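/- Let $k$ be an algebraically closed field containing $\mathbb{R}$, let $F=k((z))$, $\mathfrak{o}=k[[z]]$, $\tau=z\frac{d}{dz}$, and let $V$ be a nonzero finite-dimensional $k$-vector space; write $\hat W=F\otimes_k W$ for a $k$-vector space $W$. A flat $\mathrm{GL}(V)$-bundle $(\mathcal{G},\nabla)$ on $\operatorname{Spec}F$ is a principal $\mathrm{GL}(V)$-bundle $\mathcal{G}$ whose trivializations $\phi$ form a torsor under $\mathrm{GL}(\hat V)$, together with a matrix $[\nabla]_\phi\in\mathfrak{gl}(\hat V)\frac{dz}{z}$ for each $\phi$ such that $[\nabla]_{g\phi}=g[\nabla]_\phi g^{-1}-(dg)g^{-1}$. For an algebraic representation $(W,\rho)$ of $\mathrm{GL}(V)$, the associated flat vector bundle $(W_{\mathcal{G}},\nabla_W)$ is, in the trivialization $\phi$, $(\hat W,\,d+\rho([\nabla]_\phi))$. A flat vector bundle $(U,\nabla)$ over $F$ is regular singular if some $\mathfrak{o}$-lattice $L\subset U$ satisfies $\nabla(L)\subset L\frac{dz}{z}$; then its slope is $0$. Otherwise its slope is the positive rational number $r$ such that, writing $\nabla_\tau$ for the contraction of $\nabla$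 with $\tau$, the set $\{v(\nabla_\tau^i\mathbf{e})+ri : i>0\}$ is bounded, for $\mathbf{e}$ a basis of $U$ and $v(\mathbf{e}')$ the greatest $m$ with $\mathbf{e}'\subset z^mL$, $L$ a lattice. The bundle $(\mathcal{G},\nabla)$ is regular singular if $(W_{\mathcal{G}},\nabla_W)$ is regular singular for every finite-dimensional algebraic representation $W$ of $\mathrm{GL}(V)$. Let $\mathcal{B}$ be the enlarged Bruhat–Tits building of $\mathrm{GL}(V)$ over $F$. A point $x\in\mathcal{B}$ has Moy–Prasad filtrations $\{\hat W_{x,r}\}_{r\in\mathbb{R}}$ on $\hat W$ for all finite-dimensional representations $W$, and $\{\mathfrak{gl}(\hat V)_{x,r}\}$ on $\mathfrak{gl}(\hat V)$; a subscript $r+$ denotes the union over all indices $>r$. A stratum of depth $r\ge 0$ is a triple $(x,r,\beta)$ with $\beta$ a $k$-linear functional on $\mathfrak{gl}(\hat V)_{x,r}/\mathfrak{gl}(\hat V)_{x,r+}$. It is fundamental if $\beta$ is a semistable point for the coadjoint action of the parahoric subgroup at $x$, i.e. $0$ is not in the Zariski closure of its orbit. It is contained in $(\mathcal{G},\nabla)$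 if, for some trivialization $\phi$ and some $X\in\mathfrak{gl}(\hat V)_{x,-r}$ with $\beta(Y)=\operatorname{Res}\operatorname{Tr}(XY)\frac{dz}{z}$ for all $Y\in\mathfrak{gl}(\hat V)_{x,r}$, one has $$\Bigl(d+\rho([\nabla]_\phi)-i\tfrac{dz}{z}-\rho(X)\tfrac{dz}{z}\Bigr)\hat W_{x,i}\subset \hat W_{x,(i-r)+}\tfrac{dz}{z}$$ for all $i\in\mathbb{R}$ and all finite-dimensional algebraic representations $(W,\rho)$ of $\mathrm{GL}(V)$. The slope of $(\mathcal{G},\nabla)$ is the depth of any fundamental stratum contained in it. **Corollary.** For every flat $\mathrm{GL}(V)$-bundle $(\mathcal{G},\nabla)$, both the slope of $(\mathcal{G},\nabla)$ and the slope of the flat vector bundle $(V_{\mathcal{G}},\nabla_V)$ associated to the standard representation $V$ are well defined (each exists and is unique), and they are equal. In particular, $(\mathcal{G},\nabla)$ is regular singular if and only if $(V_{\mathcal{G}},\nabla_V)$ is regular singular. -/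

import Mathlib

open scoped TensorProduct PowerSeries
universe u

noncomputable section

/-- The field `F = k((z))` of formal Laurent series. (A type synonym of Mathlib's `LaurentSeries k`
which carries the `k`-algebra structure and the `k⟦z⟧`-algebra structure.) -/
def LF (k : Type u) [Field k] : Type u := LaurentSeries k

namespace LF

variable {k : Type u} [Field k]

/-- `z * df/dz` for a Laurent series. -/
def eulerDeriv (f : LaurentSeries k) : LaurentSeries k :=
  HahnSeries.single 1 1 * LaurentSeries.derivative k f

theorem eulerDeriv_coeff (f : LaurentSeries k) (n : ℤ) :
    (eulerDeriv f).coeff n = (n : k) * f.coeff n := by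
  have := HahnSeries.coeff_single_mul_add (Γ := ℤ) (r := (1 : k))
    (x := LaurentSeries.derivative k f) (a := n - 1) (b := 1)
  rw [sub_add_cancel, one_mul] at this
  rw [eulerDeriv, this, LaurentSeries.derivative_apply, LaurentSeries.hasseDeriv_coeff]
  simp

theorem eulerDeriv_mul (f g : LaurentSeries k) :
    eulerDeriv (f * g) = eulerDeriv f * g + f * eulerDeriv g := by
  ext n
  have hs : ∀ h : LaurentSeries k, (eulerDeriv h).support ⊆ h.support := by
    intro h m hm h0
    apply hm
    rw [eulerDeriv_coeff, h0, mul_zero]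
  rw [HahnSeries.coeff_add, HahnSeries.coeff_mul_left' f.isPWO_support (hs f),
    HahnSeries.coeff_mul_right' g.isPWO_support (hs g), eulerDeriv_coeff, HahnSeries.coeff_mul,
    Finset.mul_sum, ← Finset.sum_add_distrib]
  refine Finset.sum_congr rfl fun ij hij => ?_
  have hn : ij.1 + ij.2 = n := (Finset.mem_antidiagonal.1 hij).2.2
  rw [eulerDeriv_coeff, eulerDeriv_coeff, ← hn]
  push_cast
  ring

instance instField : Field (LF k) := inferInstanceAs (Field (LaurentSeries k))

instance instAlgebraConst : Algebra k (LF k) where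
  smul c f := let f' : LaurentSeries k := f; (c • f' : LaurentSeries k)
  algebraMap := (HahnSeries.C : k →+* LaurentSeries k)
  commutes' _ _ := mul_comm (G := LaurentSeries k) _ _
  smul_def' c f := (HahnSeries.C_mul_eq_smul (Γ := ℤ) (r := c) (x := f)).symm

instance instAlgebraInt : Algebra k⟦X⟧ (LF k) :=
  inferInstanceAs (Algebra k⟦X⟧ (LaurentSeries k))

/-- The coefficient of `z ^ n`. -/
def coeff (f : LF k) (n : ℤ) : k := HahnSeries.coeff f n

/-- The monomial `z ^ n`. -/
def zpow (n : ℤ) : LF k := (HahnSeries.single n (1 : k) : LaurentSeries k)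

/-- The derivation `τ = z d/dz` of `F`. -/
def tau : LF k →ₗ[k] LF k where
  toFun f := eulerDeriv f
  map_add' f g := HahnSeries.ext (funext fun n => by
    have h : ∀ a b : LaurentSeries k,
        (eulerDeriv (a + b)).coeff n = (eulerDeriv a + eulerDeriv b).coeff n := fun a b => by
      rw [HahnSeries.coeff_add]; simp only [eulerDeriv_coeff, HahnSeries.coeff_add, mul_add]
    exact h f g)
  map_smul' c f := HahnSeries.ext (funext fun n => by
    have h : ∀ a : LaurentSeries k,
        (eulerDeriv (c • a)).coeff n = (c • eulerDeriv a).coeff n := fun a => by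
      rw [HahnSeries.coeff_smul]
      simp only [eulerDeriv_coeff, HahnSeries.coeff_smul, smul_eq_mul]; ring
    exact h f)

theorem tau_mul (f g : LF k) : tau (f * g) = tau f * g + f * tau g := eulerDeriv_mul f g

theorem tau_coeff (f : LF k) (n : ℤ) : (tau f).coeff n = (n : k) * f.coeff n :=
  eulerDeriv_coeff f n

end LF

/-! ### Algebraic representations of `GL(V)` -/

/-- The map `R ⊗ V → S ⊗ V` induced by a `k`-linear map `R → S`. -/
abbrev bc {k : Type u} [Field k] {R S : Type u} [CommRing R] [Algebra k R] [CommRing S]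
    [Algebra k S] (V : Type u) [AddCommGroup V] [Module k V] (f : R →ₗ[k] S) :
    R ⊗[k] V →ₗ[k] S ⊗[k] V :=
  f.rTensor V

/-- An algebraic representation of the algebraic group `GL(V)` over `k` on the vector space `W`:
a homomorphism of group functors `GL(V) → GL(W)`, i.e. a family of group homomorphisms
`GL(R ⊗ V) → GL(R ⊗ W)`, for commutative `k`-algebras `R`, which is natural in `R`. (An
automorphism `h` of `S ⊗ V` is the base change of `g` along `f : R → S` iff `h ∘ f = f ∘ g`.) -/
structure AlgRep (k V W : Type u) [Field k] [AddCommGroup V] [Module k V] [AddCommGroup W]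
    [Module k W] where
  /-- the action of the `R`-points -/
  act : ∀ (R : Type u) [CommRing R] [Algebra k R],
    LinearMap.GeneralLinearGroup R (R ⊗[k] V) →* LinearMap.GeneralLinearGroup R (R ⊗[k] W)
  natural : ∀ (R S : Type u) [CommRing R] [Algebra k R] [CommRing S] [Algebra k S]
    (f : R →ₐ[k] S) (g : LinearMap.GeneralLinearGroup R (R ⊗[k] V))
    (h : LinearMap.GeneralLinearGroup S (S ⊗[k] V)),
    (∀ v, h.1 (bc V f.toLinearMap v) = bc V f.toLinearMap (g.1 v)) →
    ∀ w, (act S h).1 (bc W f.toLinearMap w) = bc W f.toLinearMap ((act R g).1 w)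

/-- The standard representation of `GL(V)` on `V`. -/
def AlgRep.std (k V : Type u) [Field k] [AddCommGroup V] [Module k V] : AlgRep k V V where
  act _ _ _ := MonoidHom.id _
  natural _ _ _ _ _ _ _ _ _ hgh := hgh

namespace AlgRep

section differential

variable {k V W : Type u} [Field k] [AddCommGroup V] [Module k V] [AddCommGroup W] [Module k W]
variable (R : Type u) [CommRing R] [Algebra k R]

/-- `r ↦ r`, as a `k`-linear map `R → R[ε]`. -/
def inl : R →ₗ[k] DualNumber R := (TrivSqZeroExt.inlAlgHom k R R).toLinearMap

/-- `r ↦ r ε`, as a `k`-linear map `R → R[ε]`. -/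
def inr : R →ₗ[k] DualNumber R := (TrivSqZeroExt.inrHom R R).restrictScalars k

/-- `r + s ε ↦ r`, as a `k`-algebra homomorphism `R[ε] → R`. -/
def fst : DualNumber R →ₐ[k] R := TrivSqZeroExt.fstHom k R R

/-- `r + s ε ↦ s`, as a `k`-linear map `R[ε] → R`. -/
def snd : DualNumber R →ₗ[k] R := (TrivSqZeroExt.sndHom R R).restrictScalars k

variable {R}

/-- The endomorphism `ε X` of `R[ε] ⊗ V`, for an endomorphism `X` of `R ⊗ V`. -/
def epsEnd (X : Module.End R (R ⊗[k] V)) : Module.End (DualNumber R) (DualNumber R ⊗[k] V) :=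
  LinearMap.liftBaseChange (DualNumber R)
    (bc V (inr R) ∘ₗ X.restrictScalars k ∘ₗ TensorProduct.mk k R V 1)

theorem bc_inr_smul (r : R) (x : R ⊗[k] V) :
    bc V (inr R) (r • x) = (TrivSqZeroExt.inl r : DualNumber R) • bc V (inr R) x := by
  induction x with
  | zero => simp
  | add x y hx hy => rw [smul_add, map_add, map_add, smul_add, hx, hy]
  | tmul s v =>
    have h : inr R (k := k) (r • s) = (TrivSqZeroExt.inl r : DualNumber R) • inr R (k := k) s := by
      ext <;> simp [inr, mul_comm]
    rw [TensorProduct.smul_tmul']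
    simp only [bc, LinearMap.rTensor_tmul]
    rw [h, TensorProduct.smul_tmul']

theorem inr_smul_bc_inr (r : R) (x : R ⊗[k] V) :
    (TrivSqZeroExt.inr r : DualNumber R) • bc V (inr R) x = 0 := by
  induction x with
  | zero => simp
  | add x y hx hy => rw [map_add, smul_add, hx, hy, add_zero]
  | tmul s v =>
    simp [bc, inr, TensorProduct.smul_tmul']

theorem epsEnd_inl (X : Module.End R (R ⊗[k] V)) (x : R ⊗[k] V) :
    epsEnd X (bc V (inl R) x) = bc V (inr R) (X x) := by
  induction x with
  | zero => simp
  | add x y hx hy => rw [map_add, map_add, map_add, map_add, hx, hy]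
  | tmul s v =>
    have h : X (s ⊗ₜ v) = s • X (1 ⊗ₜ v) := by
      rw [← map_smul, TensorProduct.smul_tmul', smul_eq_mul, mul_one]
    rw [h, bc_inr_smul]
    rfl

theorem epsEnd_inr (X : Module.End R (R ⊗[k] V)) (x : R ⊗[k] V) :
    epsEnd X (bc V (inr R) x) = 0 := by
  induction x with
  | zero => simp
  | add x y hx hy => rw [map_add, map_add, hx, hy, add_zero]
  | tmul s v => exact inr_smul_bc_inr s (X (1 ⊗ₜ v))

/-- Two `R[ε]`-linear endomorphisms agree if they agree on `R ⊗ V`. -/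
theorem end_ext {A B : Module.End (DualNumber R) (DualNumber R ⊗[k] V)}
    (h : ∀ x : R ⊗[k] V, A (bc V (inl R) x) = B (bc V (inl R) x)) : A = B := by
  apply LinearMap.ext
  intro y
  induction y with
  | zero => simp
  | add x y hx hy => rw [map_add, map_add, hx, hy]
  | tmul s v =>
    have h1 : (s ⊗ₜ[k] v : DualNumber R ⊗[k] V) = s • bc V (inl R) (1 ⊗ₜ v) := by
      simp [bc, inl, TensorProduct.smul_tmul']
    rw [h1, map_smul, map_smul, h]

theorem epsEnd_mul (X Y : Module.End R (R ⊗[k] V)) : epsEnd X * epsEnd Y = 0 :=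
  end_ext fun x => by
    rw [Module.End.mul_apply, epsEnd_inl, epsEnd_inr, LinearMap.zero_apply]

theorem epsEnd_add (X Y : Module.End R (R ⊗[k] V)) : epsEnd (X + Y) = epsEnd X + epsEnd Y :=
  end_ext fun x => by
    rw [LinearMap.add_apply, epsEnd_inl, epsEnd_inl, epsEnd_inl, LinearMap.add_apply, map_add]

theorem epsEnd_zero : epsEnd (0 : Module.End R (R ⊗[k] V)) = 0 :=
  end_ext fun x => by
    rw [LinearMap.zero_apply, epsEnd_inl, LinearMap.zero_apply, map_zero]

theorem one_add_epsEnd_mul (X Y : Module.End R (R ⊗[k] V)) :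
    (1 + epsEnd X) * (1 + epsEnd Y) = 1 + epsEnd (X + Y) := by
  rw [add_mul, mul_add, mul_add, epsEnd_mul, epsEnd_add, one_mul, mul_one, one_mul]
  abel

/-- The element `1 + ε X` of `GL(R[ε] ⊗ V)`. -/
def oneAddEps (X : Module.End R (R ⊗[k] V)) :
    LinearMap.GeneralLinearGroup (DualNumber R) (DualNumber R ⊗[k] V) where
  val := 1 + epsEnd X
  inv := 1 + epsEnd (-X)
  val_inv := by rw [one_add_epsEnd_mul, show X + -X = 0 from add_neg_cancel X, epsEnd_zero, add_zero]
  inv_val := by rw [one_add_epsEnd_mul, show -X + X = 0 from neg_add_cancel X, epsEnd_zero, add_zero]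

theorem oneAddEps_add (X Y : Module.End R (R ⊗[k] V)) :
    oneAddEps (X + Y) = oneAddEps X * oneAddEps Y :=
  Units.ext (one_add_epsEnd_mul X Y).symm

theorem oneAddEps_inl (X : Module.End R (R ⊗[k] V)) (x : R ⊗[k] V) :
    (oneAddEps X).1 (bc V (inl R) x) = bc V (inl R) x + bc V (inr R) (X x) := by
  show (1 + epsEnd X) _ = _
  rw [LinearMap.add_apply, epsEnd_inl]; rfl

/-- The differential `dρ : gl(R ⊗ V) → gl(R ⊗ W)` of a representation, characterized by
`ρ(1 + ε X) = 1 + ε dρ(X)`. -/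
def diff (ρ : AlgRep k V W) (X : Module.End R (R ⊗[k] V)) : Module.End R (R ⊗[k] W) :=
  LinearMap.liftBaseChange R
    (bc W (snd R) ∘ₗ ((ρ.act (DualNumber R) (oneAddEps X)).1).restrictScalars k ∘ₗ
      TensorProduct.mk k (DualNumber R) W 1)

theorem bc_inl_smul (r : R) (x : R ⊗[k] V) :
    bc V (inl R) (r • x) = (TrivSqZeroExt.inl r : DualNumber R) • bc V (inl R) x := by
  induction x with
  | zero => simp
  | add x y hx hy => rw [smul_add, map_add, map_add, smul_add, hx, hy]
  | tmul s v => simp [bc, inl, TensorProduct.smul_tmul']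

theorem bc_snd_smul (r : R) (x : DualNumber R ⊗[k] V) :
    bc V (snd R) ((TrivSqZeroExt.inl r : DualNumber R) • x) = r • bc V (snd R) x := by
  induction x with
  | zero => simp
  | add x y hx hy => rw [smul_add, map_add, map_add, smul_add, hx, hy]
  | tmul s v => simp [bc, snd, TensorProduct.smul_tmul']

theorem decomp (x : DualNumber R ⊗[k] V) :
    x = bc V (inl R) (bc V (fst R).toLinearMap x) + bc V (inr R) (bc V (snd R) x) := by
  induction x with
  | zero => simp
  | add x y hx hy =>
    conv_lhs => rw [hx, hy]
    simp only [map_add]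
    abel
  | tmul s v =>
    simp only [bc, inl, inr, fst, snd, LinearMap.rTensor_tmul]
    rw [← TensorProduct.add_tmul]
    congr 1
    exact (TrivSqZeroExt.inl_fst_add_inr_snd_eq s).symm

theorem bc_fst_inl (x : R ⊗[k] V) : bc V (fst R).toLinearMap (bc V (inl R) x) = x := by
  induction x with
  | zero => simp
  | add x y hx hy => rw [map_add, map_add, hx, hy]
  | tmul s v => simp [bc, inl, fst]

theorem bc_fst_inr (x : R ⊗[k] V) : bc V (fst R).toLinearMap (bc V (inr R) x) = 0 := by
  induction x with
  | zero => simp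
  | add x y hx hy => rw [map_add, map_add, hx, hy, add_zero]
  | tmul s v => simp [bc, inr, fst]

theorem bc_snd_inl (x : R ⊗[k] V) : bc V (snd R) (bc V (inl R) x) = 0 := by
  induction x with
  | zero => simp
  | add x y hx hy => rw [map_add, map_add, hx, hy, add_zero]
  | tmul s v => simp [bc, inl, snd]

theorem bc_snd_inr (x : R ⊗[k] V) : bc V (snd R) (bc V (inr R) x) = x := by
  induction x with
  | zero => simp
  | add x y hx hy => rw [map_add, map_add, hx, hy]
  | tmul s v => simp [bc, inr, snd]

theorem oneAddEps_inr (X : Module.End R (R ⊗[k] V)) (x : R ⊗[k] V) :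
    (oneAddEps X).1 (bc V (inr R) x) = bc V (inr R) x := by
  show (1 + epsEnd X) _ = _
  rw [LinearMap.add_apply, epsEnd_inr, add_zero]; rfl

theorem bc_snd_act (ρ : AlgRep k V W) (X : Module.End R (R ⊗[k] V)) (w : R ⊗[k] W) :
    bc W (snd R) ((ρ.act (DualNumber R) (oneAddEps X)).1 (bc W (inl R) w)) = diff ρ X w := by
  induction w with
  | zero => simp
  | add x y hx hy => rw [map_add, map_add, map_add, map_add, hx, hy]
  | tmul s v =>
    have h : (s ⊗ₜ[k] v : R ⊗[k] W) = s • (1 ⊗ₜ v) := by simp [TensorProduct.smul_tmul']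
    rw [h, bc_inl_smul, map_smul, bc_snd_smul, map_smul]
    congr 1
    rw [diff, LinearMap.liftBaseChange_tmul, one_smul]
    rfl

theorem act_oneAddEps (ρ : AlgRep k V W) (X : Module.End R (R ⊗[k] V)) :
    ρ.act (DualNumber R) (oneAddEps X) = oneAddEps (diff ρ X) := by
  apply Units.ext
  apply end_ext
  intro w
  rw [oneAddEps_inl, ← bc_snd_act]
  have h1 : bc W (fst R).toLinearMap
      ((ρ.act (DualNumber R) (oneAddEps X)).1 (bc W (inl R) w)) = w := by
    rw [← ρ.natural (DualNumber R) R (fst R) (oneAddEps X) 1, map_one, bc_fst_inl]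
    · rfl
    · intro v
      conv_rhs => rw [decomp v, map_add, oneAddEps_inl, oneAddEps_inr]
      simp only [map_add, bc_fst_inl, bc_fst_inr, add_zero]
      rfl
  conv_lhs => rw [decomp ((ρ.act (DualNumber R) (oneAddEps X)).1 (bc W (inl R) w)), h1]

theorem oneAddEps_injective {X Y : Module.End R (R ⊗[k] V)} (h : oneAddEps X = oneAddEps Y) :
    X = Y := by
  apply LinearMap.ext
  intro x
  have h1 := congrArg (fun g => bc V (snd R) (g.1 (bc V (inl R) x))) h
  simpa only [oneAddEps_inl, map_add, bc_snd_inl, bc_snd_inr, zero_add] using h1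

theorem diff_add (ρ : AlgRep k V W) (X Y : Module.End R (R ⊗[k] V)) :
    diff ρ (X + Y) = diff ρ X + diff ρ Y := by
  apply oneAddEps_injective
  rw [← act_oneAddEps, oneAddEps_add, map_mul, act_oneAddEps, act_oneAddEps, oneAddEps_add]

end differential

end AlgRep

namespace AlgRep

section basechange

variable {k V W : Type u} [Field k] [AddCommGroup V] [Module k V] [AddCommGroup W] [Module k W]
variable {R S : Type u} [CommRing R] [Algebra k R] [CommRing S] [Algebra k S]

theorem bc_algHom_smul (f : R →ₐ[k] S) (r : R) (x : R ⊗[k] V) :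
    bc V f.toLinearMap (r • x) = f r • bc V f.toLinearMap x := by
  induction x with
  | zero => simp
  | add x y hx hy => rw [smul_add, map_add, map_add, smul_add, hx, hy]
  | tmul s v => simp [bc, TensorProduct.smul_tmul']

/-- The base change of an endomorphism along `f : R → S`. -/
def bcEnd (f : R →ₐ[k] S) (g : Module.End R (R ⊗[k] V)) : Module.End S (S ⊗[k] V) :=
  LinearMap.liftBaseChange S
    (bc V f.toLinearMap ∘ₗ g.restrictScalars k ∘ₗ TensorProduct.mk k R V 1)

theorem bcEnd_bc (f : R →ₐ[k] S) (g : Module.End R (R ⊗[k] V)) (x : R ⊗[k] V) :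
    bcEnd f g (bc V f.toLinearMap x) = bc V f.toLinearMap (g x) := by
  induction x with
  | zero => simp
  | add x y hx hy => rw [map_add, map_add, map_add, map_add, hx, hy]
  | tmul s v =>
    have h : (s ⊗ₜ[k] v : R ⊗[k] V) = s • (1 ⊗ₜ v) := by simp [TensorProduct.smul_tmul']
    rw [h, bc_algHom_smul, map_smul, map_smul g, bc_algHom_smul]
    congr 1
    rw [bc, LinearMap.rTensor_tmul, AlgHom.toLinearMap_apply, map_one, bcEnd,
      LinearMap.liftBaseChange_tmul, one_smul]
    rfl

theorem bcEnd_ext (f : R →ₐ[k] S) {A B : Module.End S (S ⊗[k] V)}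
    (h : ∀ x : R ⊗[k] V, A (bc V f.toLinearMap x) = B (bc V f.toLinearMap x)) : A = B := by
  apply LinearMap.ext
  intro y
  induction y with
  | zero => simp
  | add x y hx hy => rw [map_add, map_add, hx, hy]
  | tmul s v =>
    have h1 : (s ⊗ₜ[k] v : S ⊗[k] V) = s • bc V f.toLinearMap (1 ⊗ₜ v) := by
      simp [bc, TensorProduct.smul_tmul']
    rw [h1, map_smul, map_smul, h]

/-- The base change of an automorphism along `f : R → S`. -/
def bcGL (f : R →ₐ[k] S) (g : LinearMap.GeneralLinearGroup R (R ⊗[k] V)) :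
    LinearMap.GeneralLinearGroup S (S ⊗[k] V) where
  val := bcEnd f g.1
  inv := bcEnd f g⁻¹.1
  val_inv := bcEnd_ext f fun x => by
    rw [Module.End.mul_apply, bcEnd_bc, bcEnd_bc, ← Module.End.mul_apply, Units.mul_inv]; rfl
  inv_val := bcEnd_ext f fun x => by
    rw [Module.End.mul_apply, bcEnd_bc, bcEnd_bc, ← Module.End.mul_apply, Units.inv_mul]; rfl

theorem bcGL_bc (f : R →ₐ[k] S) (g : LinearMap.GeneralLinearGroup R (R ⊗[k] V)) (x : R ⊗[k] V) :
    (bcGL f g).1 (bc V f.toLinearMap x) = bc V f.toLinearMap (g.1 x) :=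
  bcEnd_bc f g.1 x

theorem act_bcGL (ρ : AlgRep k V W) (f : R →ₐ[k] S)
    (g : LinearMap.GeneralLinearGroup R (R ⊗[k] V)) :
    ρ.act S (bcGL f g) = bcGL f (ρ.act R g) := by
  apply Units.ext
  apply bcEnd_ext f
  intro w
  rw [ρ.natural R S f g (bcGL f g) (bcGL_bc f g), bcGL_bc]

/-- The inclusion `R → R[ε]`. -/
abbrev inlA (k R : Type u) [Field k] [CommRing R] [Algebra k R] : R →ₐ[k] DualNumber R :=
  TrivSqZeroExt.inlAlgHom k R R

theorem bc_inr_eq (x : R ⊗[k] V) :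
    bc V (inr R) x = (TrivSqZeroExt.inr 1 : DualNumber R) • bc V (inl R) x := by
  induction x with
  | zero => simp
  | add x y hx hy => rw [map_add, map_add, smul_add, hx, hy]
  | tmul s v =>
    have h : inr R (k := k) s = (TrivSqZeroExt.inr 1 : DualNumber R) • inl R (k := k) s := by
      ext <;> simp [inr, inl]
    simp only [bc, LinearMap.rTensor_tmul]
    rw [h, TensorProduct.smul_tmul']

theorem bcGL_inl (g : LinearMap.GeneralLinearGroup R (R ⊗[k] V)) (x : R ⊗[k] V) :
    (bcGL (inlA k R) g).1 (bc V (inl R) x) = bc V (inl R) (g.1 x) :=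
  bcGL_bc (inlA k R) g x

theorem bcGL_inr (g : LinearMap.GeneralLinearGroup R (R ⊗[k] V)) (x : R ⊗[k] V) :
    (bcGL (inlA k R) g).1 (bc V (inr R) x) = bc V (inr R) (g.1 x) := by
  rw [bc_inr_eq, map_smul, bcGL_inl, bc_inr_eq]

theorem oneAddEps_conj (g : LinearMap.GeneralLinearGroup R (R ⊗[k] V))
    (X : Module.End R (R ⊗[k] V)) :
    oneAddEps (g.1 * X * g⁻¹.1) * bcGL (inlA k R) g = bcGL (inlA k R) g * oneAddEps X := by
  apply Units.ext
  apply end_ext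
  intro x
  show (oneAddEps _).1 ((bcGL (inlA k R) g).1 _) = (bcGL (inlA k R) g).1 ((oneAddEps X).1 _)
  rw [bcGL_inl, oneAddEps_inl, oneAddEps_inl, map_add, bcGL_inl, bcGL_inr]
  have h : (g.1 * X * g⁻¹.1) (g.1 x) = g.1 (X x) := by
    show (g.1 * X) ((g⁻¹.1 * g.1) x) = _
    rw [Units.inv_mul]; rfl
  rw [h]

theorem diff_conj (ρ : AlgRep k V W) (g : LinearMap.GeneralLinearGroup R (R ⊗[k] V))
    (X : Module.End R (R ⊗[k] V)) :
    diff ρ (g.1 * X * g⁻¹.1) = (ρ.act R g).1 * diff ρ X * (ρ.act R g)⁻¹.1 := by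
  apply oneAddEps_injective
  have h := congrArg (ρ.act (DualNumber R)) (oneAddEps_conj g X)
  rw [map_mul, map_mul, act_oneAddEps, act_oneAddEps, act_bcGL, ← oneAddEps_conj] at h
  exact mul_right_cancel h

end basechange

end AlgRep

/-! ### Gauge transformations -/

section gauge

variable {k V W : Type u} [Field k] [AddCommGroup V] [Module k V] [AddCommGroup W] [Module k W]

/-- The operator `τ ⊗ 1` on `F ⊗ V`. -/
def tauHat (V : Type u) [AddCommGroup V] [Module k V] : LF k ⊗[k] V →ₗ[k] LF k ⊗[k] V :=
  bc V LF.tau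

theorem tauHat_smul (f : LF k) (x : LF k ⊗[k] V) :
    tauHat V (f • x) = LF.tau f • x + f • tauHat V x := by
  induction x with
  | zero => simp
  | add x y hx hy => rw [smul_add, map_add, map_add, smul_add, hx, hy, smul_add]; abel
  | tmul s v =>
    simp only [tauHat, bc, TensorProduct.smul_tmul', LinearMap.rTensor_tmul, smul_eq_mul,
      LF.tau_mul, TensorProduct.add_tmul]

/-- The matrix `τ(g)` obtained by applying `τ` to the entries of `g`; it is the commutator of the
operators `τ ⊗ 1` and `g` on `F ⊗ V`. -/
def tauEnd (g : Module.End (LF k) (LF k ⊗[k] V)) : Module.End (LF k) (LF k ⊗[k] V) where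
  toFun x := tauHat V (g x) - g (tauHat V x)
  map_add' x y := by simp only [map_add]; abel
  map_smul' f x := by
    simp only [map_smul, tauHat_smul, map_add, RingHom.id_apply, smul_sub]; abel

/-- The Maurer–Cartan form `(dg) g⁻¹`, contracted with `τ`: the matrix `τ(g) g⁻¹`. -/
def maurerCartan (g : LinearMap.GeneralLinearGroup (LF k) (LF k ⊗[k] V)) :
    Module.End (LF k) (LF k ⊗[k] V) :=
  tauEnd g.1 * g⁻¹.1

theorem maurerCartan_apply (g : LinearMap.GeneralLinearGroup (LF k) (LF k ⊗[k] V))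
    (x : LF k ⊗[k] V) : maurerCartan g (g.1 x) = tauHat V (g.1 x) - g.1 (tauHat V x) := by
  have h : g⁻¹.1 (g.1 x) = x := by
    show (g⁻¹.1 * g.1) x = x
    rw [Units.inv_mul]; rfl
  show tauEnd g.1 (g⁻¹.1 (g.1 x)) = _
  rw [h]; rfl

/-- The `k`-algebra homomorphism `F → F[ε]`, `f ↦ f + τ(f) ε`. -/
def tauAlgHom (k : Type u) [Field k] : LF k →ₐ[k] DualNumber (LF k) :=
  AlgHom.ofLinearMap (AlgRep.inl (LF k) + AlgRep.inr (LF k) ∘ₗ LF.tau)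
    (by
      have h : LF.tau (1 : LF k) = 0 := by
        have := LF.tau_mul (1 : LF k) 1
        simpa using this
      simp [AlgRep.inl, h])
    (by
      intro f g
      ext <;> simp [AlgRep.inl, AlgRep.inr, LF.tau_mul, mul_comm, add_comm])

theorem bc_tauAlgHom (x : LF k ⊗[k] V) :
    bc V (tauAlgHom k).toLinearMap x
      = bc V (AlgRep.inl (LF k)) x + bc V (AlgRep.inr (LF k)) (tauHat V x) := by
  have h : (tauAlgHom k).toLinearMap = AlgRep.inl (LF k) + AlgRep.inr (LF k) ∘ₗ LF.tau := rfl
  rw [h, bc, LinearMap.rTensor_add, LinearMap.rTensor_comp]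
  rfl

theorem AlgRep.diff_maurerCartan (ρ : AlgRep k V W)
    (g : LinearMap.GeneralLinearGroup (LF k) (LF k ⊗[k] V)) (w : LF k ⊗[k] W) :
    ρ.diff (maurerCartan g) ((ρ.act (LF k) g).1 w) + (ρ.act (LF k) g).1 (tauHat W w)
      = tauHat W ((ρ.act (LF k) g).1 w) := by
  have h := ρ.natural (LF k) (DualNumber (LF k)) (tauAlgHom k) g
    (oneAddEps (maurerCartan g) * bcGL (inlA k (LF k)) g) (fun v => by
      show (oneAddEps _).1 ((bcGL (inlA k (LF k)) g).1 _) = _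
      rw [bc_tauAlgHom, bc_tauAlgHom, map_add, bcGL_inl, bcGL_inr, map_add, oneAddEps_inl,
        oneAddEps_inr, maurerCartan_apply, map_sub]
      abel) w
  rw [map_mul, act_oneAddEps, act_bcGL, bc_tauAlgHom, bc_tauAlgHom] at h
  change (oneAddEps _).1 ((bcGL (inlA k (LF k)) _).1 _) = _ at h
  rw [map_add, bcGL_inl, bcGL_inr, map_add, oneAddEps_inl, oneAddEps_inr] at h
  have h2 := congrArg (bc W (snd (LF k))) h
  simpa only [map_add, bc_snd_inl, bc_snd_inr, zero_add] using h2

end gauge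

/-! ### Flat vector bundles on the formal punctured disk -/

/-- A connection `∇` on an `F`-vector space `U`, given by the operator `ι_τ ∘ ∇ : U → U` obtained
by contracting with `τ = z d/dz` (so `∇ u = op u · dz/z`). Such an operator is `k`-linear by the
Leibniz rule, since `τ` kills `k`. -/
structure FlatConn (k : Type u) [Field k] (U : Type u) [AddCommGroup U] [Module (LF k) U] where
  op : U →+ U
  leibniz : ∀ (f : LF k) (u : U), op (f • u) = LF.tau f • u + f • op u

namespace FlatConn

variable {k : Type u} [Field k] {U : Type u} [AddCommGroup U] [Module (LF k) U]
  [Module k⟦X⟧ U] [IsScalarTower k⟦X⟧ (LF k) U]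

/-- `(U, ∇)` is regular singular if some `k⟦z⟧`-lattice `L ⊂ U` satisfies `(ι_τ ∘ ∇)(L) ⊂ L`. -/
def RegularSingular (D : FlatConn k U) : Prop :=
  ∃ L : Submodule k⟦X⟧ U, Submodule.IsLattice (LF k) L ∧ ∀ u ∈ L, D.op u ∈ L

/-- `r` is the slope of `(U, ∇)`. A regular singular `(U, ∇)` has slope `0`. An irregular singular
one has slope `r`, where `r` is a positive rational number, if the numbers
`v((ι_τ ∘ ∇)^i e) + r i`, `i > 0`, are bounded; here `e` is a basis of `U`, and for a finite family
`e'` in `U`, `v(e')` is the greatest integer `m` with `e' ⊂ z ^ m L`, for a lattice `L`. -/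
def HasSlope (D : FlatConn k U) (r : ℝ) : Prop :=
  (D.RegularSingular ∧ r = 0) ∨
  (¬ D.RegularSingular ∧ 0 < r ∧ (∃ q : ℚ, (q : ℝ) = r) ∧
    ∀ L : Submodule k⟦X⟧ U, Submodule.IsLattice (LF k) L →
    ∀ (n : ℕ) (e : Module.Basis (Fin n) (LF k) U),
    ∃ (v : ℕ → ℤ) (C : ℝ), ∀ i : ℕ, 0 < i →
      IsGreatest {m : ℤ | ∀ j, (LF.zpow (-m) : LF k) • (D.op^[i] (e j)) ∈ L} (v i) ∧
      |(v i : ℝ) + r * i| ≤ C)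

end FlatConn

/-! ### Flat `GL(V)`-bundles on the formal punctured disk -/

/-- The group `GL(V)(F) = GL(F ⊗ V)`. -/
abbrev GLhat (k V : Type u) [Field k] [AddCommGroup V] [Module k V] : Type u :=
  LinearMap.GeneralLinearGroup (LF k) (LF k ⊗[k] V)

/-- A flat `GL(V)`-bundle on `Spec F`. A principal bundle is given by the set of its
trivializations `φ`, a torsor under `GL(V)(F)`. A flat structure `∇` assigns to each trivialization
`φ` the matrix `[∇]_φ = conn φ · dz/z` of the connection, subject to the gauge transformation rule
`[∇]_{g φ} = g [∇]_φ g⁻¹ - (dg) g⁻¹`. -/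
structure FlatGLBundle (k V : Type u) [Field k] [AddCommGroup V] [Module k V] where
  /-- the set of trivializations -/
  Triv : Type u
  [mulAction : MulAction (GLhat k V) Triv]
  nonempty : Nonempty Triv
  simply_transitive : ∀ φ ψ : Triv, ∃! g : GLhat k V, g • φ = ψ
  /-- the matrix of the connection, contracted with `τ` -/
  conn : Triv → Module.End (LF k) (LF k ⊗[k] V)
  gauge : ∀ (g : GLhat k V) (φ : Triv),
    conn (g • φ) = g.1 * conn φ * g⁻¹.1 - maurerCartan g

namespace FlatGLBundle

variable {k V : Type u} [Field k] [AddCommGroup V] [Module k V]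

instance (P : FlatGLBundle k V) : MulAction (GLhat k V) P.Triv := P.mulAction

variable {W : Type u} [AddCommGroup W] [Module k W]

/-- The vector bundle associated to a representation `(W, ρ)`: a section `s` is the compatible
family of its expressions `s φ ∈ F ⊗ W` in the trivializations `φ`. -/
def assocSpace (P : FlatGLBundle k V) (ρ : AlgRep k V W) :
    Submodule (LF k) (P.Triv → LF k ⊗[k] W) where
  carrier := {s | ∀ (g : GLhat k V) (φ : P.Triv), s (g • φ) = (ρ.act (LF k) g).1 (s φ)}
  add_mem' hs ht g φ := by rw [Pi.add_apply, hs g φ, ht g φ, Pi.add_apply, map_add]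
  zero_mem' g φ := by rw [Pi.zero_apply, Pi.zero_apply, map_zero]
  smul_mem' f s hs g φ := by rw [Pi.smul_apply, hs g φ, Pi.smul_apply, map_smul]

theorem assoc_equivariant (P : FlatGLBundle k V) (ρ : AlgRep k V W) (g : GLhat k V)
    (φ : P.Triv) (w : LF k ⊗[k] W) :
    tauHat W ((ρ.act (LF k) g).1 w) + ρ.diff (P.conn (g • φ)) ((ρ.act (LF k) g).1 w)
      = (ρ.act (LF k) g).1 (tauHat W w + ρ.diff (P.conn φ) w) := by
  have h : P.conn (g • φ) + maurerCartan g = g.1 * P.conn φ * g⁻¹.1 := by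
    rw [P.gauge]; exact sub_add_cancel (g.1 * P.conn φ * g⁻¹.1) (maurerCartan g)
  have h1 := congrArg (fun X => ρ.diff X ((ρ.act (LF k) g).1 w)) h
  simp only [AlgRep.diff_add, AlgRep.diff_conj, LinearMap.add_apply] at h1
  have h2 : ((ρ.act (LF k) g).1 * ρ.diff (P.conn φ) * (ρ.act (LF k) g)⁻¹.1)
      ((ρ.act (LF k) g).1 w) = (ρ.act (LF k) g).1 (ρ.diff (P.conn φ) w) := by
    show ((ρ.act (LF k) g).1 * ρ.diff (P.conn φ))
      (((ρ.act (LF k) g)⁻¹.1 * (ρ.act (LF k) g).1) w) = _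
    rw [Units.inv_mul]; rfl
  rw [← AlgRep.diff_maurerCartan ρ g w, map_add, ← h2, ← h1]
  abel

/-- The flat vector bundle `(W_𝒢, ∇_W)` associated to a representation `(W, ρ)`. In the
trivialization `φ` it is `(F ⊗ W, d + ρ([∇]_φ))`. -/
def assoc (P : FlatGLBundle k V) (ρ : AlgRep k V W) : FlatConn k (P.assocSpace ρ) where
  op :=
    { toFun := fun s =>
        ⟨fun φ => tauHat W (s.1 φ) + ρ.diff (P.conn φ) (s.1 φ), fun g φ => by
          show tauHat W (s.1 (g • φ)) + ρ.diff (P.conn (g • φ)) (s.1 (g • φ)) = _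
          rw [s.2 g φ, assoc_equivariant]⟩
      map_zero' := Subtype.ext (funext fun φ => by
        show tauHat W (0 : LF k ⊗[k] W) + ρ.diff (P.conn φ) 0 = 0
        rw [map_zero, map_zero, add_zero])
      map_add' := fun s t => Subtype.ext (funext fun φ => by
        show tauHat W (s.1 φ + t.1 φ) + ρ.diff (P.conn φ) (s.1 φ + t.1 φ)
          = (tauHat W (s.1 φ) + ρ.diff (P.conn φ) (s.1 φ))
            + (tauHat W (t.1 φ) + ρ.diff (P.conn φ) (t.1 φ))
        rw [map_add, map_add]; abel) }
  leibniz f s := Subtype.ext (funext fun φ => by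
    show tauHat W (f • s.1 φ) + ρ.diff (P.conn φ) (f • s.1 φ)
      = LF.tau f • s.1 φ + f • (tauHat W (s.1 φ) + ρ.diff (P.conn φ) (s.1 φ))
    rw [tauHat_smul, map_smul, smul_add]; abel)

/-- A flat `GL(V)`-bundle is regular singular if all associated flat vector bundles are. -/
def RegularSingular (P : FlatGLBundle k V) : Prop :=
  ∀ (W : Type u) [AddCommGroup W] [Module k W] [FiniteDimensional k W] (ρ : AlgRep k V W),
    (P.assoc ρ).RegularSingular

end FlatGLBundle

/-! ### Moy–Prasad filtrations and the building -/

section building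

variable {k V : Type u} [Field k] [AddCommGroup V] [Module k V] {n : ℕ}
  (b : Module.Basis (Fin n) k V)

/-- The element of the maximal torus `T ⊂ GL(V)`, diagonal in the basis `b`, with entries `t i`. -/
def torusElt (t : Fin n → kˣ) : LinearMap.GeneralLinearGroup k (k ⊗[k] V) :=
  LinearMap.GeneralLinearGroup.ofLinearEquiv
    ((b.baseChange k).equiv ((b.baseChange k).unitsSMul t) (Equiv.refl (Fin n)))

variable {W : Type u} [AddCommGroup W] [Module k W]

/-- The weight space `W_χ` of a representation, for the character `t ↦ ∏ i, (t i) ^ (χ i)`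
of `T`. -/
def weightSpace (ρ : AlgRep k V W) (χ : Fin n → ℤ) : Submodule k W where
  carrier := {w | ∀ t : Fin n → kˣ, (ρ.act k (torusElt b t)).1 (1 ⊗ₜ w)
    = 1 ⊗ₜ (((∏ i, t i ^ χ i : kˣ) : k) • w)}
  add_mem' hv hw t := by
    rw [TensorProduct.tmul_add, map_add, hv t, hw t, smul_add, TensorProduct.tmul_add]
  zero_mem' t := by simp
  smul_mem' c w hw t := by
    rw [← TensorProduct.smul_tmul, ← TensorProduct.smul_tmul', map_smul, hw t, smul_comm,
      TensorProduct.smul_tmul', TensorProduct.smul_tmul]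

/-- For a point `a ∈ X_*(T) ⊗ ℝ = ℝⁿ` of the standard apartment, the lattice
`∏_{χ(a) + m ≥ r} W_χ z ^ m ⊂ F ⊗ W`. -/
def stdFilt (ρ : AlgRep k V W) (a : Fin n → ℝ) (r : ℝ) : Submodule k⟦X⟧ (LF k ⊗[k] W) :=
  Submodule.span k⟦X⟧ {y | ∃ (χ : Fin n → ℤ) (m : ℤ), r ≤ (∑ i, (χ i : ℝ) * a i) + m ∧
    ∃ w ∈ weightSpace b ρ χ, y = LF.zpow m ⊗ₜ w}

/-- The Moy–Prasad lattice `(F ⊗ W)_{g a, r} = g (F ⊗ W)_{a, r}`. -/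
def preFilt (p : GLhat k V × (Fin n → ℝ)) (ρ : AlgRep k V W) (r : ℝ) :
    Submodule k⟦X⟧ (LF k ⊗[k] W) :=
  (stdFilt b ρ p.2 r).map ((ρ.act (LF k) p.1).1.restrictScalars k⟦X⟧)

/-- Two pairs `(g, a)` define the same point of the building iff they define the same filtration on
all representations. -/
def buildingSetoid : Setoid (GLhat k V × (Fin n → ℝ)) where
  r p q := ∀ (W : Type u) [AddCommGroup W] [Module k W] [FiniteDimensional k W]
    (ρ : AlgRep k V W) (r : ℝ), preFilt b p ρ r = preFilt b q ρ r
  iseqv :=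
    { refl := fun _ _ _ _ _ _ _ => rfl
      symm := fun h W _ _ _ ρ r => (h W ρ r).symm
      trans := fun h h' W _ _ _ ρ r => (h W ρ r).trans (h' W ρ r) }

/-- The (enlarged) Bruhat–Tits building of `GL(V)` over `F`: the points `g a` with `g ∈ GL(V)(F)`
and `a` in the standard apartment `ℝⁿ`. -/
def Building : Type u := Quotient (buildingSetoid b)

namespace Building

variable {b}

/-- The Moy–Prasad filtration `(F ⊗ W)_{x, r}`. -/
def filt [FiniteDimensional k W] (x : Building b) (ρ : AlgRep k V W) (r : ℝ) :
    Submodule k⟦X⟧ (LF k ⊗[k] W) :=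
  Quotient.lift (fun p => preFilt b p ρ r) (fun p q (h : (buildingSetoid b).r p q) => h W ρ r) x

/-- `(F ⊗ W)_{x, r+}`, the union of the `(F ⊗ W)_{x, s}` with `s > r`. -/
def filtPlus [FiniteDimensional k W] (x : Building b) (ρ : AlgRep k V W) (r : ℝ) :
    Submodule k⟦X⟧ (LF k ⊗[k] W) :=
  ⨆ s : {s : ℝ // r < s}, x.filt ρ s

variable [FiniteDimensional k V]

/-- The filtration `gl(F ⊗ V)_{x, r}`. -/
def glFilt (x : Building b) (r : ℝ) : Submodule k (Module.End (LF k) (LF k ⊗[k] V)) where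
  carrier := {X | ∀ (s : ℝ), ∀ u ∈ x.filt (AlgRep.std k V) s,
    X u ∈ x.filt (AlgRep.std k V) (s + r)}
  add_mem' hX hY s u hu := add_mem (hX s u hu) (hY s u hu)
  zero_mem' s u _ := zero_mem _
  smul_mem' c X hX s u hu := by
    have h : (c • X) u = (PowerSeries.C c : k⟦X⟧) • X u := by
      rw [LinearMap.smul_apply, ← algebraMap_smul (LF k) c, ← algebraMap_smul (LF k)]
      congr 1
      exact (HahnSeries.ofPowerSeries_C c).symm
    rw [h]
    exact Submodule.smul_mem _ _ (hX s u hu)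

/-- `gl(F ⊗ V)_{x, r+}`, the union of the `gl(F ⊗ V)_{x, s}` with `s > r`. -/
def glFiltPlus (x : Building b) (r : ℝ) : Submodule k (Module.End (LF k) (LF k ⊗[k] V)) :=
  ⨆ s : {s : ℝ // r < s}, x.glFilt s

instance instAddCommGroupGlFilt (x : Building b) (r : ℝ) : AddCommGroup (x.glFilt r) :=
  Module.addCommMonoidToAddCommGroup k

/-- The quotient `gl(F ⊗ V)_{x, r} / gl(F ⊗ V)_{x, r+}`. -/
abbrev Gr (x : Building b) (r : ℝ) : Type u :=
  x.glFilt r ⧸ (x.glFiltPlus r).submoduleOf (x.glFilt r)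

/-- The parahoric subgroup of `GL(V)(F)` attached to `x`. For the general linear group it is the
stabilizer of the filtration `(F ⊗ V)_{x, •}`. -/
def parahoric (x : Building b) : Subgroup (GLhat k V) where
  carrier := {g | ∀ (s : ℝ) (u : LF k ⊗[k] V),
    g.1 u ∈ x.filt (AlgRep.std k V) s ↔ u ∈ x.filt (AlgRep.std k V) s}
  one_mem' _ _ := Iff.rfl
  mul_mem' hg hh s u := (hg s _).trans (hh s u)
  inv_mem' {g} hg s u := by
    rw [← hg s (g⁻¹.1 u)]
    have h : g.1 (g⁻¹.1 u) = u := by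
      show (g.1 * g⁻¹.1) u = u
      rw [Units.mul_inv]; rfl
    rw [h]

/-- Conjugation `Ad(g) : X ↦ g X g⁻¹` on `gl(F ⊗ V)`. -/
def conj (g : GLhat k V) :
    Module.End (LF k) (LF k ⊗[k] V) →ₗ[k] Module.End (LF k) (LF k ⊗[k] V) where
  toFun X := g.1 * X * g⁻¹.1
  map_add' X Y := by rw [mul_add, add_mul]
  map_smul' c X := by
    rw [RingHom.id_apply, mul_smul_comm, smul_mul_assoc]

theorem conj_mem (x : Building b) {g : GLhat k V} (hg : g ∈ x.parahoric) {r : ℝ}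
    {X : Module.End (LF k) (LF k ⊗[k] V)} (hX : X ∈ x.glFilt r) : conj g X ∈ x.glFilt r := by
  intro s u hu
  exact (hg _ _).2 (hX s _ ((x.parahoric.inv_mem hg s u).2 hu))

theorem conj_mem_plus (x : Building b) {g : GLhat k V} (hg : g ∈ x.parahoric) {r : ℝ}
    {X : Module.End (LF k) (LF k ⊗[k] V)} (hX : X ∈ x.glFiltPlus r) :
    conj g X ∈ x.glFiltPlus r := by
  have h : x.glFiltPlus r ≤ (x.glFiltPlus r).comap (conj g) :=
    iSup_le fun s Y hY => (le_iSup (fun s : {s : ℝ // r < s} => x.glFilt s) s) (x.conj_mem hg hY)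
  exact h hX

/-- The adjoint action of the parahoric subgroup on `gl(F ⊗ V)_{x, r} / gl(F ⊗ V)_{x, r+}`. -/
def adGr (x : Building b) (r : ℝ) (g : x.parahoric) : x.Gr r →ₗ[k] x.Gr r :=
  Submodule.mapQ _ _ ((conj g.1).restrict fun _ hX => x.conj_mem g.2 hX)
    (fun Y hY => x.conj_mem_plus g.2 (X := Y.1) hY)

end Building

/-! ### Strata -/

/-- The Zariski closure of a subset of a finite-dimensional `k`-vector space. -/
def zariskiClosure {M : Type u} [AddCommGroup M] [Module k M] (S : Set M) : Set M :=
  {x | ∀ p ∈ Algebra.adjoin k (Set.range fun (l : Module.Dual k M) (y : M) => l y),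
    (∀ y ∈ S, p y = 0) → p x = 0}

variable [FiniteDimensional k V] {b}

/-- The stratum `(x, r, β)` is fundamental if `β` is a semistable point of the coadjoint
representation of the parahoric at `x` on `(gl(F ⊗ V)_{x, r} / gl(F ⊗ V)_{x, r+})^∨`, i.e. `0` is not
in the Zariski closure of its orbit. (The action factors through the reductive quotient of the
parahoric.) -/
def IsFundamental (x : Building b) (r : ℝ) (β : Module.Dual k (x.Gr r)) : Prop :=
  (0 : Module.Dual k (x.Gr r)) ∉
    zariskiClosure (k := k) (Set.range fun g : x.parahoric => β ∘ₗ x.adGr r g⁻¹)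

/-- `X dz/z`, with `X ∈ gl(F ⊗ V)_{x, -r}`, represents the functional `β` on
`gl(F ⊗ V)_{x, r} / gl(F ⊗ V)_{x, r+}` if `β(Y) = Res Tr(X Y) dz/z` for all `Y`. -/
def IsRepresentative (x : Building b) (r : ℝ) (β : Module.Dual k (x.Gr r))
    (X : Module.End (LF k) (LF k ⊗[k] V)) : Prop :=
  X ∈ x.glFilt (-r) ∧ ∀ Y : x.glFilt r,
    β (Submodule.Quotient.mk Y) = (LinearMap.trace (LF k) (LF k ⊗[k] V) (X * Y.1)).coeff 0

namespace FlatGLBundle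

variable [Algebra ℝ k]

/-- The flat `GL(V)`-bundle contains the stratum `(x, r, β)` with respect to the trivialization
`φ`: for a representative `X dz/z` of `β`, the operator `∇_φ - i dz/z - X dz/z` maps
`(F ⊗ W)_{x, i}` to `Ω¹(F ⊗ W)_{x, (i-r)+} = (F ⊗ W)_{x, (i-r)+} dz/z`, for all real `i` and all
representations `W`. -/
def ContainsStratum (P : FlatGLBundle k V) (φ : P.Triv) (x : Building b) (r : ℝ)
    (β : Module.Dual k (x.Gr r)) : Prop :=
  ∃ X, IsRepresentative x r β X ∧
    ∀ (W : Type u) [AddCommGroup W] [Module k W] [FiniteDimensional k W] (ρ : AlgRep k V W)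
      (i : ℝ), ∀ w ∈ x.filt ρ i,
      tauHat W w + ρ.diff (P.conn φ) w - algebraMap ℝ k i • w - ρ.diff X w ∈ x.filtPlus ρ (i - r)

variable (b) in
/-- `r` is a slope of the flat `GL(V)`-bundle: it is the depth of a fundamental stratum contained in
the bundle (with respect to some trivialization). -/
def HasSlope (P : FlatGLBundle k V) (r : ℝ) : Prop :=
  0 ≤ r ∧ ∃ (φ : P.Triv) (x : Building b) (β : Module.Dual k (x.Gr r)),
    IsFundamental x r β ∧ P.ContainsStratum φ x r β

end FlatGLBundle

end building

end

set_option linter.unusedSectionVars false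

noncomputable section

/-! ### Orders and coefficients of Laurent series -/

namespace LF

variable {k : Type u} [Field k]

/-! In a trivialization the standard flat bundle is `F ⊗ V` with the operator `D = τ + A`. A point
of the building is a basis of `F ⊗ V` with real weights, i.e. a filtration by lattices. If a stratum
of depth `r` is contained in the bundle, then `D` agrees with an `F`-linear `X` of depth `-r` modulo
higher depth, up to the scalar `i`, which is negligible when `r > 0` and zero on the step `i = 0`.
The stratum only sees the leading matrix `C` of `X`, a matrix over `k` on which the parahoric acts
by conjugation.

Uniqueness: a nilpotent `C` is driven to `0` by a one-parameter subgroup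
(`not_isFundamental_of_pow_eq_zero`), so a fundamental stratum has `C` non-nilpotent. If `r > 0`,
the iterate `D^i` then lowers depth by exactly `r i`, and `r` is the growth rate in the definition
of the slope of a flat vector bundle. If `r = 0`, a step of the filtration is a stable lattice. A
positive growth rate is unique and incompatible with regular singularity, so every fundamental
stratum has the same depth, namely the slope of the standard bundle (`growth_of_containsStratum`).

Existence: a cyclic vector puts the connection in companion form. With `q` the Newton slope of its
last column, the weights `-q j` give it depth `-q`. When `q > 0` the leading matrix is a companion
matrix over `k` with a nonzero coefficient, hence with a nonzero eigenvalue `μ`. The invariant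
polynomial `det (μ - C)` separates the orbit from `0`, so the stratum is fundamental
(`isFundamental_of_det_eq_zero`). When `q = 0` the connection matrix is integral: a scalar gauge
change by a power of `z` provides a nonzero eigenvalue if needed, and every associated bundle is
regular singular because the differential of a representation is already defined over `k⟦z⟧`. -/

theorem ext {f g : LF k} (h : ∀ m, f.coeff m = g.coeff m) : f = g :=
  HahnSeries.ext (funext h)

@[simp] theorem coeff_zero (m : ℤ) : (0 : LF k).coeff m = 0 := rfl

@[simp] theorem coeff_add (f g : LF k) (m : ℤ) : (f + g).coeff m = f.coeff m + g.coeff m := rfl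

@[simp] theorem coeff_neg (f : LF k) (m : ℤ) : (-f).coeff m = -f.coeff m := rfl

@[simp] theorem coeff_sub (f g : LF k) (m : ℤ) : (f - g).coeff m = f.coeff m - g.coeff m := by
  rw [sub_eq_add_neg, coeff_add, coeff_neg, sub_eq_add_neg]

@[simp] theorem coeff_smul (c : k) (f : LF k) (m : ℤ) : (c • f).coeff m = c * f.coeff m := rfl

theorem coeff_sum {ι : Type*} (s : Finset ι) (f : ι → LF k) (m : ℤ) :
    (∑ i ∈ s, f i).coeff m = ∑ i ∈ s, (f i).coeff m := by
  classical
  induction s using Finset.induction_on with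
  | empty => simp
  | insert a s ha ih => rw [Finset.sum_insert ha, Finset.sum_insert ha, coeff_add, ih]

theorem coeff_zpow (n m : ℤ) : (zpow n : LF k).coeff m = if m = n then 1 else 0 := 
  Eq.trans (HahnSeries.coeff_single (Γ := ℤ) (R := k)) (by congr)

@[simp] theorem coeff_zpow_mul (n m : ℤ) (f : LF k) :
    (zpow n * f).coeff m = f.coeff (m - n) := by
  have h := HahnSeries.coeff_single_mul_add (Γ := ℤ) (r := (1 : k)) (x := f) (a := m - n) (b := n)
  rw [sub_add_cancel, one_mul] at h
  exact h

theorem coeff_one (m : ℤ) : (1 : LF k).coeff m = if m = 0 then 1 else 0 := coeff_zpow 0 m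

theorem zpow_eq_one : (zpow 0 : LF k) = 1 := rfl

theorem zpow_mul_zpow (m n : ℤ) : (zpow m * zpow n : LF k) = zpow (m + n) :=
  ext fun l => by
    rw [coeff_zpow_mul, coeff_zpow, coeff_zpow]
    exact if_congr (by omega) rfl rfl

theorem tau_zpow (m : ℤ) : tau (zpow m : LF k) = (m : k) • zpow m :=
  ext fun l => by
    rw [tau_coeff, coeff_smul, coeff_zpow]
    split_ifs with h
    · rw [h]
    · simp

theorem tau_one : tau (1 : LF k) = 0 :=
  ext fun l => by
    rw [tau_coeff, coeff_one]
    split_ifs with h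
    · simp [h]
    · simp

/-- `f` has order at least `u`. -/
def OrdGE (f : LF k) (u : ℝ) : Prop := ∀ m : ℤ, (m : ℝ) < u → f.coeff m = 0

namespace OrdGE

variable {f g : LF k} {u v : ℝ}

theorem zero (u : ℝ) : OrdGE (0 : LF k) u := fun _ _ => rfl

theorem mono (hf : OrdGE f u) (h : v ≤ u) : OrdGE f v := fun m hm => hf m (hm.trans_le h)

theorem add (hf : OrdGE f u) (hg : OrdGE g u) : OrdGE (f + g) u := fun m hm => by
  rw [coeff_add, hf m hm, hg m hm, add_zero]

theorem smul (c : k) (hf : OrdGE f u) : OrdGE (c • f) u := fun m hm => by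
  rw [coeff_smul, hf m hm, mul_zero]

theorem sum {ι : Type*} {s : Finset ι} {f : ι → LF k} (hf : ∀ i ∈ s, OrdGE (f i) u) :
    OrdGE (∑ i ∈ s, f i) u := fun m hm => by
  rw [coeff_sum]; exact Finset.sum_eq_zero fun i hi => hf i hi m hm

theorem mul (hf : OrdGE f u) (hg : OrdGE g v) : OrdGE (f * g) (u + v) := fun m hm => by
  have h := HahnSeries.coeff_mul (Γ := ℤ) (x := f) (y := g) (a := m)
  refine h.trans (Finset.sum_eq_zero fun ij hij => ?_)
  have hs : ij.1 + ij.2 = m := (Finset.mem_antidiagonal.1 hij).2.2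
  rcases lt_or_ge (ij.1 : ℝ) u with h1 | h1
  · have : HahnSeries.coeff f ij.1 = 0 := hf _ h1
    rw [this, zero_mul]
  · have : HahnSeries.coeff g ij.2 = 0 := hg _ (by
      have : (ij.1 : ℝ) + ij.2 = m := by exact_mod_cast hs
      linarith)
    rw [this, mul_zero]

theorem tau (hf : OrdGE f u) : OrdGE (tau f) u := fun m hm => by
  rw [tau_coeff, hf m hm, mul_zero]

theorem zpow {m : ℤ} (h : u ≤ m) : OrdGE (zpow m : LF k) u := fun l hl => by
  rw [coeff_zpow, if_neg]
  rintro rfl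
  exact absurd hl (not_lt.2 h)

theorem one (h : u ≤ 0) : OrdGE (1 : LF k) u := OrdGE.zpow (m := 0) (by simpa using h)

theorem const (c : k) (h : u ≤ 0) : OrdGE (algebraMap k (LF k) c) u := by
  rw [Algebra.algebraMap_eq_smul_one]; exact (OrdGE.one h).smul c

theorem powerSeries (p : k⟦X⟧) : OrdGE (algebraMap k⟦X⟧ (LF k) p) 0 := fun m hm => by
  have hm' : m < 0 := by exact_mod_cast hm
  have h : (HahnSeries.ofPowerSeries ℤ k p).coeff m = 0 := by
    rw [HahnSeries.ofPowerSeries_apply]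
    refine HahnSeries.embDomain_of_notMem_range ?_
    rintro ⟨n, rfl⟩
    exact absurd hm' (not_lt.2 (Int.natCast_nonneg n))
  exact h

theorem exists_powerSeries (hf : OrdGE f 0) : ∃ p : k⟦X⟧, algebraMap k⟦X⟧ (LF k) p = f := by
  refine ⟨PowerSeries.mk fun n => f.coeff n, ext fun m => ?_⟩
  rcases lt_or_ge m 0 with hm | hm
  · rw [hf m (by exact_mod_cast hm), OrdGE.powerSeries _ m (by exact_mod_cast hm)]
  · lift m to ℕ using hm
    exact (HahnSeries.ofPowerSeries_apply_coeff (Γ := ℤ) _ m).trans (PowerSeries.coeff_mk _ _)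

theorem zpow_mul_iff {m : ℤ} : OrdGE (LF.zpow m * f) u ↔ OrdGE f (u - m) := by
  constructor
  · intro h l hl
    have := h (l + m) (by push_cast; linarith)
    rwa [coeff_zpow_mul, add_sub_cancel_right] at this
  · intro h l hl
    rw [coeff_zpow_mul]
    exact h _ (by push_cast; linarith)

theorem ceil (hf : OrdGE f u) : OrdGE f ⌈u⌉ := fun m hm => hf m (by
  have : m < ⌈u⌉ := by exact_mod_cast hm
  exact Int.lt_ceil.1 this)

end OrdGE

theorem coeff_order_ne_zero {f : LF k} (hf : f ≠ 0) :
    ∃ m : ℤ, f.coeff m ≠ 0 ∧ OrdGE f m :=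
  ⟨HahnSeries.order (Γ := ℤ) f,
    fun h => hf (HahnSeries.coeff_order_eq_zero.1 h),
    fun _ hl => HahnSeries.coeff_eq_zero_of_lt_order (by exact_mod_cast hl)⟩

theorem exists_ordGE (f : LF k) : ∃ c : ℕ, OrdGE f (-c) := by
  by_cases hf : f = 0
  · exact ⟨0, hf ▸ OrdGE.zero _⟩
  · obtain ⟨m, -, hm⟩ := coeff_order_ne_zero hf
    refine ⟨m.natAbs, hm.mono ?_⟩
    have : -(m.natAbs : ℤ) ≤ m := by omega
    exact_mod_cast this

theorem exists_ordGE_finite {ι : Type*} [Finite ι] (f : ι → LF k) :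
    ∃ c : ℕ, ∀ i, OrdGE (f i) (-c) := by
  have := Fintype.ofFinite ι
  choose c hc using fun i => exists_ordGE (f i)
  refine ⟨Finset.univ.sup c, fun i => (hc i).mono ?_⟩
  have : c i ≤ Finset.univ.sup c := Finset.le_sup (Finset.mem_univ i)
  exact neg_le_neg (by exact_mod_cast this)

/-! ### Coefficients at real exponents -/

/-- The coefficient of `z ^ u`, for a real exponent `u`; it is `0` if `u` is not an integer. -/
def rcoeff (f : LF k) (u : ℝ) : k := if (⌊u⌋ : ℝ) = u then f.coeff ⌊u⌋ else 0

theorem rcoeff_intCast (f : LF k) (m : ℤ) : f.rcoeff m = f.coeff m := by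
  rw [rcoeff, Int.floor_intCast, if_pos rfl]

theorem rcoeff_eq_zero_of_not_int {f : LF k} {u : ℝ} (h : ∀ m : ℤ, (m : ℝ) ≠ u) :
    f.rcoeff u = 0 := if_neg (h _)

@[simp] theorem rcoeff_zero (u : ℝ) : (0 : LF k).rcoeff u = 0 := by
  rw [rcoeff, coeff_zero, ite_self]

theorem rcoeff_add (f g : LF k) (u : ℝ) : (f + g).rcoeff u = f.rcoeff u + g.rcoeff u := by
  unfold rcoeff; split_ifs <;> simp

theorem rcoeff_smul (c : k) (f : LF k) (u : ℝ) : (c • f).rcoeff u = c * f.rcoeff u := by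
  unfold rcoeff; split_ifs <;> simp

theorem rcoeff_sum {ι : Type*} (s : Finset ι) (f : ι → LF k) (u : ℝ) :
    (∑ i ∈ s, f i).rcoeff u = ∑ i ∈ s, (f i).rcoeff u := by
  unfold rcoeff; split_ifs
  · rw [coeff_sum]
  · simp

/-- The order bounds leave only the pair of exponents `(u, v)` to contribute to the product. If `u +
v` is an integer but `u` is not, no pair contributes, which agrees with the value `0` at
non-integers. This makes leading matrices multiplicative. -/
theorem rcoeff_mul {f g : LF k} {u v : ℝ} (hf : OrdGE f u) (hg : OrdGE g v) :
    (f * g).rcoeff (u + v) = f.rcoeff u * g.rcoeff v := by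
  by_cases h : ∃ m : ℤ, (m : ℝ) = u + v
  · obtain ⟨m, hm⟩ := h
    rw [← hm, rcoeff_intCast]
    have h := HahnSeries.coeff_mul (Γ := ℤ) (x := f) (y := g) (a := m)
    refine h.trans ?_
    by_cases hu : ∃ l : ℤ, (l : ℝ) = u
    · obtain ⟨l, rfl⟩ := hu
      have hv : ((m - l : ℤ) : ℝ) = v := by push_cast; linarith
      rw [← hv, rcoeff_intCast, rcoeff_intCast]
      have key : ∀ ij ∈ Finset.antidiagonal f.isPWO_support g.isPWO_support m,
          ij ≠ (l, m - l) → HahnSeries.coeff f ij.1 * HahnSeries.coeff g ij.2 = 0 := by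
        intro ij hij hne
        have hs : ij.1 + ij.2 = m := (Finset.mem_antidiagonal.1 hij).2.2
        rcases lt_trichotomy ij.1 l with h1 | h1 | h1
        · have : HahnSeries.coeff f ij.1 = 0 := hf _ (by exact_mod_cast h1)
          rw [this, zero_mul]
        · exact absurd (Prod.ext h1 (by show ij.2 = m - l; omega)) hne
        · have : HahnSeries.coeff g ij.2 = 0 := hg _ (by
            rw [← hv]
            have : ij.2 < m - l := by omega
            exact_mod_cast this)
          rw [this, mul_zero]
      rw [Finset.sum_eq_single (l, m - l) key]
      · rfl
      · intro hn
        by_contra h0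
        apply hn
        rw [Finset.mem_antidiagonal]
        exact ⟨left_ne_zero_of_mul h0, right_ne_zero_of_mul h0, by show l + (m - l) = m; omega⟩
    · push Not at hu
      rw [rcoeff_eq_zero_of_not_int hu, zero_mul]
      refine Finset.sum_eq_zero fun ij hij => ?_
      have hs : (ij.1 : ℝ) + ij.2 = m := by exact_mod_cast (Finset.mem_antidiagonal.1 hij).2.2
      rcases lt_or_gt_of_ne (hu ij.1) with h1 | h1
      · have : HahnSeries.coeff f ij.1 = 0 := hf _ h1
        rw [this, zero_mul]
      · have : HahnSeries.coeff g ij.2 = 0 := hg _ (by linarith)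
        rw [this, mul_zero]
  · push Not at h
    rw [rcoeff_eq_zero_of_not_int h]
    by_cases hu : ∃ l : ℤ, (l : ℝ) = u
    · obtain ⟨l, hl⟩ := hu
      rw [rcoeff_eq_zero_of_not_int (f := g), mul_zero]
      intro m hm
      exact h (l + m) (by push_cast; rw [hl, hm])
    · push Not at hu
      rw [rcoeff_eq_zero_of_not_int hu, zero_mul]

theorem OrdGE.rcoeff_eq_zero {f : LF k} {u v : ℝ} (hf : OrdGE f v) (h : u < v) :
    f.rcoeff u = 0 := by
  unfold rcoeff
  split_ifs with hu
  · exact hf _ (hu.trans_lt h)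
  · rfl

/-- A series of order at least `u` whose coefficient at `u` vanishes has order greater than `u`. -/
theorem OrdGE.exists_gt {f : LF k} {u : ℝ} (hf : OrdGE f u) (h : f.rcoeff u = 0) :
    ∃ v > u, OrdGE f v := by
  -- The next integer after `u`: an exponent below it that is not below `u` must equal `⌊u⌋ = u`.
  refine ⟨⌊u⌋ + 1, Int.lt_floor_add_one u, fun m hm => ?_⟩
  rcases lt_or_ge (m : ℝ) u with h1 | h1
  · exact hf m h1
  · have h2 : m < ⌊u⌋ + 1 := by exact_mod_cast hm
    have h3 : m = ⌊u⌋ := le_antisymm (by omega) (by exact_mod_cast (Int.floor_le u).trans h1)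
    have h6 : (⌊u⌋ : ℝ) = u := le_antisymm (Int.floor_le u) (by rw [← h3]; exact h1)
    rw [rcoeff, if_pos h6] at h
    rw [h3, h]

end LF

/-! ### The filtration attached to a weighted basis -/

section weighted

open LF

variable {k : Type u} [Field k] {U : Type*} [AddCommGroup U] [Module (LF k) U]
  [Module k⟦X⟧ U] [IsScalarTower k⟦X⟧ (LF k) U] {ι : Type*}

theorem powerSeries_smul (p : k⟦X⟧) (u : U) : p • u = algebraMap k⟦X⟧ (LF k) p • u :=
  (algebraMap_smul (LF k) p u).symm

/-- An element of nonnegative order acts on every `k⟦z⟧`-submodule. -/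
theorem LF.OrdGE.smul_mem {f : LF k} (hf : OrdGE f 0) {L : Submodule k⟦X⟧ U} {u : U} (hu : u ∈ L) :
    f • u ∈ L := by
  obtain ⟨p, rfl⟩ := hf.exists_powerSeries
  rw [← powerSeries_smul]
  exact L.smul_mem p hu

/-- The lattice of all `∑ f i • e i` with `f i` of order at least `s - a i`. -/
def weightedFilt (e : Module.Basis ι (LF k) U) (a : ι → ℝ) (s : ℝ) : Submodule k⟦X⟧ U where
  carrier := {u | ∀ i, OrdGE (e.repr u i) (s - a i)}
  add_mem' hu hv i := by rw [map_add]; exact (hu i).add (hv i)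
  zero_mem' i := by rw [map_zero]; exact OrdGE.zero _
  smul_mem' p u hu i := by
    rw [powerSeries_smul, map_smul]
    have := (OrdGE.powerSeries p).mul (hu i)
    rwa [zero_add] at this

variable {e : Module.Basis ι (LF k) U} {a : ι → ℝ} {s t : ℝ}

theorem weightedFilt_anti (h : s ≤ t) : weightedFilt e a t ≤ weightedFilt e a s :=
  fun _ hu i => (hu i).mono (by linarith)

theorem smul_mem_weightedFilt {f : LF k} {u : U} (hf : OrdGE f t) (hu : u ∈ weightedFilt e a s) :
    f • u ∈ weightedFilt e a (s + t) := fun i => by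
  rw [map_smul]
  exact (hf.mul (hu i)).mono (by linarith)

theorem zpow_smul_mem_weightedFilt {m : ℤ} {u : U} :
    (zpow m : LF k) • u ∈ weightedFilt e a s ↔ u ∈ weightedFilt e a (s - m) := by
  refine forall_congr' fun i => ?_
  rw [map_smul, Finsupp.smul_apply, smul_eq_mul, OrdGE.zpow_mul_iff, sub_right_comm]

variable (e a) in
theorem basis_mem_weightedFilt (i : ι) : e i ∈ weightedFilt e a (a i) := fun j => by
  rw [Module.Basis.repr_self]
  by_cases h : i = j
  · subst h; rw [Finsupp.single_eq_same]; exact OrdGE.one (by simp)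
  · rw [Finsupp.single_eq_of_ne (Ne.symm h)]; exact OrdGE.zero _

/-- A `k⟦z⟧`-submodule that contains nonzero multiples of all vectors of a basis spans. -/
theorem span_eq_top_of_zpow_smul_mem {L : Submodule k⟦X⟧ U} (m : ι → ℤ)
    (h : ∀ i, (zpow (m i) : LF k) • e i ∈ L) : Submodule.span (LF k) (L : Set U) = ⊤ := by
  rw [eq_top_iff, ← e.span_eq, Submodule.span_le]
  rintro _ ⟨i, rfl⟩
  have h1 : e i = (zpow (-m i) : LF k) • ((zpow (m i) : LF k) • e i) := by
    rw [← mul_smul, zpow_mul_zpow, neg_add_cancel, zpow_eq_one, one_smul]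
  rw [h1]
  exact Submodule.smul_mem _ _ (Submodule.subset_span (h i))

section finite

variable [Finite ι]

variable (e a) in
theorem exists_mem_weightedFilt (u : U) : ∃ c : ℕ, u ∈ weightedFilt e a (-c) := by
  have := Fintype.ofFinite ι
  obtain ⟨c, hc⟩ := exists_ordGE_finite fun i => e.repr u i
  obtain ⟨d, hd⟩ := exists_nat_ge (∑ i, |a i|)
  refine ⟨c + d, fun i => (hc i).mono ?_⟩
  have h1 : |a i| ≤ ∑ i, |a i| :=
    Finset.single_le_sum (f := fun i => |a i|) (fun _ _ => abs_nonneg _) (Finset.mem_univ i)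
  have h2 := neg_abs_le (a i)
  push_cast
  linarith

variable (e a) in
theorem exists_mem_weightedFilt_of_finite {κ : Type*} [Finite κ] (u : κ → U) :
    ∃ c : ℕ, ∀ j, u j ∈ weightedFilt e a (-c) := by
  have := Fintype.ofFinite κ
  choose c hc using fun j => exists_mem_weightedFilt e a (u j)
  refine ⟨Finset.univ.sup c, fun j => weightedFilt_anti ?_ (hc j)⟩
  have : c j ≤ Finset.univ.sup c := Finset.le_sup (Finset.mem_univ j)
  exact neg_le_neg (by exact_mod_cast this)

-- Orders are integers, so the real bound `s - a i` may be replaced by its ceiling. Hence each step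
-- of the filtration is free of finite rank.
variable (e a s) in
theorem weightedFilt_eq_span :
    weightedFilt e a s
      = Submodule.span k⟦X⟧ (Set.range fun i => (zpow ⌈s - a i⌉ : LF k) • e i) := by
  have := Fintype.ofFinite ι
  apply le_antisymm
  · intro u hu
    rw [← e.sum_repr u]
    refine Submodule.sum_mem _ fun i _ => ?_
    have h : e.repr u i = (zpow (-⌈s - a i⌉) * e.repr u i) * zpow ⌈s - a i⌉ := by
      rw [mul_right_comm, zpow_mul_zpow, neg_add_cancel, zpow_eq_one, one_mul]
    rw [h, mul_smul]
    refine OrdGE.smul_mem ?_ (Submodule.subset_span ⟨i, rfl⟩)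
    rw [OrdGE.zpow_mul_iff]
    refine (hu i).ceil.mono ?_
    push_cast
    simp
  · rw [Submodule.span_le]
    rintro _ ⟨i, rfl⟩
    show _ ∈ weightedFilt e a s
    rw [zpow_smul_mem_weightedFilt]
    exact weightedFilt_anti (by linarith [Int.le_ceil (s - a i)]) (basis_mem_weightedFilt e a i)

variable (e a s) in
theorem isLattice_weightedFilt : Submodule.IsLattice (LF k) (weightedFilt e a s) where
  fg := by
    rw [weightedFilt_eq_span]
    exact Submodule.fg_span (Set.finite_range _)
  span_eq_top := span_eq_top_of_zpow_smul_mem (e := e) (fun i => ⌈s - a i⌉) fun i => by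
    rw [zpow_smul_mem_weightedFilt]
    exact weightedFilt_anti (by linarith [Int.le_ceil (s - a i)]) (basis_mem_weightedFilt e a i)

-- Together with `weightedFilt_le_lattice`, this squeezes every lattice between two steps of the
-- filtration, so passing to another lattice costs a bounded error.
variable (e a) in
theorem lattice_le_weightedFilt (L : Submodule k⟦X⟧ U) [Submodule.IsLattice (LF k) L] :
    ∃ c : ℕ, L ≤ weightedFilt e a (-c) := by
  obtain ⟨S, hS⟩ := Submodule.IsLattice.fg (A := LF k) (M := L)
  obtain ⟨c, hc⟩ := exists_mem_weightedFilt_of_finite e a (fun u : S => (u : U))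
  refine ⟨c, ?_⟩
  rw [← hS, Submodule.span_le]
  exact fun u hu => hc ⟨u, hu⟩

theorem exists_zpow_smul_mem_lattice (L : Submodule k⟦X⟧ U) [Submodule.IsLattice (LF k) L]
    (u : U) : ∃ c : ℕ, (zpow c : LF k) • u ∈ L := by
  have hu : u ∈ Submodule.span (LF k) (L : Set U) := by
    rw [Submodule.IsLattice.span_eq_top]; trivial
  have up : ∀ {c d : ℕ} {v : U}, c ≤ d → (zpow c : LF k) • v ∈ L → (zpow d : LF k) • v ∈ L := by
    intro c d v hcd hv
    have h : (zpow d : LF k) = zpow ((d : ℤ) - c) * zpow c := by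
      rw [zpow_mul_zpow, sub_add_cancel]
    rw [h, mul_smul]
    refine OrdGE.smul_mem (OrdGE.zpow ?_) hv
    have : (0 : ℤ) ≤ d - c := by omega
    exact_mod_cast this
  induction hu using Submodule.span_induction with
  | mem v hv => exact ⟨0, by rw [Nat.cast_zero, zpow_eq_one, one_smul]; exact hv⟩
  | zero => exact ⟨0, by rw [smul_zero]; exact L.zero_mem⟩
  | add v w _ _ hv hw =>
    obtain ⟨c, hc⟩ := hv
    obtain ⟨d, hd⟩ := hw
    refine ⟨max c d, ?_⟩
    rw [smul_add]
    exact L.add_mem (up (le_max_left _ _) hc) (up (le_max_right _ _) hd)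
  | smul f v _ hv =>
    obtain ⟨c, hc⟩ := hv
    obtain ⟨d, hd⟩ := exists_ordGE f
    refine ⟨d + c, ?_⟩
    have h : (zpow ((d + c : ℕ) : ℤ) : LF k) • f • v = (zpow d * f) • (zpow c : LF k) • v := by
      rw [Nat.cast_add, ← zpow_mul_zpow, ← mul_smul, ← mul_smul]
      congr 1; ring
    rw [h]
    exact OrdGE.smul_mem (OrdGE.zpow_mul_iff.2 (hd.mono (by simp))) hc

variable (e a) in
theorem weightedFilt_le_lattice (L : Submodule k⟦X⟧ U) [Submodule.IsLattice (LF k) L] :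
    ∃ c : ℕ, weightedFilt e a c ≤ L := by
  have := Fintype.ofFinite ι
  choose c hc using fun i => exists_zpow_smul_mem_lattice L (e i)
  obtain ⟨d, hd⟩ := exists_nat_ge (∑ i, (c i + |a i|))
  refine ⟨d, fun u hu => ?_⟩
  rw [← e.sum_repr u]
  refine L.sum_mem fun i _ => ?_
  have h : e.repr u i = (zpow (-(c i : ℤ)) * e.repr u i) * zpow (c i) := by
    rw [mul_right_comm, zpow_mul_zpow, neg_add_cancel, zpow_eq_one, one_mul]
  rw [h, mul_smul]
  refine OrdGE.smul_mem (OrdGE.zpow_mul_iff.2 ((hu i).mono ?_)) (hc i)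
  have h1 : c i + |a i| ≤ ∑ i, (c i + |a i|) :=
    Finset.single_le_sum (f := fun i => (c i : ℝ) + |a i|) (fun _ _ => by positivity)
      (Finset.mem_univ i)
  have h2 := le_abs_self (a i)
  push_cast
  linarith

end finite

/-- The union of the lattices `weightedFilt e a t` with `t > s`. -/
def weightedFiltPlus (e : Module.Basis ι (LF k) U) (a : ι → ℝ) (s : ℝ) : Submodule k⟦X⟧ U :=
  ⨆ t : {t : ℝ // s < t}, weightedFilt e a t

theorem mem_weightedFiltPlus {u : U} :
    u ∈ weightedFiltPlus e a s ↔ ∃ t > s, u ∈ weightedFilt e a t := by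
  have : Nonempty {t : ℝ // s < t} := ⟨⟨s + 1, by linarith⟩⟩
  rw [weightedFiltPlus, Submodule.mem_iSup_of_directed]
  · simp
  · intro x y
    exact ⟨⟨min x y, lt_min x.2 y.2⟩, weightedFilt_anti (min_le_left _ _),
      weightedFilt_anti (min_le_right _ _)⟩

theorem weightedFilt_le_plus (h : s < t) : weightedFilt e a t ≤ weightedFiltPlus e a s :=
  fun _ hu => mem_weightedFiltPlus.2 ⟨t, h, hu⟩

end weighted

/-! ### Growth of the iterates of a connection -/

namespace FlatConn

open LF

variable {k : Type u} [Field k] {U : Type u} [AddCommGroup U] [Module (LF k) U]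
  [Module k⟦X⟧ U] [IsScalarTower k⟦X⟧ (LF k) U]

/-- The integers `v i` are within bounded distance of `-r i`, where `v i` is the valuation of the
`i`-th iterate of `D` on a basis, for all lattices and bases. -/
def GrowthRate (D : FlatConn k U) (r : ℝ) : Prop :=
  ∀ L : Submodule k⟦X⟧ U, Submodule.IsLattice (LF k) L →
    ∀ (n : ℕ) (e : Module.Basis (Fin n) (LF k) U),
    ∃ (v : ℕ → ℤ) (C : ℝ), ∀ i : ℕ, 0 < i →
      IsGreatest {m : ℤ | ∀ j, (LF.zpow (-m) : LF k) • (D.op^[i] (e j)) ∈ L} (v i) ∧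
      |(v i : ℝ) + r * i| ≤ C

variable {ι : Type*} {e : Module.Basis ι (LF k) U} {a : ι → ℝ} {s t r : ℝ}

theorem iterate_sum (D : FlatConn k U) (i : ℕ) {κ : Type*} (S : Finset κ) (f : κ → U) :
    D.op^[i] (∑ l ∈ S, f l) = ∑ l ∈ S, D.op^[i] (f l) := by
  induction i with
  | zero => rfl
  | succ i ih =>
    rw [Function.iterate_succ_apply', ih, map_sum]
    exact Finset.sum_congr rfl fun l _ => (Function.iterate_succ_apply' _ _ _).symm

/-- If the first iterates of `D` on `u` have a given depth, so has the last on `f u`, up to the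
order of `f`. -/
theorem iterate_smul_mem (D : FlatConn k U) {i : ℕ} {f : LF k} {u : U} (hf : OrdGE f t)
    (h : ∀ l ≤ i, D.op^[l] u ∈ weightedFilt e a s) :
    D.op^[i] (f • u) ∈ weightedFilt e a (s + t) := by
  induction i generalizing f u with
  | zero => exact smul_mem_weightedFilt hf (h 0 le_rfl)
  | succ i ih =>
    -- Since `τ` does not lower orders, the induction applies to both Leibniz terms: to `τ f` with
    -- `u`, and to `f` with `D u`.
    rw [Function.iterate_succ_apply, D.leibniz, iterate_map_add]
    refine add_mem (ih hf.tau fun l hl => h l (hl.trans (Nat.le_succ i))) (ih hf fun l hl => ?_)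
    rw [← Function.iterate_succ_apply]
    exact h (l + 1) (Nat.succ_le_succ hl)

theorem iterate_mem (D : FlatConn k U)
    (hD : ∀ s, ∀ u ∈ weightedFilt e a s, D.op u ∈ weightedFilt e a (s - r)) {u : U}
    (hu : u ∈ weightedFilt e a s) (i : ℕ) : D.op^[i] u ∈ weightedFilt e a (s - r * i) := by
  induction i with
  | zero => simpa using hu
  | succ i ih =>
    rw [Function.iterate_succ_apply']
    have := hD _ _ ih
    push_cast
    rwa [show s - r * i - r = s - r * (i + 1) by ring] at this

/-- If `D` lowers the depth by at most `r > 0`, and its iterates do so exactly, then `r` is the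
growth rate of the iterates of `D`. -/
theorem growthRate_of_filt [Finite ι] (D : FlatConn k U) (hr : 0 < r)
    (hD : ∀ s, ∀ u ∈ weightedFilt e a s, D.op u ∈ weightedFilt e a (s - r))
    (hex : ∀ i : ℕ, ∃ j, D.op^[i] (e j) ∉ weightedFiltPlus e a (a j - r * i)) :
    D.GrowthRate r := by
  intro L hL n e'
  have := Fintype.ofFinite ι
  obtain ⟨c1, hc1⟩ := lattice_le_weightedFilt e a L
  obtain ⟨c1', hc1'⟩ := weightedFilt_le_lattice e a L
  obtain ⟨c2, hc2⟩ := exists_mem_weightedFilt_of_finite e a e'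
  obtain ⟨c3, hc3⟩ := exists_ordGE_finite fun p : ι × Fin n => e'.repr (e p.1) p.2
  obtain ⟨c4, hc4⟩ := exists_nat_ge (∑ i, |a i|)
  have ha : ∀ j, a j ≤ c4 := fun j => (le_abs_self _).trans
    ((Finset.single_le_sum (f := fun i => |a i|) (fun _ _ => abs_nonneg _)
      (Finset.mem_univ j)).trans hc4)
  -- `K` further applications of `D` lower the expected depth by `r K > c2 + c3 + c4`, more than the
  -- errors from comparing the bases `e` and `e'`.
  obtain ⟨K, hK⟩ := exists_nat_gt ((c2 + c3 + c4 : ℝ) / r)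
  rw [div_lt_iff₀ hr] at hK
  have lower : ∀ i : ℕ, ∀ j,
      (zpow (-(-⌈(c1' + c2 + r * i : ℝ)⌉)) : LF k) • D.op^[i] (e' j) ∈ L := by
    intro i j
    apply hc1'
    rw [zpow_smul_mem_weightedFilt]
    refine weightedFilt_anti ?_ (D.iterate_mem hD (hc2 j) i)
    have := Int.le_ceil (c1' + c2 + r * i : ℝ)
    push_cast
    linarith
  -- If `D^i` were much less singular on `e'` than expected, expanding `e j` in `e'` would make
  -- `D^(i+K) (e j)` too deep, against `hex`.
  have upper : ∀ (i : ℕ) (m : ℤ), (∀ j, (zpow (-m) : LF k) • D.op^[i] (e' j) ∈ L) →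
      (m : ℝ) ≤ c1 + c3 + c4 - r * i := by
    intro i m hm
    by_contra! hlt
    obtain ⟨B, hB⟩ : ∃ B : ℝ, B = m - c1 + r * i := ⟨_, rfl⟩
    have h0 : ∀ j, D.op^[i] (e' j) ∈ weightedFilt e a (B - r * i) := by
      intro j
      have h := hc1 (hm j)
      rw [zpow_smul_mem_weightedFilt] at h
      refine weightedFilt_anti ?_ h
      push_cast; linarith
    obtain ⟨j, hj⟩ := hex (i + K)
    apply hj
    rw [← e'.sum_repr (e j), D.iterate_sum]
    refine Submodule.sum_mem _ fun l _ => ?_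
    obtain ⟨T, hT⟩ : ∃ T : ℝ, T > a j + c3 - r * (i + K : ℕ) ∧
        ∀ q ≤ i + K, D.op^[q] (e' l) ∈ weightedFilt e a T := by
      -- All iterates up to `i + K` must be controlled, as the Leibniz rule produces them all. Those
      -- from the `i`-th on start from the assumed depth `B - r i`; the earlier ones have lost at
      -- most `r i`, so they are shallow only by a bounded amount, which `r K` absorbs.
      refine ⟨min (B - r * (i + K : ℕ)) (r * K - c2 - r * (i + K : ℕ)), lt_min ?_ ?_, ?_⟩
      · linarith [ha j]
      · linarith [ha j]
      · intro q hq
        rcases le_total i q with hiq | hiq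
        · obtain ⟨p, rfl⟩ := Nat.exists_eq_add_of_le hiq
          rw [add_comm i p, Function.iterate_add_apply]
          refine weightedFilt_anti ((min_le_left _ _).trans ?_) (D.iterate_mem hD (h0 l) p)
          have : (p : ℝ) ≤ K := by exact_mod_cast (by omega : p ≤ K)
          push_cast
          nlinarith
        · refine weightedFilt_anti ((min_le_right _ _).trans ?_) (D.iterate_mem hD (hc2 l) q)
          have : (q : ℝ) ≤ i := by exact_mod_cast hiq
          push_cast
          nlinarith
    refine weightedFilt_le_plus ?_ (D.iterate_smul_mem (hc3 (j, l)) hT.2)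
    linarith [hT.1]
  have key : ∀ i : ℕ, ∃ v : ℤ,
      IsGreatest {m : ℤ | ∀ j, (LF.zpow (-m) : LF k) • (D.op^[i] (e' j)) ∈ L} v := by
    intro i
    obtain ⟨v, hv, hv'⟩ := Int.exists_greatest_of_bdd
      (P := fun m => ∀ j, (LF.zpow (-m) : LF k) • (D.op^[i] (e' j)) ∈ L)
      ⟨⌈(c1 + c3 + c4 - r * i : ℝ)⌉, fun z hz => by
        exact_mod_cast (upper i z hz).trans (Int.le_ceil _)⟩ ⟨_, lower i⟩
    exact ⟨v, hv, fun m hm => hv' m hm⟩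
  choose v hv using key
  refine ⟨v, c1 + c1' + c2 + c3 + c4 + 1, fun i _ => ⟨hv i, ?_⟩⟩
  have h1 := upper i (v i) (hv i).1
  have h2 : ((-⌈(c1' + c2 + r * i : ℝ)⌉ : ℤ) : ℝ) ≤ v i := by exact_mod_cast (hv i).2 (lower i)
  have h3 := Int.ceil_lt_add_one (c1' + c2 + r * i : ℝ)
  push_cast at h2
  have p1 : (0 : ℝ) ≤ c1 := by positivity
  have p2 : (0 : ℝ) ≤ c1' := by positivity
  have p3 : (0 : ℝ) ≤ c2 := by positivity
  have p4 : (0 : ℝ) ≤ c3 := by positivity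
  have p5 : (0 : ℝ) ≤ c4 := by positivity
  rw [abs_le]
  constructor <;> linarith

/-- If a basis spans a stable `k⟦z⟧`-module, the connection is regular singular. -/
theorem regularSingular_of_filt [Finite ι] (D : FlatConn k U)
    (hD : ∀ u ∈ weightedFilt e a s, D.op u ∈ weightedFilt e a s) : D.RegularSingular :=
  ⟨weightedFilt e a s, isLattice_weightedFilt e a s, hD⟩

/-- Stability of the span of a basis can be tested on the basis, because `τ` preserves integral
coefficients. -/
theorem regularSingular_of_basis [Finite ι] (D : FlatConn k U)
    (hD : ∀ j, D.op (e j) ∈ weightedFilt e 0 0) : D.RegularSingular := by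
  have := Fintype.ofFinite ι
  refine D.regularSingular_of_filt (e := e) (a := 0) (s := 0) fun u hu => ?_
  rw [← e.sum_repr u, map_sum]
  refine Submodule.sum_mem _ fun j _ => ?_
  have hj : OrdGE (e.repr u j) 0 := by simpa using hu j
  rw [D.leibniz]
  exact add_mem (hj.tau.smul_mem (basis_mem_weightedFilt e 0 j)) (hj.smul_mem (hD j))

variable [FiniteDimensional (LF k) U]

/-- On a stable lattice `L`, some `z ^ M` brings a basis into `L`. By the Leibniz rule `z ^ M D u`
is `D (z ^ M u)` minus a constant multiple of `z ^ M u`, so all iterates stay in `z ^ (-M) L`.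
Valuations bounded below cannot decrease like `-r i`. -/
theorem GrowthRate.not_regularSingular {D : FlatConn k U} (h : D.GrowthRate r) (hr : 0 < r) :
    ¬ D.RegularSingular := by
  rintro ⟨L, hL, hst⟩
  let e := Module.finBasis (LF k) U
  obtain ⟨v, C, hv⟩ := h L hL _ e
  choose c hc using fun i => exists_zpow_smul_mem_lattice L (e i)
  let M := Finset.univ.sup c
  have h0 : ∀ i, (zpow (M : ℤ) : LF k) • e i ∈ L := by
    intro i
    have h : (zpow (M : ℤ) : LF k) = zpow ((M : ℤ) - c i) * zpow (c i) := by
      rw [zpow_mul_zpow, sub_add_cancel]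
    have h' : c i ≤ M := Finset.le_sup (Finset.mem_univ i)
    rw [h, mul_smul]
    refine OrdGE.smul_mem (OrdGE.zpow ?_) (hc i)
    have : (0 : ℤ) ≤ M - c i := by omega
    exact_mod_cast this
  have hM : ∀ (i : ℕ) j, (zpow (M : ℤ) : LF k) • D.op^[i] (e j) ∈ L := by
    intro i j
    induction i with
    | zero => exact h0 j
    | succ i ih =>
      rw [Function.iterate_succ_apply']
      have h1 := D.leibniz (zpow (M : ℤ)) (D.op^[i] (e j))
      rw [tau_zpow] at h1
      rw [← sub_eq_of_eq_add' h1]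
      refine L.sub_mem (hst _ ih) ?_
      have h2 : ((M : ℤ) : k) • (zpow (M : ℤ) : LF k) = (algebraMap k (LF k) (M : ℤ)) * zpow M :=
        Algebra.smul_def _ _
      rw [h2, mul_smul]
      exact OrdGE.smul_mem (OrdGE.const _ le_rfl) ih
  obtain ⟨i, hi⟩ := exists_nat_gt ((C + M) / r)
  rw [div_lt_iff₀ hr] at hi
  have hC : 0 ≤ C := (abs_nonneg _).trans (hv 1 one_pos).2
  have hi0 : 0 < i := by
    rcases Nat.eq_zero_or_pos i with rfl | h
    · simp at hi
      have : (0 : ℝ) ≤ M := by positivity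
      linarith
    · exact h
  obtain ⟨hg, hb⟩ := hv i hi0
  have h1 : (-(M : ℤ)) ≤ v i := hg.2 (show ∀ j, _ from fun j => by rw [neg_neg]; exact hM i j)
  have h2 : (-(M : ℝ)) ≤ v i := by exact_mod_cast h1
  have h3 := (abs_le.1 hb).2
  linarith

/-- For a fixed lattice and basis the valuations do not depend on the rate, so `|r - s| i` stays
bounded. -/
theorem GrowthRate.unique {D : FlatConn k U} (h : D.GrowthRate r) (h' : D.GrowthRate s) :
    r = s := by
  let e := Module.finBasis (LF k) U
  obtain ⟨v, C, hv⟩ := h _ (isLattice_weightedFilt e 0 0) _ e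
  obtain ⟨v', C', hv'⟩ := h' _ (isLattice_weightedFilt e 0 0) _ e
  by_contra hne
  have hpos : 0 < |r - s| := abs_pos.2 (sub_ne_zero.2 hne)
  obtain ⟨i, hi⟩ := exists_nat_gt ((C + C') / |r - s|)
  rw [div_lt_iff₀ hpos] at hi
  have hb : ∀ i : ℕ, 0 < i → |r - s| * i ≤ C + C' := by
    intro i hi
    have e1 : v i = v' i := (hv i hi).1.unique (hv' i hi).1
    have b1 := (hv i hi).2
    have b2 := (hv' i hi).2
    rw [e1] at b1
    calc |r - s| * i = |(v' i + r * i) - (v' i + s * i)| := by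
          rw [show (v' i + r * i) - (v' i + s * i) = (r - s) * i by ring, abs_mul, Nat.abs_cast]
      _ ≤ |v' i + r * i| + |v' i + s * i| := abs_sub _ _
      _ ≤ C + C' := add_le_add b1 b2
  -- The bound holds for positive indices only, and `i` may be `0`.
  have := hb (i + 1) (Nat.succ_pos i)
  push_cast at this
  nlinarith

end FlatConn

/-! ### Cyclic vectors -/

section perturbation

variable {K U : Type*} [Field K] [AddCommGroup U] [Module K U]

/-- Linear independence of `u + c • w` fails for finitely many `c` only, if `u` is independent. -/
theorem LinearIndependent.finite_perturbation {m : ℕ} {u : Fin m → U} (hu : LinearIndependent K u)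
    (w : Fin m → U) : {c : K | ¬ LinearIndependent K (fun j => u j + c • w j)}.Finite := by
  classical
  -- A left inverse `T` sends `u` to the standard basis and `u + c w` to the rows of `1 + c A`. The
  -- determinant of the latter is a polynomial in `c` with value `1` at `0`, namely the reversed
  -- characteristic polynomial of `-A`.
  obtain ⟨T, hT⟩ := LinearMap.exists_leftInverse_of_injective (Fintype.linearCombination K u)
    (LinearMap.ker_eq_bot.2 (hu.fintypeLinearCombination_injective))
  have hTu : ∀ j, T (u j) = Pi.single j 1 := by
    intro j
    have := LinearMap.congr_fun hT (Pi.single j 1)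
    rwa [LinearMap.comp_apply, Fintype.linearCombination_apply_single, one_smul] at this
  let A : Matrix (Fin m) (Fin m) K := Matrix.of fun j => T (w j)
  have hp : (-A).charpolyRev ≠ 0 := by
    intro h
    have := Matrix.eval_charpolyRev (M := -A)
    rw [h, Polynomial.eval_zero] at this
    exact zero_ne_one this
  refine ((-A).charpolyRev.roots.toFinset.finite_toSet).subset fun c hc => ?_
  rw [Finset.mem_coe, Multiset.mem_toFinset, Polynomial.mem_roots hp, Polynomial.IsRoot]
  by_contra hne
  apply hc
  have hdet : (-A).charpolyRev.eval c = (1 + c • A).det := by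
    rw [Matrix.charpolyRev, ← Polynomial.coe_evalRingHom, RingHom.map_det]
    congr 1
    ext i j
    by_cases h : i = j
    · simp [h, mul_comm c]
    · simp [h, mul_comm c]
  rw [hdet] at hne
  have h1 : LinearIndependent K (1 + c • A).row :=
    Matrix.linearIndependent_rows_iff_isUnit.2 ((Matrix.isUnit_iff_isUnit_det _).2
      (isUnit_iff_ne_zero.2 hne))
  refine LinearIndependent.of_comp T ?_
  have h2 : (T ∘ fun j => u j + c • w j) = (1 + c • A).row := by
    ext j i
    simp [hTu, A, Matrix.row, Matrix.one_apply, Pi.single_apply, eq_comm]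
  rw [h2]
  exact h1

end perturbation

namespace FlatConn

open LF

variable {k : Type u} [Field k] {U : Type u} [AddCommGroup U] [Module (LF k) U]

/-- The connection as an element of the ring of additive endomorphisms. -/
def opEnd (D : FlatConn k U) : AddMonoid.End U := D.op

theorem opEnd_pow_apply (D : FlatConn k U) (j : ℕ) (u : U) : (D.opEnd ^ j) u = D.op^[j] u := by
  rw [AddMonoid.End.coe_pow]; rfl

theorem op_const_smul (D : FlatConn k U) (c : k) (u : U) :
    D.op (algebraMap k (LF k) c • u) = algebraMap k (LF k) c • D.op u := by
  rw [D.leibniz, Algebra.algebraMap_eq_smul_one, map_smul, tau_one, smul_zero, zero_smul, zero_add]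

theorem iterate_const_smul (D : FlatConn k U) (c : k) (u : U) (j : ℕ) :
    D.op^[j] (algebraMap k (LF k) c • u) = algebraMap k (LF k) c • D.op^[j] u := by
  induction j with
  | zero => rfl
  | succ j ih => rw [Function.iterate_succ_apply', ih, op_const_smul, Function.iterate_succ_apply']

/-- `D (z ^ p u) = z ^ p (D + p) u`, iterated. -/
theorem iterate_zpow_smul (D : FlatConn k U) (p : ℤ) (u : U) (j : ℕ) :
    D.op^[j] ((zpow p : LF k) • u)
      = (zpow p : LF k) • ((D.opEnd + (p : AddMonoid.End U)) ^ j) u := by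
  induction j with
  | zero => rfl
  | succ j ih =>
    rw [Function.iterate_succ_apply', ih, D.leibniz, tau_zpow, pow_succ']
    show _ = (zpow p : LF k) • (D.op _ + (p : AddMonoid.End U) _)
    rw [AddMonoid.End.intCast_apply, smul_add, add_comm, ← Int.cast_smul_eq_zsmul (LF k),
      ← mul_smul]
    congr 2
    rw [mul_comm, Algebra.smul_def, map_intCast]

/-- `φ ((D + p) ^ j u)` is polynomial in `p`, of degree `j` with leading coefficient `φ u`. -/
theorem exists_polynomial (D : FlatConn k U) (φ : U →ₗ[LF k] LF k) (u : U) (j : ℕ) :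
    ∃ Q : Polynomial (LF k), Q.natDegree ≤ j ∧ Q.coeff j = φ u ∧ ∀ p : ℤ,
      φ (((D.opEnd + (p : AddMonoid.End U)) ^ j) u) = Q.eval (p : LF k) := by
  refine ⟨∑ m ∈ Finset.range (j + 1),
    Polynomial.C (φ (D.op^[m] u) * (j.choose m : LF k)) * Polynomial.X ^ (j - m), ?_, ?_, ?_⟩
  · refine Polynomial.natDegree_sum_le_of_forall_le _ _ fun m _ => ?_
    exact (Polynomial.natDegree_C_mul_X_pow_le _ _).trans (Nat.sub_le j m)
  · rw [Polynomial.finsetSum_coeff, Finset.sum_eq_single 0]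
    · simp
    · intro m hm h0
      rw [Polynomial.coeff_C_mul_X_pow, if_neg]
      have := Finset.mem_range.1 hm
      omega
    · simp
  · intro p
    -- Integers commute with `D`, unlike general elements of `F`, so the binomial theorem applies.
    rw [(Int.cast_commute p D.opEnd).symm.add_pow, Polynomial.eval_finsetSum]
    have h1 : ∀ (S : Finset ℕ) (f : ℕ → AddMonoid.End U), (∑ m ∈ S, f m) u = ∑ m ∈ S, f m u :=
      fun S f => AddMonoidHom.finsetSum_apply f S u
    rw [h1, map_sum]
    refine Finset.sum_congr rfl fun m _ => ?_
    have h2 : (D.opEnd ^ m * (p : AddMonoid.End U) ^ (j - m)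
        * (j.choose m : AddMonoid.End U)) u = ((p ^ (j - m) * j.choose m : ℤ)) • D.op^[m] u := by
      have h3 : D.opEnd ^ m * (p : AddMonoid.End U) ^ (j - m)
          * (j.choose m : AddMonoid.End U)
          = ((p ^ (j - m) * j.choose m : ℤ) : AddMonoid.End U) * D.opEnd ^ m := by
        rw [mul_assoc, ← (Int.cast_commute (p ^ (j - m) * j.choose m)
          (D.opEnd ^ m)).eq.symm]
        push_cast
        rfl
      rw [h3, ← opEnd_pow_apply]
      rfl
    rw [h2, map_zsmul, ← Int.cast_smul_eq_zsmul (LF k)]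
    simp
    ring

variable [CharZero k]

/-- Suppose `D^m e = ∑ α j D^j e`, and let `S` be the span of the independent lower iterates. Take
`f` outside `S` and a functional `φ` killing `S` but not `f`, and perturb `e` to `v = e + c z^p f`.
The combination `D^m v - ∑ α j D^j v` equals `c w'`, where `φ w'` is `z^p` times a polynomial in `p`
with leading coefficient `φ f`. In characteristic zero some integer `p` gives `w' ∉ S`, and for all
but finitely many `c` the vector `w'` remains independent of the perturbed lower iterates. -/
theorem exists_linearIndependent_iterate (D : FlatConn k U) (m : ℕ)
    (hm : m ≤ Module.finrank (LF k) U) :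
    ∃ e : U, LinearIndependent (LF k) fun j : Fin m => D.op^[j] e := by
  induction m with
  | zero => exact ⟨0, linearIndependent_empty_type⟩
  | succ m ih =>
    obtain ⟨e, he⟩ := ih (by omega)
    by_cases hdep : D.op^[m] e ∈ Submodule.span (LF k) (Set.range fun j : Fin m => D.op^[j] e)
    swap
    · exact ⟨e, linearIndependent_finSucc'.2 ⟨he, hdep⟩⟩
    obtain ⟨α, hα⟩ := (Submodule.mem_span_range_iff_exists_fun (LF k)).1 hdep
    set S := Submodule.span (LF k) (Set.range fun j : Fin m => D.op^[j] e) with hS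
    have hlt : S < ⊤ := by
      refine lt_top_iff_ne_top.2 fun h => ?_
      have h1 := finrank_range_le_card (R := LF k) (fun j : Fin m => D.op^[j] e)
      rw [Set.finrank, ← hS, h, finrank_top, Fintype.card_fin] at h1
      omega
    obtain ⟨f, -, hf⟩ := SetLike.exists_of_lt hlt
    obtain ⟨φ, hφf, hφS⟩ := Submodule.exists_le_ker_of_notMem hf
    let E : ℤ → ℕ → U := fun p j => ((D.opEnd + (p : AddMonoid.End U)) ^ j) f
    choose Q hQd hQc hQ using D.exists_polynomial φ f
    let R : Polynomial (LF k) := Q m - ∑ j : Fin m, Polynomial.C (α j) * Q j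
    have hR : R ≠ 0 := by
      intro h
      apply hφf
      have h1 : R.coeff m = φ f := by
        rw [Polynomial.coeff_sub, hQc, Polynomial.finsetSum_coeff, Finset.sum_eq_zero, sub_zero]
        intro j _
        rw [Polynomial.coeff_C_mul, Polynomial.coeff_eq_zero_of_natDegree_lt
          ((hQd j).trans_lt j.2), mul_zero]
      rw [← h1, h, Polynomial.coeff_zero]
    have hchar : CharZero (LF k) :=
      charZero_of_injective_algebraMap (algebraMap k (LF k)).injective
    obtain ⟨p, hp⟩ : ∃ p : ℤ, R.eval (p : LF k) ≠ 0 := by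
      by_contra! h
      refine hR (Polynomial.eq_zero_of_infinite_isRoot R ?_)
      refine (Set.infinite_range_of_injective (Int.cast_injective (α := LF k))).mono ?_
      rintro _ ⟨p, rfl⟩
      exact h p
    let w : Fin m → U := fun j => (zpow p : LF k) • E p j
    let w' : U := (zpow p : LF k) • E p m - ∑ j : Fin m, α j • w j
    have hz : (zpow p : LF k) ≠ 0 := by
      intro h
      have := congrArg (fun f => LF.coeff f p) h
      rw [coeff_zpow, if_pos rfl] at this
      exact one_ne_zero this
    have hw' : w' ∉ S := by
      intro h
      have h1 : φ w' = zpow p * R.eval (p : LF k) := by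
        simp only [w', w, E, R, map_sub, map_smul, map_sum, hQ, Polynomial.eval_sub,
          Polynomial.eval_finsetSum, Polynomial.eval_mul, Polynomial.eval_C, smul_eq_mul, mul_sub,
          Finset.mul_sum]
        congr 1
        exact Finset.sum_congr rfl fun j _ => by ring
      have h2 : φ w' = 0 := hφS h
      rw [h2] at h1
      exact mul_ne_zero hz hp h1.symm
    have hind : LinearIndependent (LF k)
        (Fin.snoc (fun j : Fin m => D.op^[j] e) w' : Fin (m + 1) → U) :=
      linearIndependent_finSnoc.2 ⟨he, hw'⟩
    -- Only the first `m` vectors move: the last one, `w'`, does not depend on `c`.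
    have hfin := hind.finite_perturbation (Fin.snoc w 0)
    -- `c` is taken in `k`, not in `F`, so that it commutes with `D`.
    obtain ⟨c, hc0, hc⟩ : ∃ c : k, c ≠ 0 ∧ LinearIndependent (LF k)
        (fun j : Fin (m + 1) => (Fin.snoc (fun j : Fin m => D.op^[j] e) w' : Fin (m + 1) → U) j
          + algebraMap k (LF k) c • (Fin.snoc w 0 : Fin (m + 1) → U) j) := by
      by_contra! h
      have hinf : (Set.univ \ {0} : Set k).Infinite :=
        Set.infinite_univ.sdiff (Set.finite_singleton 0)
      refine (hinf.image (f := algebraMap k (LF k))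
        (algebraMap k (LF k)).injective.injOn).mono ?_ hfin
      rintro _ ⟨c, hc, rfl⟩
      exact h c hc.2
    rw [linearIndependent_finSucc'] at hc
    have hv : ∀ j : ℕ, D.op^[j] (e + algebraMap k (LF k) c • (zpow p : LF k) • f)
        = D.op^[j] e + algebraMap k (LF k) c • (zpow p : LF k) • E p j := by
      intro j
      rw [iterate_map_add, iterate_const_smul, iterate_zpow_smul]
    have hinit : (Fin.init fun j : Fin (m + 1) =>
        (Fin.snoc (fun j : Fin m => D.op^[j] e) w' : Fin (m + 1) → U) j
          + algebraMap k (LF k) c • (Fin.snoc w 0 : Fin (m + 1) → U) j)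
        = fun j : Fin m => D.op^[j] (e + algebraMap k (LF k) c • (zpow p : LF k) • f) := by
      funext j
      rw [hv]
      simp [Fin.init, w]
    rw [hinit] at hc
    refine ⟨e + algebraMap k (LF k) c • (zpow p : LF k) • f,
      linearIndependent_finSucc'.2 ⟨hc.1, fun hmem => hc.2 ?_⟩⟩
    set S' := Submodule.span (LF k) (Set.range fun j : Fin m =>
      D.op^[j] (e + algebraMap k (LF k) c • (zpow p : LF k) • f)) with hS'
    change D.op^[m] _ ∈ S' at hmem
    rw [Fin.snoc_last, Fin.snoc_last, smul_zero, add_zero]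
    have h1 : algebraMap k (LF k) c • w' ∈ S' := by
      have h2 : algebraMap k (LF k) c • w'
          = D.op^[m] (e + algebraMap k (LF k) c • (zpow p : LF k) • f)
            - ∑ j : Fin m, α j • D.op^[j] (e + algebraMap k (LF k) c • (zpow p : LF k) • f) := by
        simp only [hv, ← hα, w', w, smul_sub, smul_add, Finset.sum_add_distrib, Finset.smul_sum]
        rw [add_sub_add_left_eq_sub]
        congr 1
        exact Finset.sum_congr rfl fun j _ => smul_comm _ _ _
      rw [h2]
      exact S'.sub_mem hmem (S'.sum_mem fun j _ =>
        S'.smul_mem _ (Submodule.subset_span ⟨j, rfl⟩))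
    have hc' : algebraMap k (LF k) c ≠ 0 := by
      rwa [Ne, map_eq_zero]
    exact (S'.smul_mem_iff hc').1 h1

/-- The cyclic vector theorem. -/
theorem exists_cyclic_basis [FiniteDimensional (LF k) U] (D : FlatConn k U) {n : ℕ} (hn : Module.finrank (LF k) U = n) :
    ∃ (u : U) (e : Module.Basis (Fin n) (LF k) U), ∀ j : Fin n, e j = D.op^[j] u := by
  obtain ⟨u, hu⟩ := D.exists_linearIndependent_iterate n hn.ge
  rcases Nat.eq_zero_or_pos n with rfl | hpos
  · exact ⟨u, (Module.finBasisOfFinrankEq (LF k) U hn), fun j => j.elim0⟩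
  · have : Nonempty (Fin n) := ⟨⟨0, hpos⟩⟩
    exact ⟨u, basisOfLinearIndependentOfCardEqFinrank hu (by simp [hn]), fun j => by simp⟩

end FlatConn

/-! ### Graded nilpotent matrices -/

namespace Matrix

variable {K ι Δ : Type*} [Field K] [Fintype ι] [DecidableEq ι] [AddCommGroup Δ]

/-- The matrix `C` is homogeneous of degree `ρ`, for the grading `d` of the coordinates. -/
def IsHomogeneousOfDegree (d : ι → Δ) (ρ : Δ) (C : Matrix ι ι K) : Prop :=
  ∀ i j, C i j ≠ 0 → d i = d j + ρ

namespace IsHomogeneousOfDegree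

variable {d : ι → Δ} {ρ σ : Δ} {A B : Matrix ι ι K}

omit [Fintype ι] in
theorem one : IsHomogeneousOfDegree d 0 (1 : Matrix ι ι K) := fun i j h => by
  rw [one_apply] at h
  have : i = j := by by_contra hne; rw [if_neg hne] at h; exact h rfl
  rw [this, add_zero]

omit [Fintype ι] [DecidableEq ι] in
theorem sub (hA : IsHomogeneousOfDegree d ρ A) (hB : IsHomogeneousOfDegree d ρ B) :
    IsHomogeneousOfDegree d ρ (A - B) := fun i j h => by
  by_cases h1 : A i j = 0
  · exact hB i j fun h2 => h (by rw [sub_apply, h1, h2, sub_zero])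
  · exact hA i j h1

omit [Fintype ι] [DecidableEq ι] in
theorem smul (c : K) (hA : IsHomogeneousOfDegree d ρ A) :
    IsHomogeneousOfDegree d ρ (c • A) := fun i j h =>
  hA i j fun h1 => h (by rw [smul_apply, h1, smul_zero])

omit [Fintype ι] [DecidableEq ι] in
theorem sum {κ : Type*} {s : Finset κ} {A : κ → Matrix ι ι K}
    (hA : ∀ l ∈ s, IsHomogeneousOfDegree d ρ (A l)) :
    IsHomogeneousOfDegree d ρ (∑ l ∈ s, A l) := fun i j h => by
  rw [sum_apply] at h
  obtain ⟨l, hl, h1⟩ := Finset.exists_ne_zero_of_sum_ne_zero h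
  exact hA l hl i j h1

omit [DecidableEq ι] in
theorem mul (hA : IsHomogeneousOfDegree d ρ A) (hB : IsHomogeneousOfDegree d σ B) :
    IsHomogeneousOfDegree d (ρ + σ) (A * B) := fun i j h => by
  rw [mul_apply] at h
  obtain ⟨l, -, h1⟩ := Finset.exists_ne_zero_of_sum_ne_zero h
  rw [hA i l (left_ne_zero_of_mul h1), hB l j (right_ne_zero_of_mul h1)]
  abel

theorem pow (hA : IsHomogeneousOfDegree d ρ A) (m : ℕ) :
    IsHomogeneousOfDegree d (m • ρ) (A ^ m) := by
  induction m with
  | zero => rw [pow_zero, zero_smul]; exact one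
  | succ m ih => rw [pow_succ, succ_nsmul]; exact ih.mul hA

end IsHomogeneousOfDegree

/-- A homogeneous matrix has a homogeneous projection onto its kernel. -/
theorem IsHomogeneousOfDegree.exists_projection {d : ι → Δ} {ρ : Δ} {A : Matrix ι ι K}
    (hA : IsHomogeneousOfDegree d ρ A) :
    ∃ p : Matrix ι ι K, IsHomogeneousOfDegree d 0 p ∧ A * p = 0 ∧
      ∀ B : Matrix ι ι K, A * B = 0 → p * B = B := by
  classical
  obtain ⟨π, hπ⟩ := LinearMap.exists_leftInverse_of_injective
    (LinearMap.ker (toLin' A)).subtype (Submodule.ker_subtype _)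
  let p : Matrix ι ι K := LinearMap.toMatrix' ((LinearMap.ker (toLin' A)).subtype ∘ₗ π)
  have hp1 : A * p = 0 := by
    apply toLin'.injective
    rw [toLin'_mul, toLin'_toMatrix', map_zero]
    exact LinearMap.ext fun v => LinearMap.mem_ker.1 (π v).2
  have hp2 : ∀ B : Matrix ι ι K, A * B = 0 → p * B = B := by
    intro B hB
    apply toLin'.injective
    rw [toLin'_mul, toLin'_toMatrix']
    refine LinearMap.ext fun v => ?_
    have hv : toLin' B v ∈ LinearMap.ker (toLin' A) := by
      rw [LinearMap.mem_ker, ← LinearMap.comp_apply, ← toLin'_mul, hB, map_zero]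
      rfl
    have := LinearMap.congr_fun hπ ⟨_, hv⟩
    exact congrArg Subtype.val this
  -- Keep the degree-zero part of an arbitrary projection. As `A` shifts degrees by `ρ`, it still
  -- kills this part.
  refine ⟨of fun i j => if d i = d j then p i j else 0, fun i j h => ?_, ?_, fun B hB => ?_⟩
  · rw [of_apply] at h
    rw [add_zero]
    by_contra hne
    exact h (if_neg hne)
  · ext i l
    rw [mul_apply, zero_apply]
    by_cases hil : d i = d l + ρ
    · rw [← zero_apply (m := ι) (n := ι) (α := K) i l, ← hp1, mul_apply]
      refine Finset.sum_congr rfl fun m _ => ?_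
      by_cases h : A i m = 0
      · rw [h, zero_mul, zero_mul]
      · rw [of_apply, if_pos]
        exact add_right_cancel ((hA i m h).symm.trans hil)
    · refine Finset.sum_eq_zero fun m _ => ?_
      by_cases h : A i m = 0
      · rw [h, zero_mul]
      · rw [of_apply, if_neg, mul_zero]
        intro hml
        exact hil (by rw [hA i m h, hml])
  · ext i l
    -- The rows of `B` of the same degree as row `i`. Homogeneity of `A` gives `A * B' = 0`, so `p`
    -- fixes `B'`, and only the degree-zero part of `p` enters row `i`.
    let B' : Matrix ι ι K := of fun m l => if d m = d i then B m l else 0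
    have hB1 : ∀ m l, B' m l = if d m = d i then B m l else 0 := fun _ _ => rfl
    have hB' : A * B' = 0 := by
      ext j l
      rw [mul_apply, zero_apply]
      by_cases hji : d j = d i + ρ
      · rw [← zero_apply (m := ι) (n := ι) (α := K) j l, ← hB, mul_apply]
        refine Finset.sum_congr rfl fun m _ => ?_
        by_cases h : A j m = 0
        · rw [h, zero_mul, zero_mul]
        · rw [hB1, if_pos]
          exact add_right_cancel ((hA j m h).symm.trans hji)
      · refine Finset.sum_eq_zero fun m _ => ?_
        by_cases h : A j m = 0
        · rw [h, zero_mul]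
        · rw [hB1, if_neg, mul_zero]
          intro hml
          exact hji (by rw [hA j m h, hml])
    have h1 := congrFun (congrFun (hp2 B' hB') i) l
    rw [hB1, if_pos rfl, mul_apply] at h1
    rw [← h1, mul_apply]
    refine Finset.sum_congr rfl fun m _ => ?_
    rw [hB1, of_apply]
    by_cases h : d m = d i
    · rw [if_pos h, if_pos h.symm]
    · rw [if_neg h, if_neg (Ne.symm h), zero_mul, mul_zero]

/-- A homogeneous nilpotent matrix is strictly triangular with respect to a homogeneous
decomposition. -/
theorem IsHomogeneousOfDegree.exists_idempotents {d : ι → Δ} {ρ : Δ} {C : Matrix ι ι K}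
    (hC : IsHomogeneousOfDegree d ρ C) {N : ℕ} (hN : C ^ N = 0) :
    ∃ q : ℕ → Matrix ι ι K, (∀ i, IsHomogeneousOfDegree d 0 (q i)) ∧
      (∀ i, q i * q i = q i) ∧ (∀ i j, i ≠ j → q i * q j = 0) ∧
      ∑ i ∈ Finset.range N, q i = 1 ∧ ∀ i j, i ≤ j → j < N → q i * C * q j = 0 := by
  choose p hp0 hp1 hp2 using fun m : ℕ => (hC.pow m).exists_projection
  -- `E m` is a projection onto `ker C^(N-m)`. Taking products of the chosen projections makes the
  -- family nested from both sides, so the differences `E i - E (i+1)` are orthogonal idempotents.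
  -- Since `C` maps `ker C^(N-j)` into `ker C^(N-j-1)`, it is strictly triangular for them.
  let E : ℕ → Matrix ι ι K := fun m => Nat.rec 1 (fun m A => p (N - (m + 1)) * A) m
  have E0 : E 0 = 1 := rfl
  have ES : ∀ m, E (m + 1) = p (N - (m + 1)) * E m := fun m => rfl
  have up : ∀ {a b : ℕ} {B : Matrix ι ι K}, a ≤ b → C ^ a * B = 0 → C ^ b * B = 0 := by
    intro a b B hab h
    rw [← Nat.sub_add_cancel hab, pow_add, mul_assoc, h, mul_zero]
  have h0 : ∀ m, IsHomogeneousOfDegree d 0 (E m) := by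
    intro m
    induction m with
    | zero => exact one
    | succ m ih => rw [ES, ← add_zero (0 : Δ)]; exact (hp0 _).mul ih
  have h1 : ∀ m, C ^ (N - m) * E m = 0 := by
    intro m
    cases m with
    | zero => rw [Nat.sub_zero, hN, zero_mul]
    | succ m => rw [ES, ← mul_assoc, hp1, zero_mul]
  have h2 : ∀ m (B : Matrix ι ι K), C ^ (N - m) * B = 0 → E m * B = B := by
    intro m
    induction m with
    | zero => intro B _; rw [E0, one_mul]
    | succ m ih =>
      intro B hB
      rw [ES, mul_assoc, ih B (up (by omega) hB), hp2 _ B hB]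
  have h3 : ∀ m l, E (m + l) * E m = E (m + l) := by
    intro m l
    induction l with
    | zero => exact h2 m _ (h1 m)
    | succ l ih => rw [← add_assoc, ES, mul_assoc, ih]
  have h4 : ∀ m l, E m * E (m + l) = E (m + l) := fun m l => h2 m _ (up (by omega) (h1 (m + l)))
  have h3' : ∀ {i j}, i ≤ j → E j * E i = E j := fun {i j} h => by
    obtain ⟨l, rfl⟩ := Nat.exists_eq_add_of_le h; exact h3 _ _
  have h4' : ∀ {i j}, i ≤ j → E i * E j = E j := fun {i j} h => by
    obtain ⟨l, rfl⟩ := Nat.exists_eq_add_of_le h; exact h4 _ _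
  refine ⟨fun i => E i - E (i + 1), fun i => (h0 i).sub (h0 (i + 1)), fun i => ?_, fun i j hij => ?_,
    ?_, fun i j hij hj => ?_⟩
  · rw [sub_mul, mul_sub, mul_sub, h3' (le_refl i), h3' (le_refl (i + 1)), h4' (Nat.le_succ i),
      h3' (Nat.le_succ i), sub_self, sub_zero]
  · rcases lt_or_gt_of_ne hij with h | h
    · rw [sub_mul, mul_sub, mul_sub, h4' h.le, h4' (by omega : i ≤ j + 1), h4' (by omega : i + 1 ≤ j),
        h4' (by omega : i + 1 ≤ j + 1), sub_self]
    · rw [sub_mul, mul_sub, mul_sub, h3' h.le, h3' (by omega : j + 1 ≤ i),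
        h3' (by omega : j ≤ i + 1), h3' (by omega : j + 1 ≤ i + 1), sub_self, sub_self, sub_zero]
  · rw [Finset.sum_range_sub', E0]
    have : E N = 0 := by
      have := h1 N
      rwa [Nat.sub_self, pow_zero, one_mul] at this
    rw [this, sub_zero]
  · have key : ∀ l ≤ i + 1, E l * (C * (E j - E (j + 1))) = C * (E j - E (j + 1)) := by
      intro l hl
      apply h2
      rw [← mul_assoc, ← pow_succ, mul_sub, up (by omega) (h1 j), up (by omega) (h1 (j + 1)),
        sub_zero]
    rw [mul_assoc, sub_mul, key i (by omega), key (i + 1) le_rfl, sub_self]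

end Matrix

/-! ### Leading matrices of endomorphisms -/

section leading

open LF

theorem addCircle_coe_eq_iff {x y : ℝ} :
    (x : AddCircle (1 : ℝ)) = y ↔ ∃ m : ℤ, (m : ℝ) = x - y := by
  rw [eq_comm, QuotientAddGroup.eq, AddSubgroup.mem_zmultiples_iff]
  refine exists_congr fun m => ?_
  rw [zsmul_eq_mul, mul_one, neg_add_eq_sub]

variable {k : Type u} [Field k] {U : Type u} [AddCommGroup U] [Module (LF k) U]
  [Module k⟦X⟧ U] [IsScalarTower k⟦X⟧ (LF k) U] {ι : Type*} [Fintype ι] [DecidableEq ι]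
  (e : Module.Basis ι (LF k) U) (a : ι → ℝ)

/-- The endomorphism `X` raises the depth by at least `r`. -/
def HasDepth (r : ℝ) (X : Module.End (LF k) U) : Prop :=
  ∀ i j, OrdGE (LinearMap.toMatrix e e X i j) (r - a i + a j)

/-- The matrix of the map induced by `X`, of depth `r`, between the graded pieces of the filtration
`weightedFilt e a`. -/
def leadMatrix (r : ℝ) (X : Module.End (LF k) U) : Matrix ι ι k :=
  Matrix.of fun i j => (LinearMap.toMatrix e e X i j).rcoeff (r - a i + a j)

variable {e a} {r s : ℝ} {X Y : Module.End (LF k) U}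

theorem leadMatrix_apply (i j : ι) :
    leadMatrix e a r X i j = (LinearMap.toMatrix e e X i j).rcoeff (r - a i + a j) := rfl

theorem HasDepth.map_mem (hX : HasDepth e a r X) {u : U} (hu : u ∈ weightedFilt e a s) :
    X u ∈ weightedFilt e a (s + r) := by
  intro i
  rw [← LinearMap.toMatrix_mulVec_repr e e X u]
  refine OrdGE.sum fun j _ => ((hX i j).mul (hu j)).mono ?_
  linarith

/-- Identifies the entrywise condition with the one defining `glFilt`; the converse tests `e j`,
which has depth `a j`. -/
theorem hasDepth_iff : HasDepth e a r X ↔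
    ∀ s, ∀ u ∈ weightedFilt e a s, X u ∈ weightedFilt e a (s + r) := by
  refine ⟨fun hX s u hu => hX.map_mem hu, fun h i j => ?_⟩
  rw [LinearMap.toMatrix_apply]
  exact (h _ _ (basis_mem_weightedFilt e a j) i).mono (by linarith)

theorem HasDepth.map_mem_plus (hX : HasDepth e a r X) {u : U}
    (hu : u ∈ weightedFiltPlus e a s) : X u ∈ weightedFiltPlus e a (s + r) := by
  obtain ⟨t, ht, hu⟩ := mem_weightedFiltPlus.1 hu
  exact mem_weightedFiltPlus.2 ⟨t + r, by linarith, hX.map_mem hu⟩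


theorem HasDepth.one : HasDepth e a 0 (1 : Module.End (LF k) U) := by
  intro i j
  rw [LinearMap.toMatrix_one, Matrix.one_apply]
  split_ifs with h
  · subst h; exact OrdGE.one (by simp)
  · exact OrdGE.zero _

theorem HasDepth.add (hX : HasDepth e a r X) (hY : HasDepth e a r Y) :
    HasDepth e a r (X + Y) := by
  intro i j
  rw [map_add]
  exact (hX i j).add (hY i j)

theorem HasDepth.mono (hX : HasDepth e a r X) (h : s ≤ r) : HasDepth e a s X :=
  fun i j => (hX i j).mono (by linarith)

theorem HasDepth.mul (hX : HasDepth e a r X) (hY : HasDepth e a s Y) :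
    HasDepth e a (r + s) (X * Y) := by
  intro i j
  rw [LinearMap.toMatrix_mul, Matrix.mul_apply]
  exact OrdGE.sum fun l _ => ((hX i l).mul (hY l j)).mono (by linarith)

theorem leadMatrix_mul (hX : HasDepth e a r X) (hY : HasDepth e a s Y) :
    leadMatrix e a (r + s) (X * Y) = leadMatrix e a r X * leadMatrix e a s Y := by
  ext i j
  rw [leadMatrix_apply, LinearMap.toMatrix_mul, Matrix.mul_apply, Matrix.mul_apply, rcoeff_sum]
  refine Finset.sum_congr rfl fun l _ => ?_
  rw [show r + s - a i + a j = (r - a i + a l) + (s - a l + a j) by ring,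
    rcoeff_mul (hX i l) (hY l j)]
  rfl

theorem leadMatrix_one : leadMatrix e a 0 (1 : Module.End (LF k) U) = 1 := by
  ext i j
  rw [leadMatrix_apply, LinearMap.toMatrix_one, Matrix.one_apply, Matrix.one_apply]
  split_ifs with h
  · subst h
    rw [show (0 : ℝ) - a i + a i = ((0 : ℤ) : ℝ) by simp, rcoeff_intCast, coeff_one, if_pos rfl]
  · exact rcoeff_zero _

theorem leadMatrix_add : leadMatrix e a r (X + Y) = leadMatrix e a r X + leadMatrix e a r Y := by
  ext i j
  rw [leadMatrix_apply, map_add, Matrix.add_apply, rcoeff_add]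
  rfl

theorem HasDepth.pow (hX : HasDepth e a r X) (m : ℕ) :
    HasDepth e a (r * m) (X ^ m) ∧ leadMatrix e a (r * m) (X ^ m) = leadMatrix e a r X ^ m := by
  induction m with
  | zero => simpa using ⟨HasDepth.one, leadMatrix_one⟩
  | succ m ih =>
    rw [pow_succ, pow_succ, Nat.cast_succ, mul_add, mul_one]
    exact ⟨ih.1.mul hX, by rw [leadMatrix_mul ih.1 hX, ih.2]⟩

theorem HasDepth.leadMatrix_eq_zero (hX : HasDepth e a s X) (h : r < s) :
    leadMatrix e a r X = 0 := by
  ext i j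
  exact (hX i j).rcoeff_eq_zero (by linarith)

/-- There are finitely many entries, so their gains in order have a positive minimum. Hence the
elements of depth `r` with zero leading matrix form the step `r+`. -/
theorem HasDepth.exists_gt (hX : HasDepth e a r X) (h : leadMatrix e a r X = 0) :
    ∃ s > r, HasDepth e a s X := by
  choose v hv hX' using fun p : ι × ι =>
    (hX p.1 p.2).exists_gt (by rw [← leadMatrix_apply, h]; rfl)
  have h1 : ∃ ε > 0, ∀ p : ι × ι, ε ≤ v p - (r - a p.1 + a p.2) := by
    cases isEmpty_or_nonempty (ι × ι)
    · exact ⟨1, one_pos, fun p => isEmptyElim p⟩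
    · obtain ⟨p, hp⟩ := Finite.exists_min fun p : ι × ι => v p - (r - a p.1 + a p.2)
      exact ⟨_, sub_pos.2 (hv p), hp⟩
  obtain ⟨ε, hε, h1⟩ := h1
  exact ⟨r + ε, by linarith, fun i j => (hX' (i, j)).mono (by have := h1 (i, j); simp at this; linarith)⟩

/-- Laurent series have integral exponents, so a nonzero `(i, j)` entry forces `r - a i + a j` to be
an integer. The natural grading is therefore by weights modulo `1`. -/
theorem isHomogeneousOfDegree_leadMatrix :
    (leadMatrix e a r X).IsHomogeneousOfDegree (fun i => (a i : AddCircle (1 : ℝ))) r := by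
  intro i j h
  by_contra hne
  apply h
  apply rcoeff_eq_zero_of_not_int
  intro m hm
  apply hne
  rw [← AddCircle.coe_add, addCircle_coe_eq_iff]
  exact ⟨-m, by push_cast; linarith⟩

theorem trace_coeff_zero (Z : Module.End (LF k) U) :
    (LinearMap.trace (LF k) U Z).coeff 0 = (leadMatrix e a 0 Z).trace := by
  rw [LinearMap.trace_eq_matrix_trace (LF k) e, Matrix.trace, coeff_sum, Matrix.trace]
  refine Finset.sum_congr rfl fun i _ => ?_
  rw [Matrix.diag_apply, Matrix.diag_apply, leadMatrix_apply,
    show (0 : ℝ) - a i + a i = ((0 : ℤ) : ℝ) by simp, rcoeff_intCast]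

/-- Turns the residue pairing into the trace pairing of leading matrices. -/
theorem trace_mul_coeff_zero (hX : HasDepth e a (-r) X) (hY : HasDepth e a r Y) :
    (LinearMap.trace (LF k) U (X * Y)).coeff 0
      = (leadMatrix e a (-r) X * leadMatrix e a r Y).trace := by
  rw [trace_coeff_zero (e := e) (a := a), ← leadMatrix_mul hX hY, neg_add_cancel]

/-! ### Endomorphisms with monomial entries -/

/-- `c z ^ u`, or `0` if `u` is not an integer. -/
def LF.rmonomial (c : k) (u : ℝ) : LF k := if (⌊u⌋ : ℝ) = u then c • zpow ⌊u⌋ else 0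

theorem LF.rmonomial_intCast (c : k) (m : ℤ) : rmonomial c (m : ℝ) = c • zpow m := by
  rw [rmonomial, Int.floor_intCast, if_pos rfl]

theorem LF.rmonomial_zero (u : ℝ) : rmonomial (0 : k) u = 0 := by
  rw [rmonomial, zero_smul, ite_self]

theorem LF.ordGE_rmonomial (c : k) (u : ℝ) : OrdGE (rmonomial c u) u := by
  unfold rmonomial
  split_ifs with h
  · exact (OrdGE.zpow h.ge).smul c
  · exact OrdGE.zero _

theorem LF.rcoeff_rmonomial {c : k} {u : ℝ} (h : c ≠ 0 → ∃ m : ℤ, (m : ℝ) = u) :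
    (rmonomial c u).rcoeff u = c := by
  by_cases hc : c = 0
  · rw [hc, rmonomial_zero, rcoeff_zero]
  · obtain ⟨m, rfl⟩ := h hc
    rw [rmonomial_intCast, rcoeff_intCast, coeff_smul, coeff_zpow, if_pos rfl, mul_one]

theorem LF.rmonomial_mul {c c' : k} {u v : ℝ} (h : c ≠ 0 → ∃ m : ℤ, (m : ℝ) = u)
    (h' : c' ≠ 0 → ∃ m : ℤ, (m : ℝ) = v) :
    rmonomial c u * rmonomial c' v = rmonomial (c * c') (u + v) := by
  by_cases hc : c = 0
  · rw [hc, zero_mul, rmonomial_zero, rmonomial_zero, zero_mul]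
  by_cases hc' : c' = 0
  · rw [hc', mul_zero, rmonomial_zero, rmonomial_zero, mul_zero]
  obtain ⟨m, rfl⟩ := h hc
  obtain ⟨m', rfl⟩ := h' hc'
  rw [← Int.cast_add, rmonomial_intCast, rmonomial_intCast, rmonomial_intCast, smul_mul_smul_comm,
    zpow_mul_zpow]

theorem LF.rmonomial_add (c c' : k) (u : ℝ) :
    rmonomial (c + c') u = rmonomial c u + rmonomial c' u := by
  unfold rmonomial
  split_ifs
  · rw [add_smul]
  · rw [add_zero]

theorem LF.rmonomial_sum {κ : Type*} (S : Finset κ) (c : κ → k) (u : ℝ) :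
    rmonomial (∑ l ∈ S, c l) u = ∑ l ∈ S, rmonomial (c l) u := by
  classical
  induction S using Finset.induction_on with
  | empty => simp [rmonomial_zero]
  | insert x S hx ih => rw [Finset.sum_insert hx, Finset.sum_insert hx, rmonomial_add, ih]

variable (e a) in
/-- The endomorphism of depth `r` with leading matrix `C`, whose entries are monomials. -/
def ofLeadMatrix (r : ℝ) (C : Matrix ι ι k) : Module.End (LF k) U :=
  Matrix.toLin e e (Matrix.of fun i j => rmonomial (C i j) (r - a i + a j))

theorem toMatrix_ofLeadMatrix (C : Matrix ι ι k) (i j : ι) :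
    LinearMap.toMatrix e e (ofLeadMatrix e a r C) i j = rmonomial (C i j) (r - a i + a j) := by
  rw [ofLeadMatrix, LinearMap.toMatrix_toLin]
  rfl

theorem hasDepth_ofLeadMatrix (C : Matrix ι ι k) : HasDepth e a r (ofLeadMatrix e a r C) := by
  intro i j
  rw [toMatrix_ofLeadMatrix]
  exact ordGE_rmonomial _ _

theorem Matrix.IsHomogeneousOfDegree.exists_int {C : Matrix ι ι k}
    (hC : C.IsHomogeneousOfDegree (fun i => (a i : AddCircle (1 : ℝ))) r) (i j : ι)
    (h : C i j ≠ 0) : ∃ m : ℤ, (m : ℝ) = r - a i + a j := by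
  have := hC i j h
  rw [← AddCircle.coe_add, addCircle_coe_eq_iff] at this
  obtain ⟨m, hm⟩ := this
  exact ⟨-m, by push_cast; linarith⟩

theorem leadMatrix_ofLeadMatrix {C : Matrix ι ι k}
    (hC : C.IsHomogeneousOfDegree (fun i => (a i : AddCircle (1 : ℝ))) r) :
    leadMatrix e a r (ofLeadMatrix e a r C) = C := by
  ext i j
  rw [leadMatrix_apply, toMatrix_ofLeadMatrix]
  exact rcoeff_rmonomial (hC.exists_int i j)

theorem ofLeadMatrix_one : ofLeadMatrix e a 0 (1 : Matrix ι ι k) = 1 := by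
  apply (LinearMap.toMatrix e e).injective
  ext i j
  rw [toMatrix_ofLeadMatrix, LinearMap.toMatrix_one, Matrix.one_apply, Matrix.one_apply]
  split_ifs with h
  · subst h
    rw [show (0 : ℝ) - a i + a i = ((0 : ℤ) : ℝ) by simp, rmonomial_intCast, one_smul, zpow_eq_one]
  · exact rmonomial_zero _

/-- The identity is exact, without terms of higher depth, because products of monomials are
monomials. Invertible matrices of degree zero thus lift to elements of the parahoric. -/
theorem ofLeadMatrix_mul {C C' : Matrix ι ι k}
    (hC : C.IsHomogeneousOfDegree (fun i => (a i : AddCircle (1 : ℝ))) r)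
    (hC' : C'.IsHomogeneousOfDegree (fun i => (a i : AddCircle (1 : ℝ))) s) :
    ofLeadMatrix e a r C * ofLeadMatrix e a s C' = ofLeadMatrix e a (r + s) (C * C') := by
  apply (LinearMap.toMatrix e e).injective
  ext i j
  rw [toMatrix_ofLeadMatrix, LinearMap.toMatrix_mul, Matrix.mul_apply, Matrix.mul_apply,
    rmonomial_sum]
  refine Finset.sum_congr rfl fun l _ => ?_
  rw [toMatrix_ofLeadMatrix, toMatrix_ofLeadMatrix,
    rmonomial_mul (hC.exists_int i l) (hC'.exists_int l j)]
  congr 1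
  ring

/-! ### Leading terms of iterated connections -/

/-- If `D` agrees with `X`, of depth `-r`, modulo higher depth, so do their iterates. -/
theorem FlatConn.iterate_sub_pow_mem (D : FlatConn k U) (hX : HasDepth e a (-r) X)
    (hD : ∀ s, ∀ u ∈ weightedFilt e a s, D.op u - X u ∈ weightedFiltPlus e a (s - r)) {u : U}
    (hu : u ∈ weightedFilt e a s) (i : ℕ) :
    D.op^[i] u - (X ^ i) u ∈ weightedFiltPlus e a (s - r * i) := by
  have hD' : ∀ s, ∀ u ∈ weightedFilt e a s, D.op u ∈ weightedFilt e a (s - r) := by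
    intro s u hu
    obtain ⟨t, ht, hm⟩ := mem_weightedFiltPlus.1 (hD s u hu)
    rw [← sub_add_cancel (D.op u) (X u)]
    exact add_mem (weightedFilt_anti ht.le hm) (hX.map_mem hu)
  induction i with
  | zero => simp
  | succ i ih =>
    have h1 := hD _ _ (D.iterate_mem hD' hu i)
    have h2 := hX.map_mem_plus ih
    have h3 : D.op^[i + 1] u - (X ^ (i + 1)) u
        = (D.op (D.op^[i] u) - X (D.op^[i] u)) + X (D.op^[i] u - (X ^ i) u) := by
      rw [Function.iterate_succ_apply', pow_succ', Module.End.mul_apply, map_sub]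
      abel
    rw [h3, show s - r * (i + 1 : ℕ) = s - r * i - r by push_cast; ring]
    exact add_mem h1 h2

/-- If the leading matrix of `D` in depth `-r` is not nilpotent, the iterates of `D` grow with
rate `r`. -/
theorem FlatConn.growthRate_of_leadMatrix (D : FlatConn k U) (hr : 0 < r)
    (hX : HasDepth e a (-r) X)
    (hD : ∀ s, ∀ u ∈ weightedFilt e a s, D.op u - X u ∈ weightedFiltPlus e a (s - r))
    (hnil : ∀ i : ℕ, leadMatrix e a (-r) X ^ i ≠ 0) : D.GrowthRate r := by
  refine D.growthRate_of_filt (e := e) (a := a) hr (fun s u hu => ?_) fun i => ?_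
  · obtain ⟨t, ht, hm⟩ := mem_weightedFiltPlus.1 (hD s u hu)
    rw [← sub_add_cancel (D.op u) (X u)]
    exact add_mem (weightedFilt_anti ht.le hm) (hX.map_mem hu)
  -- If `D^i` were deeper than expected on every `e j`, so would be `X^i`, and all columns of the
  -- `i`-th power of the leading matrix would vanish.
  · by_contra! h
    apply hnil i
    rw [← (hX.pow i).2]
    ext l j
    have h1 := D.iterate_sub_pow_mem hX hD (basis_mem_weightedFilt e a j) i
    have h2 : (X ^ i) (e j) ∈ weightedFiltPlus e a (a j - r * i) := by
      have := sub_mem (h j) h1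
      rwa [sub_sub_cancel] at this
    obtain ⟨t, ht, h3⟩ := mem_weightedFiltPlus.1 h2
    rw [leadMatrix_apply, LinearMap.toMatrix_apply]
    exact (h3 l).rcoeff_eq_zero (by linarith)

end leading

/-! ### The Moy–Prasad filtrations of the standard representation -/

section standard

open LF

variable {k V : Type u} [Field k] [AddCommGroup V] [Module k V] {n : ℕ}
  (b : Module.Basis (Fin n) k V)

theorem torusElt_tmul_basis (t : Fin n → kˣ) (j : Fin n) :
    (torusElt b t).1 (1 ⊗ₜ b j) = (t j : k) • (1 ⊗ₜ b j) := by
  have h := (b.baseChange k).equiv_apply j ((b.baseChange k).unitsSMul t) (Equiv.refl (Fin n))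
  rw [Module.Basis.baseChange_apply] at h
  refine Eq.trans h ?_
  rw [Equiv.refl_apply, Module.Basis.unitsSMul_apply, Module.Basis.baseChange_apply]
  rfl

variable [CharZero k]

theorem basis_mem_weightSpace (j : Fin n) :
    b j ∈ weightSpace b (AlgRep.std k V) (Pi.single j 1) := by
  intro t
  refine (torusElt_tmul_basis b t j).trans ?_
  rw [TensorProduct.tmul_smul, Finset.prod_eq_single j]
  · rw [Pi.single_eq_same, zpow_one]
  · intro i _ hi
    rw [Pi.single_eq_of_ne hi, _root_.zpow_zero]
  · simp

/-- Comparing `j`-th coordinates gives `∏ t i ^ χ i = t j` on the whole torus. Taking `t` with a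
single entry `2` and all others `1` recovers each `χ i`, as `2` is not a root of unity in
characteristic zero. -/
theorem eq_single_of_mem_weightSpace {χ : Fin n → ℤ} {w : V}
    (hw : w ∈ weightSpace b (AlgRep.std k V) χ) {j : Fin n} (hj : b.repr w j ≠ 0) :
    χ = Pi.single j 1 := by
  have key : ∀ t : Fin n → kˣ, ((∏ i, t i ^ χ i : kˣ) : k) = t j := by
    intro t
    have h1 := hw t
    have h2 : (torusElt b t).1 (1 ⊗ₜ w) = ∑ i, (b.repr w i * t i) • (1 ⊗ₜ[k] b i : k ⊗[k] V) := by
      conv_lhs => rw [← b.sum_repr w, TensorProduct.tmul_sum, map_sum]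
      refine Finset.sum_congr rfl fun i _ => ?_
      rw [TensorProduct.tmul_smul, map_smul, torusElt_tmul_basis, mul_smul]
    have h3 : (torusElt b t).1 (1 ⊗ₜ w) = 1 ⊗ₜ (((∏ i, t i ^ χ i : kˣ) : k) • w) := h1
    rw [h3] at h2
    have h4 := congrArg (fun y => (b.baseChange k).repr y j) h2
    simp only [map_sum, map_smul, Module.Basis.baseChange_repr_tmul, Finsupp.coe_finsetSum,
      Finset.sum_apply, Finsupp.smul_apply, Module.Basis.repr_self] at h4
    rw [Finset.sum_eq_single j] at h4
    · simp at h4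
      have h5 : b.repr w j * (((∏ i, t i ^ χ i : kˣ) : k) - t j) = 0 := by
        push_cast; rw [mul_sub, sub_eq_zero, mul_comm, h4]
      exact sub_eq_zero.1 ((mul_eq_zero.1 h5).resolve_left hj)
    · intro i _ hi
      simp [Finsupp.single_eq_of_ne (Ne.symm hi)]
    · simp
  have two : ∀ m : ℤ, ((2 : k) ^ m) = 1 → m = 0 := by
    intro m hm
    by_contra h0
    have h2 : (2 : ℚ) ^ m = 1 := by
      apply Rat.cast_injective (α := k)
      push_cast
      exact hm
    rcases zpow_eq_one_iff_of_ne_zero₀ h0 |>.1 h2 with h | h <;> norm_num at h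
  funext i
  have h := key (Pi.mulSingle i (Units.mk0 2 two_ne_zero))
  rw [Finset.prod_eq_single i] at h
  · rw [Pi.mulSingle_eq_same] at h
    by_cases hij : i = j
    · subst hij
      rw [Pi.mulSingle_eq_same] at h
      rw [Pi.single_eq_same]
      have := two (χ i - 1) (by
        rw [zpow_sub₀ two_ne_zero, zpow_one, div_eq_one_iff_eq two_ne_zero]
        simpa using h)
      omega
    · rw [Pi.mulSingle_eq_of_ne (Ne.symm hij)] at h
      rw [Pi.single_eq_of_ne hij]
      exact two _ (by simpa using h)
  · intro l _ hl
    rw [Pi.mulSingle_eq_of_ne hl, one_zpow]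
  · simp

/-- The weights of `V` are the coordinate characters, with weight lines spanned by the `b j`, so
`χ(a)` is just `a j`. -/
theorem stdFilt_std (a : Fin n → ℝ) (s : ℝ) :
    stdFilt b (AlgRep.std k V) a s = weightedFilt (b.baseChange (LF k)) a s := by
  apply le_antisymm
  · rw [stdFilt, Submodule.span_le]
    rintro _ ⟨χ, m, hm, w, hw, rfl⟩ j
    rw [Module.Basis.baseChange_repr_tmul]
    by_cases hj : b.repr w j = 0
    · rw [hj, zero_smul]; exact OrdGE.zero _
    · refine (OrdGE.zpow ?_).smul _
      rw [eq_single_of_mem_weightSpace b hw hj] at hm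
      rw [Finset.sum_eq_single j] at hm
      · simp at hm; linarith
      · intro i _ hi
        rw [Pi.single_eq_of_ne hi]; simp
      · simp
  · rw [weightedFilt_eq_span, Submodule.span_le]
    rintro _ ⟨j, rfl⟩
    refine Submodule.subset_span ⟨Pi.single j 1, ⌈s - a j⌉, ?_, b j, basis_mem_weightSpace b j, ?_⟩
    · rw [Finset.sum_eq_single j]
      · have := Int.le_ceil (s - a j)
        simp; linarith
      · intro i _ hi
        rw [Pi.single_eq_of_ne hi]; simp
      · simp
    · show (zpow ⌈s - a j⌉ : LF k) • _ = _
      rw [Module.Basis.baseChange_apply, TensorProduct.smul_tmul', smul_eq_mul, mul_one]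

/-- The basis `g (1 ⊗ b i)` of `F ⊗ V`. -/
def movedBasis (g : GLhat k V) : Module.Basis (Fin n) (LF k) (LF k ⊗[k] V) :=
  (b.baseChange (LF k)).map (LinearMap.GeneralLinearGroup.toLinearEquiv g)

theorem movedBasis_apply (g : GLhat k V) (j : Fin n) : movedBasis b g j = g.1 (1 ⊗ₜ b j) := by
  rw [movedBasis, Module.Basis.map_apply, Module.Basis.baseChange_apply]
  rfl

theorem movedBasis_repr (g : GLhat k V) (u : LF k ⊗[k] V) :
    (movedBasis b g).repr u = (b.baseChange (LF k)).repr (g⁻¹.1 u) := rfl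

theorem preFilt_std (g : GLhat k V) (a : Fin n → ℝ) (s : ℝ) :
    preFilt b (g, a) (AlgRep.std k V) s = weightedFilt (movedBasis b g) a s := by
  rw [preFilt, stdFilt_std]
  have h : ∀ u, g.1 (g⁻¹.1 u) = u := fun u => by
    show (g.1 * g⁻¹.1) u = u
    rw [Units.mul_inv]; rfl
  have h' : ∀ u, g⁻¹.1 (g.1 u) = u := fun u => by
    show (g⁻¹.1 * g.1) u = u
    rw [Units.inv_mul]; rfl
  ext u
  constructor
  · rintro ⟨v, hv, rfl⟩ j
    have : (movedBasis b g).repr (g.1 v) = (b.baseChange (LF k)).repr v := by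
      rw [movedBasis_repr, h']
    show OrdGE ((movedBasis b g).repr (g.1 v) j) _
    rw [this]
    exact hv j
  · intro hu
    exact ⟨g⁻¹.1 u, hu, h u⟩

/-- The point `g a` of the building. -/
def Building.mk (g : GLhat k V) (a : Fin n → ℝ) : Building b :=
  Quotient.mk (buildingSetoid b) (g, a)

namespace Building

variable {b} [FiniteDimensional k V] (g : GLhat k V) (a : Fin n → ℝ) {r : ℝ}
  {X : Module.End (LF k) (LF k ⊗[k] V)}

theorem exists_eq_mk (x : Building b) : ∃ g a, x = mk b g a := by
  obtain ⟨⟨g, a⟩, rfl⟩ := Quotient.exists_rep x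
  exact ⟨g, a, rfl⟩

theorem filt_mk_std (s : ℝ) :
    (mk b g a).filt (AlgRep.std k V) s = weightedFilt (movedBasis b g) a s := preFilt_std b g a s

theorem filtPlus_mk_std (s : ℝ) :
    (mk b g a).filtPlus (AlgRep.std k V) s = weightedFiltPlus (movedBasis b g) a s := by
  unfold filtPlus weightedFiltPlus
  exact iSup_congr fun t => filt_mk_std g a t

theorem mem_glFilt_mk : X ∈ (mk b g a).glFilt r ↔ HasDepth (movedBasis b g) a r X := by
  rw [hasDepth_iff]
  show (∀ s, ∀ u ∈ (mk b g a).filt (AlgRep.std k V) s, _) ↔ _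
  simp only [filt_mk_std]

theorem mem_glFiltPlus_mk : X ∈ (mk b g a).glFiltPlus r ↔
    HasDepth (movedBasis b g) a r X ∧ leadMatrix (movedBasis b g) a r X = 0 := by
  have : Nonempty {t : ℝ // r < t} := ⟨⟨r + 1, by linarith⟩⟩
  have h : X ∈ (mk b g a).glFiltPlus r ↔ ∃ t > r, HasDepth (movedBasis b g) a t X := by
    rw [glFiltPlus, Submodule.mem_iSup_of_directed]
    · simp [mem_glFilt_mk]
    · intro x y
      refine ⟨⟨min x y, lt_min x.2 y.2⟩, fun Y hY => ?_, fun Y hY => ?_⟩ <;>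
        rw [mem_glFilt_mk] at hY ⊢
      · exact hY.mono (min_le_left _ _)
      · exact hY.mono (min_le_right _ _)
  rw [h]
  constructor
  · rintro ⟨t, ht, hX⟩
    exact ⟨hX.mono ht.le, hX.leadMatrix_eq_zero ht⟩
  · rintro ⟨hX, h0⟩
    exact hX.exists_gt h0

theorem mem_parahoric_mk {h : GLhat k V} : h ∈ (mk b g a).parahoric ↔
    HasDepth (movedBasis b g) a 0 h.1 ∧ HasDepth (movedBasis b g) a 0 h⁻¹.1 := by
  have h1 : ∀ u, h.1 (h⁻¹.1 u) = u := fun u => by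
    show (h.1 * h⁻¹.1) u = u
    rw [Units.mul_inv]; rfl
  have h2 : ∀ u, h⁻¹.1 (h.1 u) = u := fun u => by
    show (h⁻¹.1 * h.1) u = u
    rw [Units.inv_mul]; rfl
  simp only [← mem_glFilt_mk]
  constructor
  · intro hh
    refine ⟨fun s u hu => ?_, fun s u hu => ?_⟩ <;> rw [add_zero]
    · exact (hh s u).2 hu
    · exact (((mk b g a).parahoric.inv_mem hh) s u).2 hu
  · rintro ⟨p, q⟩ s u
    constructor
    · intro hu
      have := q s _ hu
      rwa [add_zero, h2] at this
    · intro hu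
      have := p s _ hu
      rwa [add_zero] at this

end Building

end standard

/-! ### Semistability of strata -/

section semistable

open LF

/-- Polynomial functions are polynomial along polynomial curves. -/
theorem exists_polynomial_of_mem_adjoin {k M : Type u} [Field k] [AddCommGroup M] [Module k M]
    {p : M → k} (hp : p ∈ Algebra.adjoin k (Set.range fun (l : Module.Dual k M) (y : M) => l y))
    {κ : Type*} (S : Finset κ) (m : κ → ℕ) (γ : κ → M) :
    ∃ Q : Polynomial k, ∀ t : k, Q.eval t = p (∑ l ∈ S, t ^ m l • γ l) := by
  induction hp using Algebra.adjoin_induction with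
  | mem x hx =>
    obtain ⟨l, rfl⟩ := hx
    refine ⟨∑ i ∈ S, Polynomial.C (l (γ i)) * Polynomial.X ^ m i, fun t => ?_⟩
    show _ = l (∑ i ∈ S, t ^ m i • γ i)
    rw [Polynomial.eval_finsetSum, map_sum]
    refine Finset.sum_congr rfl fun i _ => ?_
    rw [map_smul, Polynomial.eval_mul, Polynomial.eval_C, Polynomial.eval_pow, Polynomial.eval_X,
      smul_eq_mul, mul_comm]
  | algebraMap c => exact ⟨Polynomial.C c, fun t => by simp⟩
  | add x y _ _ hx hy =>
    obtain ⟨Q, hQ⟩ := hx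
    obtain ⟨R, hR⟩ := hy
    exact ⟨Q + R, fun t => by rw [Polynomial.eval_add, hQ, hR]; rfl⟩
  | mul x y _ _ hx hy =>
    obtain ⟨Q, hQ⟩ := hx
    obtain ⟨R, hR⟩ := hy
    exact ⟨Q * R, fun t => by rw [Polynomial.eval_mul, hQ, hR]; rfl⟩

variable {k V : Type u} [Field k] [AddCommGroup V] [Module k V] {n : ℕ}
  {b : Module.Basis (Fin n) k V} [CharZero k] [FiniteDimensional k V]

namespace Building

variable (g : GLhat k V) (a : Fin n → ℝ) {r : ℝ}

/-- The leading matrix, as a linear map on `gl(F ⊗ V)_{x, r}`. -/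
def leadLinear (r : ℝ) : (mk b g a).glFilt r →ₗ[k] Matrix (Fin n) (Fin n) k where
  toFun Y := leadMatrix (movedBasis b g) a r Y.1
  map_add' Y Z := leadMatrix_add
  map_smul' c Y := by
    ext i j
    rw [leadMatrix_apply, LinearMap.toMatrix_apply]
    show ((movedBasis b g).repr (c • Y.1 (movedBasis b g j)) i).rcoeff _ = _
    rw [← algebraMap_smul (LF k) c, map_smul, Finsupp.smul_apply, algebraMap_smul, rcoeff_smul,
      RingHom.id_apply, Matrix.smul_apply, leadMatrix_apply, LinearMap.toMatrix_apply, smul_eq_mul]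

/-- The leading matrix, as a linear map on `gl(F ⊗ V)_{x, r} / gl(F ⊗ V)_{x, r+}`. -/
def leadGr (r : ℝ) : (mk b g a).Gr r →ₗ[k] Matrix (Fin n) (Fin n) k :=
  Submodule.liftQ _ (leadLinear g a r) fun _ hY =>
    ((mem_glFiltPlus_mk g a).1 (Submodule.mem_comap.1 hY)).2

/-- The functional `Y ↦ Tr(B Y)` on leading matrices. -/
def dualOfMatrix (r : ℝ) : Matrix (Fin n) (Fin n) k →ₗ[k] Module.Dual k ((mk b g a).Gr r) where
  toFun B := Matrix.traceLinearMap (Fin n) k k ∘ₗ LinearMap.mulLeft k B ∘ₗ leadGr g a r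
  map_add' B C := by
    ext Y
    simp [add_mul]
  map_smul' c B := by
    ext Y
    simp

theorem dualOfMatrix_mk (B : Matrix (Fin n) (Fin n) k) (Y : (mk b g a).glFilt r) :
    dualOfMatrix g a r B (Submodule.Quotient.mk Y)
      = (B * leadMatrix (movedBasis b g) a r Y.1).trace := rfl

/-- By `trace_mul_coeff_zero`, the functional only sees the leading matrix of its representative. -/
theorem isRepresentative_mk {β : Module.Dual k ((mk b g a).Gr r)}
    {X : Module.End (LF k) (LF k ⊗[k] V)} : IsRepresentative (mk b g a) r β X ↔
      HasDepth (movedBasis b g) a (-r) X ∧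
        β = dualOfMatrix g a r (leadMatrix (movedBasis b g) a (-r) X) := by
  rw [IsRepresentative, mem_glFilt_mk]
  refine and_congr_right fun hX => ⟨fun h => ?_, fun h Y => ?_⟩
  · refine LinearMap.ext fun y => ?_
    obtain ⟨Y, rfl⟩ := Submodule.Quotient.mk_surjective _ y
    rw [h Y, trace_mul_coeff_zero hX ((mem_glFilt_mk g a).1 Y.2)]
    rfl
  · rw [h, trace_mul_coeff_zero hX ((mem_glFilt_mk g a).1 Y.2)]
    rfl

/-- Cyclicity of the trace turns the coadjoint action into conjugation of leading matrices. -/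
theorem dualOfMatrix_comp_adGr (C : Matrix (Fin n) (Fin n) k) (h : (mk b g a).parahoric) :
    dualOfMatrix g a r C ∘ₗ (mk b g a).adGr r h⁻¹
      = dualOfMatrix g a r (leadMatrix (movedBasis b g) a 0 h.1.1 * C
          * leadMatrix (movedBasis b g) a 0 (h.1⁻¹).1) := by
  refine LinearMap.ext fun y => ?_
  obtain ⟨Y, rfl⟩ := Submodule.Quotient.mk_surjective _ y
  obtain ⟨h1, h2⟩ := (mem_parahoric_mk g a).1 h.2
  have hY := (mem_glFilt_mk g a).1 Y.2
  have h3 : leadMatrix (movedBasis b g) a r ((h.1⁻¹).1 * Y.1 * h.1.1)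
      = leadMatrix (movedBasis b g) a 0 (h.1⁻¹).1 * leadMatrix (movedBasis b g) a r Y.1
        * leadMatrix (movedBasis b g) a 0 h.1.1 := by
    have e1 := leadMatrix_mul h2 hY
    have e2 := leadMatrix_mul (h2.mul hY) h1
    rw [zero_add] at e1
    rw [zero_add, add_zero] at e2
    rw [e2, e1]
  have h4 : (dualOfMatrix g a r C ∘ₗ (mk b g a).adGr r h⁻¹) (Submodule.Quotient.mk Y)
      = (C * leadMatrix (movedBasis b g) a r ((h.1⁻¹).1 * Y.1 * (h.1⁻¹)⁻¹.1)).trace := rfl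
  rw [h4, inv_inv, h3, dualOfMatrix_mk, ← mul_assoc, ← mul_assoc, Matrix.trace_mul_comm]
  simp only [mul_assoc]

variable {g a}

/-- A stratum with nilpotent leading matrix is not fundamental. -/
theorem not_isFundamental_of_pow_eq_zero {C : Matrix (Fin n) (Fin n) k}
    (hC : C.IsHomogeneousOfDegree (fun i => (a i : AddCircle (1 : ℝ))) ((-r : ℝ) : AddCircle (1 : ℝ)))
    {N : ℕ} (hN : C ^ N = 0) :
    ¬ IsFundamental (mk b g a) r (dualOfMatrix g a r C) := by
  -- The idempotents give a one-parameter subgroup `t ↦ ∑ t^i q i` of degree zero. It conjugates `C`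
  -- to `∑ t^(i-j) q i C q j`, where only `i > j` survives, so the orbit tends to `0` as `t → 0`.
  obtain ⟨q, hq0, hq1, hq2, hq3, hq4⟩ := hC.exists_idempotents hN
  rw [IsFundamental, not_not]
  intro p hp hvan
  let S := Finset.range N ×ˢ Finset.range N
  let γ : ℕ × ℕ → Module.Dual k ((mk b g a).Gr r) := fun l =>
    dualOfMatrix g a r (q l.1 * C * q l.2)
  -- The truncated subtraction in the exponent is harmless: `γ l` vanishes when `l.1 ≤ l.2`.
  obtain ⟨Q, hQ⟩ := exists_polynomial_of_mem_adjoin hp S (fun l => l.1 - l.2) γ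
  have hmul : ∀ s t : k, s * t = 1 →
      (∑ i ∈ Finset.range N, s ^ i • q i) * (∑ i ∈ Finset.range N, t ^ i • q i) = 1 := by
    intro s t hst
    rw [Finset.sum_mul_sum, ← hq3]
    refine Finset.sum_congr rfl fun i hi => ?_
    rw [Finset.sum_eq_single i]
    · rw [smul_mul_smul_comm, ← mul_pow, hst, one_pow, one_smul, hq1]
    · intro j _ hji
      rw [smul_mul_smul_comm, hq2 i j (Ne.symm hji), smul_zero]
    · exact fun h => absurd hi h
  have hhom : ∀ s : k, (∑ i ∈ Finset.range N, s ^ i • q i).IsHomogeneousOfDegree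
      (fun i => (a i : AddCircle (1 : ℝ))) ((0 : ℝ) : AddCircle (1 : ℝ)) := fun s =>
    Matrix.IsHomogeneousOfDegree.sum fun i _ => (hq0 i).smul _
  have hroot : ∀ t : k, t ≠ 0 → Q.eval t = 0 := by
    intro t ht
    rw [hQ]
    apply hvan
    have e1 := hmul t t⁻¹ (mul_inv_cancel₀ ht)
    have e2 := hmul t⁻¹ t (inv_mul_cancel₀ ht)
    let h : GLhat k V :=
      { val := ofLeadMatrix (movedBasis b g) a 0 (∑ i ∈ Finset.range N, t ^ i • q i)
        inv := ofLeadMatrix (movedBasis b g) a 0 (∑ i ∈ Finset.range N, t⁻¹ ^ i • q i)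
        val_inv := by rw [ofLeadMatrix_mul (hhom t) (hhom t⁻¹), e1, add_zero, ofLeadMatrix_one]
        inv_val := by rw [ofLeadMatrix_mul (hhom t⁻¹) (hhom t), e2, add_zero, ofLeadMatrix_one] }
    have hh : h ∈ (mk b g a).parahoric :=
      (mem_parahoric_mk g a).2 ⟨hasDepth_ofLeadMatrix _, hasDepth_ofLeadMatrix _⟩
    refine ⟨⟨h, hh⟩, ?_⟩
    show dualOfMatrix g a r C ∘ₗ (mk b g a).adGr r (⟨h, hh⟩ : (mk b g a).parahoric)⁻¹ = _
    rw [dualOfMatrix_comp_adGr]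
    have l1 : leadMatrix (movedBasis b g) a 0 h.1 = ∑ i ∈ Finset.range N, t ^ i • q i :=
      leadMatrix_ofLeadMatrix (hhom t)
    have l2 : leadMatrix (movedBasis b g) a 0 (h⁻¹).1 = ∑ i ∈ Finset.range N, t⁻¹ ^ i • q i :=
      leadMatrix_ofLeadMatrix (hhom t⁻¹)
    rw [l1, l2, Finset.sum_mul, Finset.sum_mul_sum, ← Finset.sum_product', map_sum]
    refine Finset.sum_congr rfl fun l hl => ?_
    obtain ⟨hl1, hl2⟩ := Finset.mem_product.1 hl
    rw [smul_mul_assoc, smul_mul_smul_comm, map_smul]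
    rcases le_or_gt l.1 l.2 with hle | hlt
    · have : γ l = 0 := by
        show dualOfMatrix g a r _ = 0
        rw [hq4 _ _ hle (Finset.mem_range.1 hl2), map_zero]
      rw [this, smul_zero]
      exact smul_eq_zero_of_right _ this
    · congr 1
      rw [inv_pow, ← div_eq_mul_inv, div_eq_iff (pow_ne_zero _ ht), ← pow_add,
        Nat.sub_add_cancel hlt.le]
  -- `Q` vanishes at every nonzero `t`, hence identically; its value at `t = 0` is `p 0`.
  have hQ0 : Q = 0 := by
    refine Polynomial.eq_zero_of_infinite_isRoot Q ?_
    refine (Set.infinite_univ.sdiff (Set.finite_singleton (0 : k))).mono fun t ht => ?_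
    exact hroot t ht.2
  have h0 := hQ 0
  rw [hQ0, Polynomial.eval_zero] at h0
  rw [h0]
  congr 1
  symm
  refine Finset.sum_eq_zero fun l hl => ?_
  obtain ⟨hl1, hl2⟩ := Finset.mem_product.1 hl
  rcases le_or_gt l.1 l.2 with hle | hlt
  · have : γ l = 0 := by
      show dualOfMatrix g a r _ = 0
      rw [hq4 _ _ hle (Finset.mem_range.1 hl2), map_zero]
    rw [this, smul_zero]
  · rw [zero_pow (by omega), zero_smul]

variable (g a) in
/-- The matrix that represents a functional. -/
def matrixOfDual (r : ℝ) (β : Module.Dual k ((mk b g a).Gr r)) : Matrix (Fin n) (Fin n) k :=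
  -- The indices are swapped because the trace of `B` times the elementary matrix at `(j, i)` is `B
  -- i j`.
  Matrix.of fun i j => β (Submodule.Quotient.mk
    ⟨ofLeadMatrix (movedBasis b g) a r (Matrix.single j i 1),
      (mem_glFilt_mk g a).2 (hasDepth_ofLeadMatrix _)⟩)

/-- Homogeneity is what makes the recovery possible: at a nonzero entry of `B` the exponent of the
test monomial is an integer, so the monomial is not replaced by `0`. -/
theorem matrixOfDual_dualOfMatrix {B : Matrix (Fin n) (Fin n) k}
    (hB : B.IsHomogeneousOfDegree (fun i => (a i : AddCircle (1 : ℝ)))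
      ((-r : ℝ) : AddCircle (1 : ℝ))) :
    matrixOfDual (b := b) g a r (dualOfMatrix g a r B) = B := by
  ext i j
  obtain ⟨L, hL⟩ : ∃ L, L = leadMatrix (movedBasis b g) a r
    (ofLeadMatrix (movedBasis b g) a r (Matrix.single j i (1 : k))) := ⟨_, rfl⟩
  have h1 : matrixOfDual (b := b) g a r (dualOfMatrix g a r B) i j = (B * L).trace := by
    rw [matrixOfDual, Matrix.of_apply, dualOfMatrix_mk, hL]
  have h2 : ∀ l m, L l m = (rmonomial (Matrix.single j i (1 : k) l m) (r - a l + a m)).rcoeff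
      (r - a l + a m) := fun l m => by
    rw [hL, leadMatrix_apply, toMatrix_ofLeadMatrix]
  have h3 : L = Matrix.single j i (L j i) := by
    ext l m
    by_cases hlm : j = l ∧ i = m
    · obtain ⟨rfl, rfl⟩ := hlm
      rw [Matrix.single_apply_same]
    · rw [Matrix.single_apply, if_neg hlm, h2, Matrix.single_apply, if_neg hlm, rmonomial_zero,
        rcoeff_zero]
  rw [h1, h3, Matrix.trace_mul_single]
  by_cases hij : B i j = 0
  · simp [hij]
  · have h4 : L j i = 1 := by
      rw [h2, Matrix.single_apply_same]
      refine rcoeff_rmonomial fun _ => ?_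
      obtain ⟨m, hm⟩ := hB.exists_int i j hij
      exact ⟨-m, by push_cast; linarith⟩
    simp [h4]

/-- A stratum whose leading matrix has a nonzero eigenvalue is fundamental. -/
theorem isFundamental_of_det_eq_zero {C : Matrix (Fin n) (Fin n) k}
    (hC : C.IsHomogeneousOfDegree (fun i => (a i : AddCircle (1 : ℝ))) ((-r : ℝ) : AddCircle (1 : ℝ)))
    {μ : k} (hμ : μ ≠ 0) (hdet : (Matrix.scalar (Fin n) μ - C).det = 0) :
    IsFundamental (mk b g a) r (dualOfMatrix g a r C) := by
  intro hmem
  -- Working over the ring of functions of `β`, the determinant of `M` is a polynomial function. It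
  -- is invariant under conjugation, vanishes on the orbit of `C`, and takes the value `μ^n ≠ 0` at
  -- `β = 0`.
  let M : Matrix (Fin n) (Fin n) (Module.Dual k ((mk b g a).Gr r) → k) :=
    Matrix.of fun i j β => (Matrix.scalar (Fin n) μ - matrixOfDual g a r β) i j
  have hM : ∀ β, M.det β = (Matrix.scalar (Fin n) μ - matrixOfDual g a r β).det := by
    intro β
    have := RingHom.map_det (Pi.evalRingHom (fun _ : Module.Dual k ((mk b g a).Gr r) => k) β) M
    refine this.trans ?_
    congr 1
  have hadj : M.det ∈ Algebra.adjoin k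
      (Set.range fun (l : Module.Dual k (Module.Dual k ((mk b g a).Gr r)))
        (y : Module.Dual k ((mk b g a).Gr r)) => l y) := by
    rw [Matrix.det_apply']
    refine sum_mem fun σ _ => mul_mem (intCast_mem _ _) (prod_mem fun i _ => ?_)
    have h1 : M (σ i) i = algebraMap k _ (Matrix.scalar (Fin n) μ (σ i) i)
        - fun β => matrixOfDual g a r β (σ i) i := rfl
    rw [h1]
    refine sub_mem (Subalgebra.algebraMap_mem _ _) (Algebra.subset_adjoin ?_)
    exact ⟨Module.Dual.eval k _ (Submodule.Quotient.mk
      ⟨ofLeadMatrix (movedBasis b g) a r (Matrix.single i (σ i) 1),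
        (mem_glFilt_mk g a).2 (hasDepth_ofLeadMatrix _)⟩), rfl⟩
  have h0 := hmem M.det hadj ?_
  · rw [hM] at h0
    have : matrixOfDual g a r (0 : Module.Dual k ((mk b g a).Gr r)) = 0 := rfl
    rw [this, sub_zero, Matrix.scalar_apply, Matrix.det_diagonal, Finset.prod_const] at h0
    exact pow_ne_zero _ hμ h0
  · rintro _ ⟨h, rfl⟩
    have hl : leadMatrix (movedBasis b g) a 0 h.1.1 * leadMatrix (movedBasis b g) a 0 (h.1⁻¹).1
        = 1 := by
      obtain ⟨h1, h2⟩ := (mem_parahoric_mk g a).1 h.2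
      rw [← leadMatrix_one (e := movedBasis b g) (a := a), ← Units.mul_inv h.1,
        ← leadMatrix_mul h1 h2, add_zero]
    have hhom : (leadMatrix (movedBasis b g) a 0 h.1.1 * C
        * leadMatrix (movedBasis b g) a 0 (h.1⁻¹).1).IsHomogeneousOfDegree
          (fun i => (a i : AddCircle (1 : ℝ))) ((-r : ℝ) : AddCircle (1 : ℝ)) := by
      have := (isHomogeneousOfDegree_leadMatrix (e := movedBasis b g) (a := a) (r := 0)
        (X := h.1.1)).mul hC |>.mul (isHomogeneousOfDegree_leadMatrix (e := movedBasis b g)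
          (a := a) (r := 0) (X := (h.1⁻¹).1))
      rwa [← AddCircle.coe_add, ← AddCircle.coe_add, zero_add, add_zero] at this
    show M.det (dualOfMatrix g a r C ∘ₗ (mk b g a).adGr r h⁻¹) = 0
    rw [hM, dualOfMatrix_comp_adGr, matrixOfDual_dualOfMatrix hhom]
    have h5 : Matrix.scalar (Fin n) μ - leadMatrix (movedBasis b g) a 0 h.1.1 * C
        * leadMatrix (movedBasis b g) a 0 (h.1⁻¹).1
        = leadMatrix (movedBasis b g) a 0 h.1.1 * (Matrix.scalar (Fin n) μ - C)
          * leadMatrix (movedBasis b g) a 0 (h.1⁻¹).1 := by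
      rw [mul_sub, sub_mul, ← (Matrix.scalar_commute μ (fun _ => mul_comm _ _) _).eq,
        mul_assoc (Matrix.scalar (Fin n) μ), hl, mul_one]
    rw [h5, Matrix.det_mul, Matrix.det_mul, hdet, mul_zero, zero_mul]

end Building

end semistable

/-! ### Transport of connections -/

section transport

open LF

variable {k : Type u} [Field k] {U U' : Type u} [AddCommGroup U] [Module (LF k) U]
  [Module k⟦X⟧ U] [IsScalarTower k⟦X⟧ (LF k) U] [AddCommGroup U'] [Module (LF k) U']
  [Module k⟦X⟧ U'] [IsScalarTower k⟦X⟧ (LF k) U']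

theorem isLattice_map (f : U ≃ₗ[LF k] U') (L : Submodule k⟦X⟧ U) [Submodule.IsLattice (LF k) L] :
    Submodule.IsLattice (LF k) (L.map (f.toLinearMap.restrictScalars k⟦X⟧)) where
  fg := (Submodule.IsLattice.fg (A := LF k) (M := L)).map _
  span_eq_top := by
    rw [Submodule.map_coe]
    have := Submodule.map_span f.toLinearMap (L : Set U)
    rw [Submodule.IsLattice.span_eq_top, Submodule.map_top, LinearEquiv.range] at this
    exact this.symm

theorem mem_map_iff (f : U ≃ₗ[LF k] U') (L : Submodule k⟦X⟧ U) (u : U) :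
    f u ∈ L.map (f.toLinearMap.restrictScalars k⟦X⟧) ↔ u ∈ L :=
  ⟨fun ⟨_, hv, h⟩ => f.injective h ▸ hv, fun h => ⟨u, h, rfl⟩⟩

namespace FlatConn

variable {D : FlatConn k U} {D' : FlatConn k U'}

theorem RegularSingular.map (f : U ≃ₗ[LF k] U') (h : ∀ u, f (D.op u) = D'.op (f u))
    (hD : D.RegularSingular) : D'.RegularSingular := by
  obtain ⟨L, hL, hst⟩ := hD
  refine ⟨_, isLattice_map f L, ?_⟩
  rintro _ ⟨u, hu, rfl⟩
  exact ⟨_, hst u hu, h u⟩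

theorem RegularSingular.congr (f : U ≃ₗ[LF k] U') (h : ∀ u, f (D.op u) = D'.op (f u)) :
    D.RegularSingular ↔ D'.RegularSingular := by
  refine ⟨fun hD => hD.map f h, fun hD => hD.map f.symm fun u => ?_⟩
  rw [LinearEquiv.symm_apply_eq, h, LinearEquiv.apply_symm_apply]

theorem GrowthRate.comap {r : ℝ} (f : U ≃ₗ[LF k] U') (h : ∀ u, f (D.op u) = D'.op (f u))
    (hD : D'.GrowthRate r) : D.GrowthRate r := by
  intro L hL n e
  obtain ⟨v, C, hv⟩ := hD _ (isLattice_map f L) n (e.map f)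
  refine ⟨v, C, fun i hi => ⟨?_, (hv i hi).2⟩⟩
  have hs : ∀ u, f (D.op^[i] u) = D'.op^[i] (f u) := fun u =>
    (Function.Semiconj.iterate_right (f := f) h i) u
  convert (hv i hi).1 using 3 with m
  refine forall_congr' fun j => ?_
  rw [Module.Basis.map_apply, ← hs, ← map_smul, mem_map_iff]

end FlatConn

end transport

/-! ### Flat bundles in a trivialization -/

namespace AlgRep

variable {k V W : Type u} [Field k] [AddCommGroup V] [Module k V] [AddCommGroup W] [Module k W]

theorem diff_std {R : Type u} [CommRing R] [Algebra k R] (X : Module.End R (R ⊗[k] V)) :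
    (std k V).diff X = X :=
  oneAddEps_injective ((act_oneAddEps (std k V) X).symm)

variable {R S : Type u} [CommRing R] [Algebra k R] [CommRing S] [Algebra k S]

/-- The map of dual numbers induced by a `k`-algebra homomorphism. -/
def dualNumberMap (f : R →ₐ[k] S) : DualNumber R →ₐ[k] DualNumber S :=
  AlgHom.ofLinearMap
    (inl S ∘ₗ f.toLinearMap ∘ₗ (fst R).toLinearMap + inr S ∘ₗ f.toLinearMap ∘ₗ snd R)
    (by ext <;> simp [inl, inr, fst, snd])
    (by
      intro x y
      ext <;> simp [inl, inr, fst, snd, mul_comm])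

theorem bc_dualNumberMap_inl (f : R →ₐ[k] S) (x : R ⊗[k] V) :
    bc V (dualNumberMap f).toLinearMap (bc V (inl R) x) = bc V (inl S) (bc V f.toLinearMap x) := by
  simp only [bc, ← LinearMap.comp_apply, ← LinearMap.rTensor_comp]
  congr 2
  refine LinearMap.ext fun r => ?_
  apply TrivSqZeroExt.ext <;> simp [dualNumberMap, inl, inr, fst, snd]

theorem bc_dualNumberMap_inr (f : R →ₐ[k] S) (x : R ⊗[k] V) :
    bc V (dualNumberMap f).toLinearMap (bc V (inr R) x) = bc V (inr S) (bc V f.toLinearMap x) := by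
  simp only [bc, ← LinearMap.comp_apply, ← LinearMap.rTensor_comp]
  congr 2
  refine LinearMap.ext fun r => ?_
  apply TrivSqZeroExt.ext <;> simp [dualNumberMap, inl, inr, fst, snd]

theorem bc_snd_dualNumberMap (f : R →ₐ[k] S) (x : DualNumber R ⊗[k] V) :
    bc V (snd S) (bc V (dualNumberMap f).toLinearMap x) = bc V f.toLinearMap (bc V (snd R) x) := by
  simp only [bc, ← LinearMap.comp_apply, ← LinearMap.rTensor_comp]
  congr 2
  refine LinearMap.ext fun r => ?_
  simp [dualNumberMap, inl, inr, fst, snd]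

/-- The differential of a representation commutes with base change. -/
theorem diff_bcEnd (ρ : AlgRep k V W) (f : R →ₐ[k] S) (X : Module.End R (R ⊗[k] V))
    (w : R ⊗[k] W) :
    ρ.diff (bcEnd f X) (bc W f.toLinearMap w) = bc W f.toLinearMap (ρ.diff X w) := by
  rw [← bc_snd_act, ← bc_snd_act, ← bc_dualNumberMap_inl, ← bc_snd_dualNumberMap]
  congr 1
  -- Naturality along `R[ε] → S[ε]`, which carries `1 + ε X` to `1 + ε` times the base change of
  -- `X`.
  refine ρ.natural _ _ (dualNumberMap f) (oneAddEps X) (oneAddEps (bcEnd f X)) (fun v => ?_) _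
  rw [decomp v, map_add, map_add, map_add, map_add, bc_dualNumberMap_inl, bc_dualNumberMap_inr,
    oneAddEps_inl, oneAddEps_inr, oneAddEps_inl, oneAddEps_inr, map_add, bc_dualNumberMap_inl,
    bc_dualNumberMap_inr, bc_dualNumberMap_inr, bcEnd_bc]

end AlgRep

namespace FlatGLBundle

open LF

variable {k V W : Type u} [Field k] [AddCommGroup V] [Module k V] [AddCommGroup W] [Module k W]
  (P : FlatGLBundle k V) (ρ : AlgRep k V W) (φ : P.Triv)

/-- The connection `d + ρ([∇]_φ)` on `F ⊗ W`. -/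
def connAt : FlatConn k (LF k ⊗[k] W) where
  op := (tauHat W).toAddMonoidHom + (ρ.diff (P.conn φ)).toAddMonoidHom
  leibniz f u := by
    show tauHat W (f • u) + ρ.diff (P.conn φ) (f • u)
      = LF.tau f • u + f • (tauHat W u + ρ.diff (P.conn φ) u)
    rw [tauHat_smul, map_smul, smul_add]; abel

theorem connAt_apply (u : LF k ⊗[k] W) :
    (P.connAt ρ φ).op u = tauHat W u + ρ.diff (P.conn φ) u := rfl

/-- Evaluation of a section in the trivialization `φ`. -/
def evalAt : P.assocSpace ρ ≃ₗ[LF k] LF k ⊗[k] W :=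
  LinearEquiv.ofBijective ((LinearMap.proj φ).comp (P.assocSpace ρ).subtype) <| by
    constructor
    · intro s t h
      apply Subtype.ext
      funext ψ
      obtain ⟨g, rfl, -⟩ := P.simply_transitive φ ψ
      rw [s.2, t.2]
      exact congrArg _ h
    · intro w
      -- A section is recovered from its value at `φ` by transport along the unique `g ψ` taking `φ`
      -- to `ψ`; uniqueness of `g ψ` gives equivariance.
      choose g hg hu using fun ψ => P.simply_transitive φ ψ
      refine ⟨⟨fun ψ => (ρ.act (LF k) (g ψ)).1 w, fun h ψ => ?_⟩, ?_⟩
      · have : g (h • ψ) = h * g ψ := (hu _ _ (by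
          show (h * g ψ) • φ = h • ψ
          rw [mul_smul]; exact congrArg (h • ·) (hg ψ))).symm
        show (ρ.act (LF k) (g (h • ψ))).1 w = _
        rw [this, map_mul]; rfl
      · have : g φ = 1 := (hu φ 1 (one_smul _ _)).symm
        show (ρ.act (LF k) (g φ)).1 w = w
        rw [this, map_one]; rfl

theorem evalAt_op (s : P.assocSpace ρ) :
    P.evalAt ρ φ ((P.assoc ρ).op s) = (P.connAt ρ φ).op (P.evalAt ρ φ s) := rfl

theorem assoc_regularSingular_iff :
    (P.assoc ρ).RegularSingular ↔ (P.connAt ρ φ).RegularSingular :=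
  FlatConn.RegularSingular.congr (P.evalAt ρ φ) (P.evalAt_op ρ φ)

theorem assoc_growthRate {r : ℝ} (h : (P.connAt ρ φ).GrowthRate r) :
    (P.assoc ρ).GrowthRate r :=
  h.comap (P.evalAt ρ φ) (P.evalAt_op ρ φ)

theorem connAt_std (u : LF k ⊗[k] V) :
    (P.connAt (AlgRep.std k V) φ).op u = tauHat V u + P.conn φ u := by
  rw [connAt_apply, AlgRep.diff_std]

theorem connAt_smul (g : GLhat k V) (u : LF k ⊗[k] V) :
    (P.connAt (AlgRep.std k V) (g • φ)).op (g.1 u)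
      = g.1 ((P.connAt (AlgRep.std k V) φ).op u) :=
  P.assoc_equivariant (AlgRep.std k V) g φ u

theorem tauHat_one_tmul (w : W) : tauHat W ((1 : LF k) ⊗ₜ[k] w) = 0 := by
  rw [tauHat, bc, LinearMap.rTensor_tmul, tau_one, TensorProduct.zero_tmul]

/-- The inclusion `k⟦z⟧ → F`, as a homomorphism of `k`-algebras. -/
def _root_.LF.ofPowerSeries (k : Type u) [Field k] : k⟦X⟧ →ₐ[k] LF k :=
  { algebraMap k⟦X⟧ (LF k) with
    commutes' := fun c => HahnSeries.ofPowerSeries_C c }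

/-- If the matrix of the connection is integral, all associated connections are regular
singular. -/
theorem regularSingular_of_integral {n : ℕ} (b : Module.Basis (Fin n) k V)
    (h : HasDepth (b.baseChange (LF k)) 0 0 (P.conn φ)) : P.RegularSingular := by
  intro W _ _ _ ρ
  rw [P.assoc_regularSingular_iff ρ φ]
  refine (P.connAt ρ φ).regularSingular_of_basis
    (e := (Module.finBasis k W).baseChange (LF k)) fun j => ?_
  rw [connAt_apply, Module.Basis.baseChange_apply, tauHat_one_tmul, zero_add]
  choose A hA using fun i j => (show OrdGE (LinearMap.toMatrix (b.baseChange (LF k))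
    (b.baseChange (LF k)) (P.conn φ) i j) 0 by simpa using h i j).exists_powerSeries
  -- The connection matrix descends to `k⟦z⟧`, where the differential of `ρ` is also defined. Hence
  -- `ρ` of the matrix preserves the image of `k⟦z⟧ ⊗ W`.
  let X : Module.End k⟦X⟧ (k⟦X⟧ ⊗[k] V) :=
    Matrix.toLin (b.baseChange k⟦X⟧) (b.baseChange k⟦X⟧) (Matrix.of A)
  have hX : P.conn φ = AlgRep.bcEnd (LF.ofPowerSeries k) X := by
    refine (b.baseChange (LF k)).ext fun j => ?_
    have h1 : (b.baseChange (LF k)) j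
        = bc V (LF.ofPowerSeries k).toLinearMap ((b.baseChange k⟦X⟧) j) := by
      rw [Module.Basis.baseChange_apply, Module.Basis.baseChange_apply, bc, LinearMap.rTensor_tmul,
        AlgHom.toLinearMap_apply, map_one]
    conv_rhs => rw [h1, AlgRep.bcEnd_bc, Matrix.toLin_self, map_sum]
    rw [← (b.baseChange (LF k)).sum_repr (P.conn φ _)]
    refine Finset.sum_congr rfl fun i _ => ?_
    rw [AlgRep.bc_algHom_smul, ← LinearMap.toMatrix_apply, ← hA, Module.Basis.baseChange_apply,
      Module.Basis.baseChange_apply, bc, LinearMap.rTensor_tmul, AlgHom.toLinearMap_apply, map_one]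
    rfl
  have h2 : (1 : LF k) ⊗ₜ[k] (Module.finBasis k W j)
      = bc W (LF.ofPowerSeries k).toLinearMap (1 ⊗ₜ Module.finBasis k W j) := by
    rw [bc, LinearMap.rTensor_tmul, AlgHom.toLinearMap_apply, map_one]
  rw [hX, h2, AlgRep.diff_bcEnd]
  generalize ρ.diff X _ = y
  induction y with
  | zero => rw [map_zero]; exact zero_mem _
  | add x y hx hy => rw [map_add]; exact add_mem hx hy
  | tmul p w =>
    intro i
    rw [bc, LinearMap.rTensor_tmul, Module.Basis.baseChange_repr_tmul, Pi.zero_apply, sub_zero]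
    exact (OrdGE.powerSeries p).smul _

end FlatGLBundle

/-! ### Slopes of contained strata -/

namespace FlatGLBundle

open LF Building

variable {k V : Type u} [Field k] [CharZero k] [Algebra ℝ k] [AddCommGroup V] [Module k V]
  [FiniteDimensional k V] {n : ℕ} {b : Module.Basis (Fin n) k V} (P : FlatGLBundle k V)

theorem const_smul_mem {W : Type u} [AddCommGroup W] [Module k W] (c : k)
    {L : Submodule k⟦X⟧ (LF k ⊗[k] W)} {u : LF k ⊗[k] W} (hu : u ∈ L) : c • u ∈ L := by
  rw [← algebraMap_smul (LF k) c]
  exact (OrdGE.const c le_rfl).smul_mem hu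

/-- The depth of a fundamental stratum contained in `P` governs the growth of the connection on
the standard representation. -/
theorem growth_of_containsStratum {φ : P.Triv} {x : Building b} {r : ℝ} (hr : 0 ≤ r)
    {β : Module.Dual k (x.Gr r)} (hβ : IsFundamental x r β) (hP : P.ContainsStratum φ x r β) :
    (r = 0 ∧ (P.assoc (AlgRep.std k V)).RegularSingular) ∨
      (0 < r ∧ (P.assoc (AlgRep.std k V)).GrowthRate r) := by
  obtain ⟨g, a, rfl⟩ := exists_eq_mk (b := b) x
  obtain ⟨X, hX, hD⟩ := hP
  obtain ⟨hXd, rfl⟩ := (isRepresentative_mk g a).1 hX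
  have hD' : ∀ s, ∀ u ∈ weightedFilt (movedBasis b g) a s,
      (P.connAt (AlgRep.std k V) φ).op u - algebraMap ℝ k s • u - X u
        ∈ weightedFiltPlus (movedBasis b g) a (s - r) := by
    intro s u hu
    have := hD V (AlgRep.std k V) s u (by rw [filt_mk_std]; exact hu)
    rwa [filtPlus_mk_std, AlgRep.diff_std X] at this
  -- In depth zero, the step with index `0` is a stable lattice, since there the scalar term
  -- vanishes. In positive depth the scalar `s` preserves the step `s`, hence falls into `(s - r)+`
  -- and can be dropped.
  rcases hr.eq_or_lt with rfl | hr
  · refine Or.inl ⟨rfl, ?_⟩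
    rw [P.assoc_regularSingular_iff _ φ]
    refine FlatConn.regularSingular_of_filt (e := movedBasis b g) (a := a) (s := 0) _
      fun u hu => ?_
    obtain ⟨t, ht, h1⟩ := mem_weightedFiltPlus.1 (hD' 0 u hu)
    rw [map_zero, zero_smul, sub_zero] at h1
    rw [← sub_add_cancel ((P.connAt (AlgRep.std k V) φ).op u) (X u)]
    refine add_mem (weightedFilt_anti (by linarith) h1) ?_
    have := hXd.map_mem hu
    rwa [neg_zero, add_zero] at this
  · refine Or.inr ⟨hr, P.assoc_growthRate _ φ ?_⟩
    refine FlatConn.growthRate_of_leadMatrix _ hr hXd (fun s u hu => ?_) fun i hi => ?_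
    · have h1 : (P.connAt (AlgRep.std k V) φ).op u - X u
          = ((P.connAt (AlgRep.std k V) φ).op u - algebraMap ℝ k s • u - X u)
            + algebraMap ℝ k s • u := by abel
      rw [h1]
      exact add_mem (hD' s u hu) (weightedFilt_le_plus (by linarith) (const_smul_mem _ hu))
    · exact not_isFundamental_of_pow_eq_zero isHomogeneousOfDegree_leadMatrix hi hβ

/-! ### The operator `τ` on Moy–Prasad lattices -/

variable {W : Type u} [AddCommGroup W] [Module k W] (ρ : AlgRep k V W)

theorem tauHat_mem_stdFilt {a : Fin n → ℝ} {s : ℝ} {w : LF k ⊗[k] W} (hw : w ∈ stdFilt b ρ a s) :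
    tauHat W w ∈ stdFilt b ρ a s := by
  induction hw using Submodule.span_induction with
  | mem y hy =>
    obtain ⟨χ, m, hm, w, hw, rfl⟩ := hy
    rw [tauHat, bc, LinearMap.rTensor_tmul, tau_zpow, ← TensorProduct.smul_tmul']
    exact const_smul_mem _ (Submodule.subset_span ⟨χ, m, hm, w, hw, rfl⟩)
  | zero => rw [map_zero]; exact zero_mem _
  | add x y _ _ hx hy => rw [map_add]; exact add_mem hx hy
  | smul p y hy h =>
    rw [powerSeries_smul, tauHat_smul]
    exact add_mem ((OrdGE.powerSeries p).tau.smul_mem hy) ((OrdGE.powerSeries p).smul_mem h)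

theorem zpow_one_smul_mem_stdFilt {a : Fin n → ℝ} {s : ℝ} {w : LF k ⊗[k] W}
    (hw : w ∈ stdFilt b ρ a s) : (zpow 1 : LF k) • w ∈ stdFilt b ρ a (s + 1) := by
  induction hw using Submodule.span_induction with
  | mem y hy =>
    obtain ⟨χ, m, hm, w, hw, rfl⟩ := hy
    rw [TensorProduct.smul_tmul', smul_eq_mul, zpow_mul_zpow]
    exact Submodule.subset_span ⟨χ, 1 + m, by push_cast; linarith, w, hw, rfl⟩
  | zero => rw [smul_zero]; exact zero_mem _
  | add x y _ _ hx hy => rw [smul_add]; exact add_mem hx hy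
  | smul p y hy h =>
    rw [smul_comm]
    exact Submodule.smul_mem _ _ h

/-- The derivation `τ` kills the constant term. -/
theorem ordGE_tau_powerSeries (p : k⟦X⟧) : OrdGE (tau (algebraMap k⟦X⟧ (LF k) p)) 1 := by
  intro m hm
  rw [tau_coeff]
  have h : m < 1 := by exact_mod_cast hm
  rcases (by omega : m = 0 ∨ m < 0) with rfl | h
  · simp
  · rw [OrdGE.powerSeries p m (by exact_mod_cast h), mul_zero]

theorem filt_mk_one [FiniteDimensional k W] (a : Fin n → ℝ) (s : ℝ) :
    (Building.mk b 1 a).filt ρ s = stdFilt b ρ a s := by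
  show (stdFilt b ρ a s).map ((ρ.act (LF k) 1).1.restrictScalars k⟦X⟧) = _
  rw [map_one]
  exact Submodule.map_id _

theorem filt_le_filtPlus [FiniteDimensional k W] (x : Building b) {s t : ℝ} (h : s < t) :
    x.filt ρ t ≤ x.filtPlus ρ s :=
  le_iSup (fun t : {t : ℝ // s < t} => x.filt ρ t) ⟨t, h⟩

/-- At the origin of the standard apartment, `τ` acts on the graded piece of degree `i` by `i`. -/
theorem tauHat_sub_mem [FiniteDimensional k W] (s : ℝ) {w : LF k ⊗[k] W}
    (hw : w ∈ stdFilt b ρ 0 s) :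
    tauHat W w - algebraMap ℝ k s • w ∈ (Building.mk b 1 0).filtPlus ρ s := by
  induction hw using Submodule.span_induction with
  | mem y hy =>
    obtain ⟨χ, m, hm, w, hw, rfl⟩ := hy
    -- At the origin the characters contribute nothing, so the depth is the exponent `m`, the
    -- eigenvalue of `τ`.
    have hm' : s ≤ m := by simpa using hm
    have h1 : tauHat W ((zpow m : LF k) ⊗ₜ[k] w) - algebraMap ℝ k s • ((zpow m : LF k) ⊗ₜ[k] w)
        = algebraMap ℝ k (m - s) • ((zpow m : LF k) ⊗ₜ[k] w) := by
      rw [tauHat, bc, LinearMap.rTensor_tmul, tau_zpow, ← TensorProduct.smul_tmul', map_sub,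
        map_intCast]
      exact (sub_smul (m : k) (algebraMap ℝ k s) ((zpow m : LF k) ⊗ₜ[k] w)).symm
    rw [h1]
    rcases hm'.eq_or_lt with h | h
    · rw [h, sub_self, map_zero, zero_smul]; exact zero_mem _
    · refine filt_le_filtPlus ρ _ h ?_
      rw [filt_mk_one]
      exact const_smul_mem _ (Submodule.subset_span ⟨χ, m, by simp, w, hw, rfl⟩)
  | zero => rw [map_zero, smul_zero, sub_zero]; exact zero_mem _
  | add x y _ _ hx hy =>
    rw [map_add, smul_add, add_sub_add_comm]
    exact add_mem hx hy
  | smul p y hy h =>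
    have h1 : tauHat W (p • y) - algebraMap ℝ k s • p • y
        = tau (algebraMap k⟦X⟧ (LF k) p) • y + p • (tauHat W y - algebraMap ℝ k s • y) := by
      rw [smul_sub, powerSeries_smul p y, tauHat_smul, powerSeries_smul p (tauHat W y),
        powerSeries_smul p (algebraMap ℝ k s • y), smul_comm (algebraMap ℝ k s)]
      abel
    rw [h1]
    refine add_mem (filt_le_filtPlus ρ _ (lt_add_one s) ?_) (Submodule.smul_mem _ _ h)
    rw [filt_mk_one]
    have h2 : tau (algebraMap k⟦X⟧ (LF k) p)
        = (zpow (-1) * tau (algebraMap k⟦X⟧ (LF k) p)) * zpow 1 := by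
      rw [mul_right_comm, zpow_mul_zpow, neg_add_cancel, zpow_eq_one, one_mul]
    rw [h2, mul_smul]
    exact (OrdGE.zpow_mul_iff.2 ((ordGE_tau_powerSeries p).mono (by simp))).smul_mem
      (zpow_one_smul_mem_stdFilt ρ hy)

theorem movedBasis_one : movedBasis b (1 : GLhat k V) = b.baseChange (LF k) := by
  refine Module.Basis.eq_of_apply_eq fun j => ?_
  rw [movedBasis_apply, Module.Basis.baseChange_apply]
  rfl

/-- A trivialization in which the connection has a leading matrix with a nonzero eigenvalue yields
a fundamental stratum. -/
theorem hasSlope_of_leadMatrix {φ : P.Triv} {a : Fin n → ℝ} {r : ℝ}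
    (hr : 0 < r ∨ (r = 0 ∧ a = 0))
    (hA : HasDepth (b.baseChange (LF k)) a (-r) (P.conn φ)) {μ : k} (hμ : μ ≠ 0)
    (hdet : (Matrix.scalar (Fin n) μ
      - leadMatrix (b.baseChange (LF k)) a (-r) (P.conn φ)).det = 0) :
    P.HasSlope b r := by
  rw [← movedBasis_one] at hA hdet
  refine ⟨by rcases hr with h | ⟨h, -⟩ <;> linarith, φ, Building.mk b 1 a, _,
    isFundamental_of_det_eq_zero isHomogeneousOfDegree_leadMatrix hμ hdet,
    P.conn φ, (isRepresentative_mk 1 a).2 ⟨hA, rfl⟩, fun W _ _ _ ρ i w hw => ?_⟩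
  rw [filt_mk_one] at hw
  rw [add_sub_right_comm, add_sub_cancel_right]
  -- With the connection matrix itself as representative, it remains to bound `τ - i`. For `r > 0`
  -- preserving the step `i` is enough; for `r = 0` the depth must strictly increase, which is why
  -- the origin is used.
  rcases hr with hr | ⟨rfl, rfl⟩
  · refine filt_le_filtPlus ρ _ (t := i) (by linarith) ?_
    rw [filt_mk_one]
    exact sub_mem (tauHat_mem_stdFilt ρ hw) (const_smul_mem _ hw)
  · rw [sub_zero]
    exact tauHat_sub_mem ρ i hw

end FlatGLBundle

/-! ### Existence of fundamental strata -/

/-- The Newton slope of a monic polynomial with lower coefficients `c`. -/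
theorem LF.exists_newtonSlope {k : Type u} [Field k] {n : ℕ} (c : Fin n → LF k) :
    ∃ q : ℚ, 0 ≤ q ∧ (∀ j, LF.OrdGE (c j) (-(q * ((n : ℝ) - j)))) ∧
      (q = 0 ∨ ∃ j, (c j).rcoeff (-(q * ((n : ℝ) - j))) ≠ 0) := by
  choose o ho1 ho2 using fun j : {j : Fin n // c j ≠ 0} => LF.coeff_order_ne_zero j.2
  have hpos : ∀ j : Fin n, (0 : ℚ) < (n : ℚ) - j := fun j => by
    have : ((j : ℕ) : ℚ) < n := by exact_mod_cast j.2
    linarith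
  -- The candidate slopes are `-ord (c j) / (n - j)`, with `none` contributing the slope `0`. A
  -- maximum attained at some `j` makes the corresponding leading coefficient nonzero.
  let w : Option {j : Fin n // c j ≠ 0} → ℚ := fun x =>
    x.elim 0 fun j => -(o j : ℚ) / ((n : ℚ) - (j : Fin n))
  obtain ⟨x, hx⟩ := Finite.exists_max w
  refine ⟨w x, hx none, fun j => ?_, ?_⟩
  · by_cases hj : c j = 0
    · rw [hj]; exact LF.OrdGE.zero _
    · refine (ho2 ⟨j, hj⟩).mono ?_
      have h1 : -(o ⟨j, hj⟩ : ℚ) / ((n : ℚ) - j) ≤ w x := hx (some ⟨j, hj⟩)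
      rw [div_le_iff₀ (hpos j)] at h1
      have h2 : -(o ⟨j, hj⟩ : ℝ) ≤ w x * ((n : ℝ) - j) := by exact_mod_cast h1
      linarith
  · cases x with
    | none => exact Or.inl rfl
    | some j =>
      refine Or.inr ⟨j, ?_⟩
      have h1 : w (some j) * ((n : ℚ) - (j : Fin n)) = -(o j : ℚ) :=
        div_mul_cancel₀ _ (hpos j).ne'
      have h2 : (w (some j) : ℝ) * ((n : ℝ) - (j : Fin n)) = -(o j : ℝ) := by exact_mod_cast h1
      rw [h2, neg_neg, LF.rcoeff_intCast]
      exact ho1 j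

/-- A monic polynomial with a nonzero lower coefficient has a nonzero root. -/
theorem exists_ne_zero_pow_eq_sum {k : Type*} [Field k] [IsAlgClosed k] {n : ℕ} {γ : Fin n → k}
    {i : Fin n} (hi : γ i ≠ 0) : ∃ μ : k, μ ≠ 0 ∧ μ ^ n = ∑ j, γ j * μ ^ (j : ℕ) := by
  let p : Polynomial k := ∑ j : Fin n, Polynomial.C (γ j) * Polynomial.X ^ (j : ℕ)
  have hdeg : p.degree < n := by
    refine (Polynomial.degree_sum_le _ _).trans_lt ((Finset.sup_lt_iff (WithBot.bot_lt_coe n)).2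
      fun j _ => (Polynomial.degree_C_mul_X_pow_le _ _).trans_lt ?_)
    exact Nat.cast_lt.2 j.2
  have hcoeff : p.coeff i = γ i := by
    rw [Polynomial.finsetSum_coeff, Finset.sum_eq_single i]
    · simp
    · intro j _ hj
      rw [Polynomial.coeff_C_mul_X_pow, if_neg]
      exact fun h => hj (Fin.ext h.symm)
    · simp
  have hmonic : (Polynomial.X ^ n - p).Monic := Polynomial.monic_X_pow_sub hdeg
  by_contra! h
  -- If `0` were the only root, the polynomial would be `X ^ n` and all lower coefficients would
  -- vanish.
  have hroots : ∀ μ ∈ (Polynomial.X ^ n - p).roots, μ = 0 := by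
    intro μ hμ
    by_contra h0
    apply h μ h0
    have := (Polynomial.mem_roots'.1 hμ).2
    rw [Polynomial.IsRoot, Polynomial.eval_sub, Polynomial.eval_pow, Polynomial.eval_X,
      Polynomial.eval_finsetSum, sub_eq_zero] at this
    rw [this]
    simp
  have hprod := (IsAlgClosed.splits (Polynomial.X ^ n - p)).eq_prod_roots_of_monic hmonic
  rw [Multiset.eq_replicate_of_mem hroots, Multiset.map_replicate, Multiset.prod_replicate,
    Polynomial.C_0, sub_zero] at hprod
  have hnd : (Polynomial.X ^ n - p).natDegree = n := by
    rw [Polynomial.natDegree_sub_eq_left_of_natDegree_lt, Polynomial.natDegree_X_pow]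
    rw [Polynomial.natDegree_X_pow]
    by_cases hp : p = 0
    · exact absurd (by rw [← hcoeff, hp, Polynomial.coeff_zero]) hi
    · exact (Polynomial.natDegree_lt_iff_degree_lt hp).2 hdeg
  have hcard : (Polynomial.X ^ n - p).roots.card = n :=
    (IsAlgClosed.splits _).natDegree_eq_card_roots.symm.trans hnd
  rw [hcard, sub_eq_self] at hprod
  exact hi (by rw [← hcoeff, hprod, Polynomial.coeff_zero])

/-- A companion matrix has the eigenvalues given by its characteristic equation. -/
theorem Matrix.det_scalar_sub_companion {k : Type*} [Field k] {n : ℕ} (hn : 0 < n)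
    {C : Matrix (Fin n) (Fin n) k} {γ : Fin n → k}
    (h1 : ∀ i j : Fin n, (j : ℕ) + 1 < n → C i j = if (i : ℕ) = j + 1 then 1 else 0)
    (h2 : ∀ i j : Fin n, (j : ℕ) + 1 = n → C i j = γ i)
    {μ : k} (hμ : μ ^ n = ∑ j, γ j * μ ^ (j : ℕ)) : (Matrix.scalar (Fin n) μ - C).det = 0 := by
  rw [← Matrix.exists_vecMul_eq_zero_iff]
  -- The left eigenvector `(1, μ, μ^2, …)`, nonzero because of its first entry.
  refine ⟨fun i => μ ^ (i : ℕ), fun h => ?_, ?_⟩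
  · have := congrFun h ⟨0, hn⟩
    simp at this
  · rw [Matrix.vecMul_sub, sub_eq_zero]
    funext j
    have hl : Matrix.vecMul (fun i : Fin n => μ ^ (i : ℕ)) (Matrix.scalar (Fin n) μ) j
        = μ ^ ((j : ℕ) + 1) := by
      rw [Matrix.scalar_apply, Matrix.vecMul_diagonal, pow_succ]
    rw [hl, Matrix.vecMul, dotProduct]
    by_cases hj : (j : ℕ) + 1 < n
    · rw [Finset.sum_eq_single ⟨j + 1, hj⟩]
      · rw [h1 _ _ hj, if_pos rfl, mul_one]
      · intro i _ hi
        rw [h1 _ _ hj, if_neg fun h => hi (Fin.ext h), mul_zero]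
      · simp
    · have hj' : (j : ℕ) + 1 = n := by omega
      rw [hj', hμ]
      exact Finset.sum_congr rfl fun i _ => by rw [h2 _ _ hj', mul_comm]

namespace FlatGLBundle

open LF

variable {k V : Type u} [Field k] [AddCommGroup V] [Module k V]
  [FiniteDimensional k V] {n : ℕ} (b : Module.Basis (Fin n) k V) (P : FlatGLBundle k V)

/-- In a suitable trivialization the matrix of the connection is a companion matrix. -/
theorem exists_companion [CharZero k] : ∃ (φ : P.Triv) (c : Fin n → LF k), ∀ i j : Fin n,
    LinearMap.toMatrix (b.baseChange (LF k)) (b.baseChange (LF k)) (P.conn φ) i j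
      = if (j : ℕ) + 1 < n then (if (i : ℕ) = j + 1 then 1 else 0) else c i := by
  obtain ⟨φ⟩ := P.nonempty
  let e₀ := b.baseChange (LF k)
  obtain ⟨u, e, he⟩ := (P.connAt (AlgRep.std k V) φ).exists_cyclic_basis
    (Module.finrank_eq_card_basis e₀ |>.trans (Fintype.card_fin n))
  -- The gauge transformation taking the cyclic basis to the standard one. Since `τ` kills `1 ⊗ b
  -- j`, the columns of the new matrix are the images of the vectors `∇ (e j)`.
  let g : GLhat k V := LinearMap.GeneralLinearGroup.ofLinearEquiv (e.equiv e₀ (Equiv.refl _))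
  have hg : ∀ j, g.1 (e j) = e₀ j := fun j => e.equiv_apply j e₀ (Equiv.refl _)
  have hconn : ∀ j, P.conn (g • φ) (e₀ j) = g.1 ((P.connAt (AlgRep.std k V) φ).op (e j)) := by
    intro j
    rw [← P.connAt_smul, hg, connAt_std, Module.Basis.baseChange_apply, tauHat_one_tmul, zero_add]
  rcases Nat.eq_zero_or_pos n with h0 | hpos
  · subst h0
    exact ⟨g • φ, 0, fun i => i.elim0⟩
  refine ⟨g • φ, fun i => e₀.repr (P.conn (g • φ) (e₀ ⟨n - 1, by omega⟩)) i, fun i j => ?_⟩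
  rw [LinearMap.toMatrix_apply]
  split_ifs with hj hij
  · have h1 : P.conn (g • φ) (e₀ j) = e₀ ⟨j + 1, hj⟩ := by
      rw [hconn, ← hg, he, he]
      congr 1
      exact (Function.iterate_succ_apply' _ _ _).symm
    have h2 : i = ⟨j + 1, hj⟩ := Fin.ext hij
    show e₀.repr (P.conn (g • φ) (e₀ j)) i = 1
    rw [h1, Module.Basis.repr_self, h2, Finsupp.single_eq_same]
  · have h1 : P.conn (g • φ) (e₀ j) = e₀ ⟨j + 1, hj⟩ := by
      rw [hconn, ← hg, he, he]
      congr 1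
      exact (Function.iterate_succ_apply' _ _ _).symm
    show e₀.repr (P.conn (g • φ) (e₀ j)) i = 0
    rw [h1, Module.Basis.repr_self, Finsupp.single_eq_of_ne]
    exact fun h => hij (congrArg Fin.val h)
  · have h2 : j = ⟨n - 1, by omega⟩ := Fin.ext (by have := j.2; show (j : ℕ) = n - 1; omega)
    rw [h2]

/-- Rationality of the depth is needed for the slope of a vector bundle. The integral companion form
found when `q = 0` controls all representations at once. -/
theorem exists_rat_hasSlope [IsAlgClosed k] [CharZero k] [Algebra ℝ k] [Nontrivial V] :
    ∃ q : ℚ, 0 ≤ q ∧ P.HasSlope b q ∧ (q = 0 → P.RegularSingular) := by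
  obtain ⟨φ, c, hc⟩ := P.exists_companion b
  have hn : 0 < n := by
    rcases Nat.eq_zero_or_pos n with h0 | h
    · subst h0
      exact b.index_nonempty.elim fun i => i.elim0
    · exact h
  obtain ⟨q, hq0, hq1, hq2⟩ := exists_newtonSlope c
  -- With weights `-q j`, the required order is `0` on the subdiagonal and `-q (n - i)` in row `i`
  -- of the last column, which is the Newton bound.
  have hdepth : HasDepth (b.baseChange (LF k)) (fun j => -((q : ℝ) * j)) (-q) (P.conn φ) := by
    intro i j
    rw [hc]
    split_ifs with h1 h2
    · refine OrdGE.one ?_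
      have : ((i : ℕ) : ℝ) = j + 1 := by exact_mod_cast h2
      dsimp only
      rw [this]; linarith
    · exact OrdGE.zero _
    · refine (hq1 i).mono ?_
      have : ((j : ℕ) : ℝ) + 1 = n := by exact_mod_cast (by have := j.2; omega : (j : ℕ) + 1 = n)
      dsimp only
      rw [← this]; linarith
  have hlead1 : ∀ i j : Fin n, (j : ℕ) + 1 < n →
      leadMatrix (b.baseChange (LF k)) (fun j => -((q : ℝ) * j)) (-q) (P.conn φ) i j
        = if (i : ℕ) = j + 1 then 1 else 0 := by
    intro i j hj
    rw [leadMatrix_apply, hc, if_pos hj]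
    split_ifs with h2
    · have : ((i : ℕ) : ℝ) = j + 1 := by exact_mod_cast h2
      rw [this, show -(q : ℝ) - -((q : ℝ) * (j + 1)) + -((q : ℝ) * j) = ((0 : ℤ) : ℝ) by
        push_cast; ring, rcoeff_intCast, coeff_one, if_pos rfl]
    · exact rcoeff_zero _
  have hlead2 : ∀ i j : Fin n, (j : ℕ) + 1 = n →
      leadMatrix (b.baseChange (LF k)) (fun j => -((q : ℝ) * j)) (-q) (P.conn φ) i j
        = (c i).rcoeff (-((q : ℝ) * ((n : ℝ) - i))) := by
    intro i j hj
    rw [leadMatrix_apply, hc, if_neg (by omega)]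
    congr 1
    have : ((j : ℕ) : ℝ) + 1 = n := by exact_mod_cast hj
    rw [← this]; ring
  rcases hq0.eq_or_lt with h0 | hpos
  · subst h0
    have ha : (fun j : Fin n => -(((0 : ℚ) : ℝ) * j)) = 0 := by funext j; simp
    rw [ha, Rat.cast_zero, neg_zero] at hdepth
    refine ⟨0, le_rfl, ?_, fun _ => P.regularSingular_of_integral φ b hdepth⟩
    rw [Rat.cast_zero]
    obtain ⟨C, hC⟩ : ∃ C, C = leadMatrix (b.baseChange (LF k)) 0 0 (P.conn φ) := ⟨_, rfl⟩
    obtain ⟨μ, hμ⟩ := IsAlgClosed.exists_root C.charpoly (by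
      rw [Matrix.charpoly_degree_eq_dim, Fintype.card_fin]
      exact_mod_cast hn.ne')
    rw [Polynomial.IsRoot, Matrix.eval_charpoly] at hμ
    -- The leading matrix may be nilpotent here. The gauge transformation `z ^ (-1)` adds `1` to the
    -- connection matrix and turns the eigenvalue `0` into `1`.
    by_cases hμ0 : μ = 0
    · let z : GLhat k V :=
        { val := (zpow (-1) : LF k) • 1
          inv := (zpow 1 : LF k) • 1
          val_inv := by
            rw [smul_mul_smul_comm, zpow_mul_zpow, neg_add_cancel, zpow_eq_one, one_smul, mul_one]
          inv_val := by
            rw [smul_mul_smul_comm, zpow_mul_zpow, add_neg_cancel, zpow_eq_one, one_smul, mul_one] }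
      have hz : ∀ u, z.1 u = (zpow (-1) : LF k) • u := fun _ => rfl
      have hconn : P.conn (z • φ) = P.conn φ + 1 := by
        refine (b.baseChange (LF k)).ext fun j => ?_
        have h1 := P.connAt_smul φ z ((b.baseChange (LF k)) j)
        rw [hz, hz, connAt_std, connAt_std, tauHat_smul, tau_zpow, Int.cast_neg, Int.cast_one,
          neg_smul, one_smul, Module.Basis.baseChange_apply, tauHat_one_tmul, smul_zero, add_zero,
          zero_add, map_smul] at h1
        have h4 : (zpow (-1) : LF k) • P.conn (z • φ) (1 ⊗ₜ[k] b j)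
            = (zpow (-1) : LF k) • (P.conn φ (1 ⊗ₜ[k] b j) + 1 ⊗ₜ[k] b j) := by
          rw [smul_add, ← h1, add_right_comm, ← add_smul, neg_add_cancel, zero_smul, zero_add]
        have h2 : (zpow (-1) : LF k) ≠ 0 := fun h => by
          have := congrArg (fun f => LF.coeff f (-1)) h
          rw [coeff_zpow, if_pos rfl] at this
          exact one_ne_zero this
        have h3 := smul_right_injective _ h2 h4
        rw [Module.Basis.baseChange_apply, LinearMap.add_apply]
        exact h3
      refine P.hasSlope_of_leadMatrix (φ := z • φ) (a := 0) (Or.inr ⟨rfl, rfl⟩) (μ := 1) ?_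
        one_ne_zero ?_
      · rw [neg_zero, hconn]
        exact hdepth.add HasDepth.one
      · rw [neg_zero, hconn, leadMatrix_add, leadMatrix_one, ← hC, ← hμ, hμ0, map_one, map_zero]
        congr 1
        abel
    · refine P.hasSlope_of_leadMatrix (φ := φ) (a := 0) (Or.inr ⟨rfl, rfl⟩) (μ := μ) ?_ hμ0 ?_
      · rwa [neg_zero]
      · rw [neg_zero, ← hC, hμ]
  · obtain ⟨i, hi⟩ := hq2.resolve_left hpos.ne'
    obtain ⟨μ, hμ0, hμ⟩ := exists_ne_zero_pow_eq_sum
      (γ := fun i => (c i).rcoeff (-((q : ℝ) * ((n : ℝ) - i)))) hi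
    exact ⟨q, hq0, P.hasSlope_of_leadMatrix (Or.inl (by exact_mod_cast hpos)) hdepth hμ0
      (Matrix.det_scalar_sub_companion hn hlead1 hlead2 hμ), fun h => absurd h hpos.ne'⟩

end FlatGLBundle

end

/-! ### Comparison of the two slopes -/

theorem mainTheorem6 {k V : Type u} [Field k] [IsAlgClosed k] [Algebra ℝ k]
    [AddCommGroup V] [Module k V] [FiniteDimensional k V] [Nontrivial V]
    {n : ℕ} (b : Module.Basis (Fin n) k V) (P : FlatGLBundle k V) :
    (∃ r : ℝ, (∀ s : ℝ, P.HasSlope b s ↔ s = r) ∧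
      (∀ s : ℝ, (P.assoc (AlgRep.std k V)).HasSlope s ↔ s = r)) ∧
    (P.RegularSingular ↔ (P.assoc (AlgRep.std k V)).RegularSingular) := by
  have : CharZero k := charZero_of_injective_algebraMap (algebraMap ℝ k).injective
  obtain ⟨φ₀⟩ := P.nonempty
  have : FiniteDimensional (LF k) (P.assocSpace (AlgRep.std k V)) :=
    (P.evalAt (AlgRep.std k V) φ₀).symm.finiteDimensional
  -- The two alternatives exclude each other and each determines `s`, so one existing fundamental
  -- stratum settles the depth of all of them.
  have hdich : ∀ s, P.HasSlope b s → (s = 0 ∧ (P.assoc (AlgRep.std k V)).RegularSingular) ∨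
      (0 < s ∧ (P.assoc (AlgRep.std k V)).GrowthRate s) := by
    rintro s ⟨hs, φ, x, β, hβ, hc⟩
    exact P.growth_of_containsStratum hs hβ hc
  obtain ⟨q, hq0, hq, hreg⟩ := P.exists_rat_hasSlope b
  rcases hdich _ hq with ⟨hq1, hRS⟩ | ⟨hq1, hG⟩
  · have hP : P.RegularSingular := hreg (by exact_mod_cast hq1)
    rw [hq1] at hq
    refine ⟨⟨0, fun s => ⟨fun hs => ?_, fun hs => hs ▸ hq⟩, fun s => ⟨fun hs => ?_, fun hs => ?_⟩⟩,
      fun _ => hRS, fun _ => hP⟩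
    · rcases hdich s hs with ⟨h, -⟩ | ⟨h, hG⟩
      · exact h
      · exact absurd hRS (hG.not_regularSingular h)
    · rcases hs with ⟨-, h⟩ | ⟨h, -⟩
      · exact h
      · exact absurd hRS h
    · exact Or.inl ⟨hRS, hs⟩
  -- With positive slope the standard bundle is irregular, so both sides of the equivalence of
  -- regular singularity fail.
  · have hRS := hG.not_regularSingular hq1
    refine ⟨⟨q, fun s => ⟨fun hs => ?_, fun hs => hs ▸ hq⟩, fun s => ⟨fun hs => ?_, fun hs => ?_⟩⟩,
      fun h => h V (AlgRep.std k V), fun h => absurd h hRS⟩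
    · rcases hdich s hs with ⟨-, h⟩ | ⟨-, h⟩
      · exact absurd h hRS
      · exact h.unique hG
    · rcases hs with ⟨h, -⟩ | ⟨-, -, -, h⟩
      · exact absurd h hRS
      · exact FlatConn.GrowthRate.unique (D := P.assoc (AlgRep.std k V)) (r := s) h hG
    · exact Or.inr ⟨hRS, hs ▸ hq1, ⟨q, hs.symm⟩, hs ▸ hG⟩
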